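/- Let $b\ge 0$ and $R=(R_1,R_2)$ with $R_1,R_2>0$, and let $\Omega_R=\left]-\tfrac{R_1}{2},\tfrac{R_1}{2}\right[\times\left]-\tfrac{R_2}{2},\tfrac{R_2}{2}\right[\subset\mathbb R^2$, with area $|\Omega_R|=R_1R_2$. Let $H_{D,b}^{\Omega_R}$ be the Dirichlet realization in $L^2(\Omega_R)$ of $$\left(D_x-b\tfrac y2\right)^2+\left(D_y+b\tfrac x2\right)^2,\qquad D_x=\tfrac1i\partial_x,\quad D_y=\tfrac1i\partial_y,$$ that is, the self-adjoint operator associated with the closure of the quadratic form $u\mapsto\int_{\Omega_R}\left(|(D_x-b\tfrac y2)u|^2+|(D_y+b\tfrac x2)u|^2\right)dx\,dy$ on $C_0^\infty(\Omega_R)$. Let $N(\lambda,H_{D,b}^{\Omega_R})$ denote the number of its eigenvalues in $]-\infty,\lambda[$, counted with multiplicity. Here $\mathbb N=\{0,1,2,\dots\}$. (i) For all $b>0$, all $R$ and all $\lambda>1$, $$N(\lambda,H_{D,b}^{\Omega_R})\le\frac{b|\Omega_R|}{2\pi}\,\#\{n\in\mathbb N:\ (2n+1)b<\lambda\}.$$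 (ii) There is a constant $C_0>0$ such that, for all $b,\lambda,R$ with $0<b<\lambda$ and $1\le\sqrt b\,\min(R_1,R_2)$, and for all $\epsilon\in\,]0,1]$, $$(1-\epsilon)^2\frac{b|\Omega_R|}{2\pi}\,\#\Big\{n\in\mathbb N:\ (2n+1)b<\lambda-\frac{C_0}{(\epsilon\min(R_1,R_2))^2}\Big\}\le N(\lambda,H_{D,b}^{\Omega_R}).$$ (iii) For every $c_0>0$ there is a constant $C_0>0$, depending only on $c_0$, such that, for all $b,\lambda,R$ with $0\le b\le\lambda$ and $1\le c_0\sqrt b\,R_j$ for $j=1,2$, $$\frac{|\Omega_R|}{4\pi}\lambda\left[1-C_0\frac{\sqrt b}{\sqrt\lambda}\right]\le N(\lambda,H_{D,b}^{\Omega_R})\le\frac{|\Omega_R|}{4\pi}\lambda\left[1+C_0\frac{\sqrt b}{\sqrt\lambda}\right].$$ -/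

import Mathlib

open MeasureTheory Set
open scoped ENNReal ContDiff

noncomputable section

namespace MagneticRectangle

/-- The open rectangle `]-R₁/2, R₁/2[ × ]-R₂/2, R₂/2[`. -/
def rectangle (R₁ R₂ : ℝ) : Set (ℝ × ℝ) :=
  Ioo (-(R₁ / 2)) (R₁ / 2) ×ˢ Ioo (-(R₂ / 2)) (R₂ / 2)

/-- The complex Hilbert space `L²(Ω)`, for Lebesgue measure on `Ω ⊆ ℝ²`. -/
abbrev L2 (Ω : Set (ℝ × ℝ)) : Type :=
  Lp ℂ 2 ((volume : Measure (ℝ × ℝ)).restrict Ω)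

/-- `φ ∈ C₀^∞(Ω)`: smooth, complex valued, with compact support contained in `Ω`. -/
structure IsTestFunction (Ω : Set (ℝ × ℝ)) (φ : ℝ × ℝ → ℂ) : Prop where
  smooth : ContDiff ℝ ∞ φ
  compact : HasCompactSupport φ
  support : tsupport φ ⊆ Ω

/-- `(D_x - b y / 2) φ`, where `D_x = (1/i) ∂_x`. -/
def momentumX (b : ℝ) (φ : ℝ × ℝ → ℂ) (p : ℝ × ℝ) : ℂ :=
  (1 / Complex.I) * fderiv ℝ φ p (1, 0) - ((b * p.2 / 2 : ℝ) : ℂ) * φ p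

/-- `(D_y + b x / 2) φ`, where `D_y = (1/i) ∂_y`. -/
def momentumY (b : ℝ) (φ : ℝ × ℝ → ℂ) (p : ℝ × ℝ) : ℂ :=
  (1 / Complex.I) * fderiv ℝ φ p (0, 1) + ((b * p.1 / 2 : ℝ) : ℂ) * φ p

theorem IsTestFunction.zero (Ω : Set (ℝ × ℝ)) : IsTestFunction Ω (fun _ => 0) where
  smooth := contDiff_const
  compact := HasCompactSupport.zero
  support := by
    have h : tsupport (fun _ : ℝ × ℝ => (0 : ℂ)) = ∅ :=
      tsupport_eq_empty_iff.2 rfl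
    rw [h]; exact empty_subset _

theorem IsTestFunction.add {Ω : Set (ℝ × ℝ)} {φ ψ : ℝ × ℝ → ℂ}
    (hφ : IsTestFunction Ω φ) (hψ : IsTestFunction Ω ψ) :
    IsTestFunction Ω (fun p => φ p + ψ p) where
  smooth := hφ.smooth.add hψ.smooth
  compact := hφ.compact.add hψ.compact
  support := (tsupport_add φ ψ).trans (union_subset hφ.support hψ.support)

theorem IsTestFunction.const_mul {Ω : Set (ℝ × ℝ)} {φ : ℝ × ℝ → ℂ}
    (hφ : IsTestFunction Ω φ) (c : ℂ) : IsTestFunction Ω (fun p => c * φ p) where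
  smooth := contDiff_const.mul hφ.smooth
  compact := hφ.compact.mul_left
  support := (tsupport_mul_subset_right (f := fun _ => c) (g := φ)).trans hφ.support

theorem IsTestFunction.differentiableAt {Ω : Set (ℝ × ℝ)} {φ : ℝ × ℝ → ℂ}
    (hφ : IsTestFunction Ω φ) (p : ℝ × ℝ) : DifferentiableAt ℝ φ p :=
  (hφ.smooth.differentiable (by simp)) p

/-- All triples `(φ, (D_x - b y / 2) φ, (D_y + b x / 2) φ)` with `φ ∈ C₀^∞(Ω)`, as elements of
`L²(Ω)³`. -/
def testGraph (b : ℝ) (Ω : Set (ℝ × ℝ)) : Submodule ℂ (L2 Ω × L2 Ω × L2 Ω) where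
  carrier := {w | ∃ φ, IsTestFunction Ω φ ∧ w.1 =ᵐ[volume.restrict Ω] φ ∧
    w.2.1 =ᵐ[volume.restrict Ω] momentumX b φ ∧ w.2.2 =ᵐ[volume.restrict Ω] momentumY b φ}
  zero_mem' := by
    refine ⟨fun _ => 0, IsTestFunction.zero Ω, Lp.coeFn_zero _ _ _, ?_, ?_⟩
    · refine (Lp.coeFn_zero _ _ _).trans (Filter.EventuallyEq.of_eq ?_)
      funext p; simp [momentumX]
    · refine (Lp.coeFn_zero _ _ _).trans (Filter.EventuallyEq.of_eq ?_)
      funext p; simp [momentumY]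
  add_mem' := by
    rintro w w' ⟨φ, hφ, h0, h1, h2⟩ ⟨ψ, hψ, k0, k1, k2⟩
    refine ⟨fun p => φ p + ψ p, hφ.add hψ, ?_, ?_, ?_⟩
    · filter_upwards [Lp.coeFn_add w.1 w'.1, h0, k0] with p hp h k
      simp only [Prod.fst_add]; rw [hp, Pi.add_apply, h, k]
    · filter_upwards [Lp.coeFn_add w.2.1 w'.2.1, h1, k1] with p hp h k
      simp only [Prod.fst_add, Prod.snd_add]
      rw [hp, Pi.add_apply, h, k]
      simp only [momentumX]
      rw [fderiv_fun_add (hφ.differentiableAt p) (hψ.differentiableAt p)]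
      simp only [add_apply]; ring
    · filter_upwards [Lp.coeFn_add w.2.2 w'.2.2, h2, k2] with p hp h k
      simp only [Prod.snd_add]
      rw [hp, Pi.add_apply, h, k]
      simp only [momentumY]
      rw [fderiv_fun_add (hφ.differentiableAt p) (hψ.differentiableAt p)]
      simp only [add_apply]; ring
  smul_mem' := by
    rintro c w ⟨φ, hφ, h0, h1, h2⟩
    refine ⟨fun p => c * φ p, hφ.const_mul c, ?_, ?_, ?_⟩
    · filter_upwards [Lp.coeFn_smul c w.1, h0] with p hp h
      simp only [Prod.smul_fst]; rw [hp, Pi.smul_apply, h, smul_eq_mul]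
    · filter_upwards [Lp.coeFn_smul c w.2.1, h1] with p hp h
      simp only [Prod.smul_fst, Prod.smul_snd]
      rw [hp, Pi.smul_apply, h]
      simp only [momentumX]
      rw [fderiv_const_mul (hφ.differentiableAt p)]
      simp only [smul_apply, smul_eq_mul]; ring
    · filter_upwards [Lp.coeFn_smul c w.2.2, h2] with p hp h
      simp only [Prod.smul_snd]
      rw [hp, Pi.smul_apply, h]
      simp only [momentumY]
      rw [fderiv_const_mul (hφ.differentiableAt p)]
      simp only [smul_apply, smul_eq_mul]; ring

/-- The closure in `L²(Ω)³` of the triples `(φ, (D_x - b y / 2) φ, (D_y + b x / 2) φ)`,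
`φ ∈ C₀^∞(Ω)`. Its first components form the domain of the Dirichlet form (the Sobolev space
`W₀¹(Ω)` if `Ω` is bounded), the other two are the magnetic derivatives of the first. -/
def formGraph (b : ℝ) (Ω : Set (ℝ × ℝ)) : Submodule ℂ (L2 Ω × L2 Ω × L2 Ω) :=
  (testGraph b Ω).topologicalClosure

/-- The graph of the operator of the closed quadratic form
`u ↦ ‖(D_x - b y / 2) u‖² + ‖(D_y + b x / 2) u‖²`: the pairs `(u, f)` such that `u` lies in the
form domain and `q(v, u) = ⟪v, f⟫` for all `v` in the form domain. -/
def operatorGraph (b : ℝ) (Ω : Set (ℝ × ℝ)) : Submodule ℂ (L2 Ω × L2 Ω) where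
  carrier := {z | ∃ g ∈ formGraph b Ω, g.1 = z.1 ∧ ∀ w ∈ formGraph b Ω,
    inner ℂ w.2.1 g.2.1 + inner ℂ w.2.2 g.2.2 = inner ℂ w.1 z.2}
  zero_mem' := ⟨0, zero_mem _, rfl, fun w _ => by simp⟩
  add_mem' := by
    rintro z z' ⟨g, hg, h1, h2⟩ ⟨g', hg', h1', h2'⟩
    refine ⟨g + g', add_mem hg hg', by simp [h1, h1'], fun w hw => ?_⟩
    simp only [Prod.fst_add, Prod.snd_add, inner_add_right]
    rw [← h2 w hw, ← h2' w hw]; ring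
  smul_mem' := by
    rintro c z ⟨g, hg, h1, h2⟩
    refine ⟨c • g, Submodule.smul_mem _ _ hg, by simp [h1], fun w hw => ?_⟩
    simp only [Prod.smul_fst, Prod.smul_snd, inner_smul_right]
    rw [← h2 w hw]; ring

theorem IsTestFunction.exists_mem_testGraph {Ω : Set (ℝ × ℝ)} {φ : ℝ × ℝ → ℂ}
    (hφ : IsTestFunction Ω φ) (b : ℝ) :
    ∃ w ∈ testGraph b Ω, w.1 =ᵐ[volume.restrict Ω] φ := by
  have hd : ∀ v : ℝ × ℝ, Continuous fun p => fderiv ℝ φ p v := fun v =>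
    (hφ.smooth.continuous_fderiv (by simp)).clm_apply continuous_const
  have hc : ∀ v : ℝ × ℝ, HasCompactSupport fun p => fderiv ℝ φ p v := fun v =>
    hφ.compact.fderiv_apply (𝕜 := ℝ) v
  have h0 : MemLp φ 2 (volume.restrict Ω) :=
    (hφ.smooth.continuous.memLp_of_hasCompactSupport hφ.compact).restrict Ω
  have h1 : MemLp (momentumX b φ) 2 (volume.restrict Ω) := by
    refine (Continuous.memLp_of_hasCompactSupport ?_ ?_).restrict Ω
    · have := hφ.smooth.continuous
      have := hd (1, 0)
      unfold momentumX
      fun_prop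
    · exact ((hc (1, 0)).mul_left (f := fun _ => 1 / Complex.I)).sub (hφ.compact.mul_left
        (f := fun p : ℝ × ℝ => ((b * p.2 / 2 : ℝ) : ℂ)))
  have h2 : MemLp (momentumY b φ) 2 (volume.restrict Ω) := by
    refine (Continuous.memLp_of_hasCompactSupport ?_ ?_).restrict Ω
    · have := hφ.smooth.continuous
      have := hd (0, 1)
      unfold momentumY
      fun_prop
    · exact ((hc (0, 1)).mul_left (f := fun _ => 1 / Complex.I)).add (hφ.compact.mul_left
        (f := fun p : ℝ × ℝ => ((b * p.1 / 2 : ℝ) : ℂ)))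
  exact ⟨(h0.toLp, h1.toLp, h2.toLp),
    ⟨φ, hφ, h0.coeFn_toLp, h1.coeFn_toLp, h2.coeFn_toLp⟩, h0.coeFn_toLp⟩

/-- The relation `operatorGraph` is single valued, so it is the graph of an operator. -/
theorem operatorGraph_singleValued (b : ℝ) {Ω : Set (ℝ × ℝ)} (hΩ : IsOpen Ω) :
    ∀ z ∈ operatorGraph b Ω, z.1 = 0 → z.2 = 0 := by
  rintro z ⟨g, hg, hz, hw⟩ h0
  have hg1 : g.1 = 0 := hz.trans h0
  have hgg := hw g hg
  rw [hg1, inner_zero_left, inner_self_eq_norm_sq_to_K, inner_self_eq_norm_sq_to_K] at hgg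
  have hgg' : ‖g.2.1‖ ^ 2 + ‖g.2.2‖ ^ 2 = 0 := by
    refine Complex.ofReal_eq_zero.1 ?_
    push_cast
    exact hgg
  have e1 : g.2.1 = 0 := by
    rw [← norm_eq_zero]; nlinarith [sq_nonneg ‖g.2.1‖, sq_nonneg ‖g.2.2‖]
  have e2 : g.2.2 = 0 := by
    rw [← norm_eq_zero]; nlinarith [sq_nonneg ‖g.2.1‖, sq_nonneg ‖g.2.2‖]
  have key : ∀ φ, IsTestFunction Ω φ →
      ∫ p in Ω, inner ℂ (φ p) ((z.2 : ℝ × ℝ → ℂ) p) = 0 := by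
    intro φ hφ
    obtain ⟨w, hwm, hwφ⟩ := hφ.exists_mem_testGraph b
    have h := hw w ((testGraph b Ω).le_topologicalClosure hwm)
    rw [e1, e2, inner_zero_right, inner_zero_right, add_zero, L2.inner_def] at h
    rw [h]
    refine integral_congr_ae ?_
    filter_upwards [hwφ] with p hp
    rw [hp]
  have hloc : LocallyIntegrableOn (z.2 : ℝ × ℝ → ℂ) Ω volume := by
    refine (locallyIntegrableOn_iff hΩ.isLocallyClosed).2 fun K hK hKc => ?_
    have hm : MemLp (z.2 : ℝ × ℝ → ℂ) 2 (volume.restrict K) :=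
      (Lp.memLp z.2).mono_measure (Measure.restrict_mono hK le_rfl)
    have : IsFiniteMeasure (volume.restrict K : Measure (ℝ × ℝ)) :=
      ⟨by simpa using hKc.measure_lt_top⟩
    exact hm.integrable (by norm_num)
  have hae := hΩ.ae_eq_zero_of_integral_contDiff_smul_eq_zero hloc (fun φ h1 h2 h3 => by
    have ht : tsupport (fun p => (φ p : ℂ)) ⊆ Ω :=
      (closure_mono (fun p hp => by
        simpa [Function.mem_support] using hp)).trans h3
    have hφ : IsTestFunction Ω (fun p => (φ p : ℂ)) :=
      ⟨Complex.ofRealCLM.contDiff.comp h1, h2.comp_left Complex.ofReal_zero, ht⟩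
    have h := key _ hφ
    rw [setIntegral_eq_integral_of_forall_compl_eq_zero] at h
    · rw [← h]
      refine integral_congr_ae (Filter.Eventually.of_forall fun p => ?_)
      simp [mul_comm]
    · intro p hp
      have : φ p = 0 := image_eq_zero_of_notMem_tsupport fun hp' => hp (h3 hp')
      simp [this])
  refine Lp.ext ?_
  have hae' := (ae_restrict_iff' hΩ.measurableSet).2 hae
  filter_upwards [hae', Lp.coeFn_zero ℂ 2 (volume.restrict Ω)] with p hp hp0
  rw [hp, hp0, Pi.zero_apply]

/-- The Dirichlet realization in `L²(Ω)` of `(D_x - b y / 2)² + (D_y + b x / 2)²`, as an unbounded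
operator. -/
def dirichletOperator (b : ℝ) (Ω : Set (ℝ × ℝ)) : L2 Ω →ₗ.[ℂ] L2 Ω :=
  (operatorGraph b Ω).toLinearPMap

theorem dirichletOperator_graph (b : ℝ) {Ω : Set (ℝ × ℝ)} (hΩ : IsOpen Ω) :
    (dirichletOperator b Ω).graph = operatorGraph b Ω :=
  Submodule.toLinearPMap_graph_eq _ (operatorGraph_singleValued b hΩ)

/-- The eigenspace `{u ∈ dom P | P u = μ u}` of an unbounded operator (zero if `μ` is not an
eigenvalue). -/
def eigenspace {E : Type*} [NormedAddCommGroup E] [NormedSpace ℂ E] (P : E →ₗ.[ℂ] E) (μ : ℝ) :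
    Submodule ℂ E where
  carrier := {u | ∃ h : u ∈ P.domain, P ⟨u, h⟩ = (μ : ℂ) • u}
  zero_mem' := ⟨zero_mem _, by
    rw [smul_zero]; exact P.map_zero⟩
  add_mem' := by
    rintro u v ⟨hu, hu'⟩ ⟨hv, hv'⟩
    refine ⟨add_mem hu hv, ?_⟩
    rw [smul_add, ← hu', ← hv']; exact P.map_add ⟨u, hu⟩ ⟨v, hv⟩
  smul_mem' := by
    rintro c u ⟨hu, hu'⟩
    refine ⟨Submodule.smul_mem _ c hu, ?_⟩
    rw [smul_comm, ← hu']; exact P.map_smul c ⟨u, hu⟩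

/-- `N(t, P)`: the number (possibly `∞`) of eigenvalues of `P` in `]-∞, t[`, counted with
multiplicity. -/
def eigenvalueCount {E : Type*} [NormedAddCommGroup E] [NormedSpace ℂ E]
    (P : E →ₗ.[ℂ] E) (t : ℝ) : ℝ≥0∞ :=
  ∑' μ : Iio t, ((Module.rank ℂ (eigenspace P μ)).toENat : ℝ≥0∞)

/-- The number of Landau levels `(2n+1)b`, `n ∈ ℕ`, below `t`. -/
def landauCount (b t : ℝ) : ℕ := Set.ncard {n : ℕ | (2 * (n : ℝ) + 1) * b < t}

end MagneticRectangle

end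

open MagneticRectangle

noncomputable section

namespace MagneticRectangle

/-! ### Counting dimensions of independent families of subspaces -/

/-! The counting function equals the dimension of `lowSpace`, the span of the eigenvectors with
eigenvalue below `t`. That space is controlled from both sides: its nonzero vectors have energy
strictly less than `t` times their squared norm (`exists_energy_lt_of_mem_lowSpace`), while
form-domain vectors orthogonal to it have energy at least `t` times their squared norm
(`FormCompact.le_energy_of_orthogonal`). The second fact is the direct method of the calculus of
variations. It needs compactness, which here takes the form of a finite-rank estimate.

Upper bound (i). Lay `n` functions on the rectangle side by side along the first axis. The magnetic
translations involved are phases, and they become the frequency offset `b i R₁` of a Fourier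
transform in `y`. Each function vanishes outside one period in `y`, so Parseval holds for every
offset and no flux quantization is needed. For each mode `2πm/R₂` the glued function has the energy
of a harmonic oscillator on the line centred at `-2πm/(b R₂)`, whose levels are `(2k+1)b`. Modes
centred further than `√t/b` from the strip cost at least `t` anyway. Hence `n` copies of `lowSpace`
embed into a coefficient space whose dimension is (number of near modes) times (number of levels
below `t`). Dividing by `n → ∞` removes the boundary modes and leaves the sharp constant
(`oscillator_inequality_tiles`, `tiled_form_inequality`, `mul_finrank_lowSpace_le`).

Lower bound (ii). The same strip is used in the opposite direction. Combinations of Landau states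
are cut into tiles by functions whose squared translates sum to one, so localization adds only the
squared derivatives of the cutoffs, of order `(ε min R)⁻²`. Each piece is moved back to the
rectangle. If the trial space had more dimensions than (number of tiles) times the dimension of
`lowSpace`, some combination would have every piece orthogonal to `lowSpace`, hence total energy at
least `t` times its mass, which contradicts the choice of levels. Dividing by the number of tiles
again gives the result (`card_le_card_mul_finrank_lowSpace`, `landau_le_finrank_lowSpace`).

Weyl bounds (iii). The upper one follows from (i), since the number of levels is at most `(t/b +
1)/2`. For the lower one the rectangle is split into cells of side at most `b^(-1/2)`. With the
gauge centred in each cell the vector potential is of order `√b`, so Dirichlet sines are good trial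
functions. Splitting the square with weight `δ = √(b/t)` and counting lattice points in a quarter
ellipse gives a relative error of order `√(b/t)` (`card_le_finrank_lowSpace_of_sines`,
`exists_lattice_points`). -/

theorem tsum_rank_eq_finrank_iSup {ι X : Type*} [AddCommGroup X] [Module ℂ X]
    (p : ι → Submodule ℂ X) (hp : iSupIndep p) [hfd : FiniteDimensional ℂ (⨆ i, p i : Submodule ℂ X)] :
    ∑' i, ((Module.rank ℂ (p i)).toENat : ℝ≥0∞) =
      ((Module.finrank ℂ (⨆ i, p i : Submodule ℂ X) : ℕ) : ℝ≥0∞) := by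
  classical
  have hfi : ∀ i, FiniteDimensional ℂ (p i) := fun i =>
    Submodule.finiteDimensional_of_le (le_iSup p i)
  have hrank : ∀ i, ((Module.rank ℂ (p i)).toENat : ℝ≥0∞) = (Module.finrank ℂ (p i) : ℕ) := by
    intro i
    rw [← Module.finrank_eq_rank ℂ (p i), Cardinal.toENat_nat]
    rfl
  have hsum : ∀ s : Finset ι, Module.finrank ℂ (⨆ i ∈ s, p i : Submodule ℂ X) =
      ∑ i ∈ s, Module.finrank ℂ (p i) := by
    intro s
    induction s using Finset.induction_on with
    | empty =>
      have : (⨆ i ∈ (∅ : Finset ι), p i) = ⊥ := by simp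
      rw [this, finrank_bot, Finset.sum_empty]
    | insert a s ha ih =>
      have hfs : FiniteDimensional ℂ (⨆ i ∈ s, p i : Submodule ℂ X) :=
        Submodule.finiteDimensional_of_le (iSup₂_le fun i _ => le_iSup p i)
      rw [Finset.iSup_insert, Finset.sum_insert ha, ← ih]
      have hd : Disjoint (p a) (⨆ i ∈ s, p i) :=
        (hp a).mono_right (iSup₂_le fun i hi => le_iSup₂_of_le i (ne_of_mem_of_not_mem hi ha) le_rfl)
      have := Submodule.finrank_sup_add_finrank_inf_eq (p a) (⨆ i ∈ s, p i)
      rw [hd.eq_bot, finrank_bot, add_zero] at this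
      exact this
  simp_rw [hrank]
  apply le_antisymm
  · rw [ENNReal.tsum_eq_iSup_sum]
    refine iSup_le fun s => ?_
    rw [← Nat.cast_sum, ← hsum s]
    exact_mod_cast Submodule.finrank_mono (iSup₂_le fun i _ => le_iSup p i)
  -- A finitely generated supremum is a compact element of the lattice, so finitely many members of
  -- the family already attain it.
  · have hfg : (⨆ i, p i).FG := (Submodule.fg_top _).1 hfd.fg_top
    have hc : IsCompactElement (⨆ i, p i) := (Submodule.fg_iff_compact _).1 hfg
    obtain ⟨s, hs⟩ := CompleteLattice.IsCompactElement.exists_finset_of_le_iSup _ hc p le_rfl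
    have he : (⨆ i, p i) = ⨆ i ∈ s, p i := le_antisymm hs (iSup₂_le fun i _ => le_iSup p i)
    calc ((Module.finrank ℂ (⨆ i, p i : Submodule ℂ X) : ℕ) : ℝ≥0∞)
        = ∑ i ∈ s, ((Module.finrank ℂ (p i) : ℕ) : ℝ≥0∞) := by
          rw [he, hsum s]; simp
      _ ≤ _ := ENNReal.sum_le_tsum s

/-! ### Quadratic forms given by a closed graph -/

section Form

variable {H : Type*} [NormedAddCommGroup H]

/-- The sum of the squares of the norms of the last two components. -/
def energy (g : H × H × H) : ℝ := ‖g.2.1‖ ^ 2 + ‖g.2.2‖ ^ 2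

theorem energy_nonneg (g : H × H × H) : 0 ≤ energy g := by unfold energy; positivity

theorem continuous_energy : Continuous (energy : H × H × H → ℝ) := by
  unfold energy; fun_prop

variable [InnerProductSpace ℂ H]

/-- The sesquilinear form on `H × H × H` that only sees the last two components. -/
def formInner (w g : H × H × H) : ℂ := inner ℂ w.2.1 g.2.1 + inner ℂ w.2.2 g.2.2

theorem formInner_self (g : H × H × H) : formInner g g = (energy g : ℂ) := by
  simp [formInner, energy, inner_self_eq_norm_sq_to_K]

theorem formInner_conj (w g : H × H × H) :
    (starRingEnd ℂ) (formInner w g) = formInner g w := by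
  simp [formInner]

theorem formInner_add_right (w g h : H × H × H) :
    formInner w (g + h) = formInner w g + formInner w h := by
  simp only [formInner, Prod.fst_add, Prod.snd_add, inner_add_right]; ring

theorem formInner_add_left (w g h : H × H × H) :
    formInner (g + h) w = formInner g w + formInner h w := by
  simp only [formInner, Prod.fst_add, Prod.snd_add, inner_add_left]; ring

theorem formInner_smul_right (c : ℂ) (w g : H × H × H) :
    formInner w (c • g) = c * formInner w g := by
  simp only [formInner, Prod.smul_fst, Prod.smul_snd, inner_smul_right]; ring

theorem formInner_smul_left (c : ℂ) (w g : H × H × H) :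
    formInner (c • w) g = (starRingEnd ℂ) c * formInner w g := by
  simp only [formInner, Prod.smul_fst, Prod.smul_snd, inner_smul_left]; ring

theorem formInner_sum_right {ι : Type*} (s : Finset ι) (w : H × H × H) (g : ι → H × H × H) :
    formInner w (∑ i ∈ s, g i) = ∑ i ∈ s, formInner w (g i) := by
  simp only [formInner, Prod.fst_sum, Prod.snd_sum, inner_sum, Finset.sum_add_distrib]

theorem energy_smul (c : ℂ) (g : H × H × H) : energy (c • g) = ‖c‖ ^ 2 * energy g := by
  simp only [energy, Prod.smul_fst, Prod.smul_snd, norm_smul]; ring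

theorem energy_parallelogram (g h : H × H × H) :
    energy (g + h) + energy (g - h) = 2 * (energy g + energy h) := by
  have h1 := parallelogram_law_with_norm ℂ g.2.1 h.2.1
  have h2 := parallelogram_law_with_norm ℂ g.2.2 h.2.2
  simp only [energy, Prod.fst_add, Prod.snd_add, Prod.fst_sub, Prod.snd_sub]
  linarith

/-- The eigenspace of the operator associated with the form whose graph is `G`. -/
def formEigenspace (G : Submodule ℂ (H × H × H)) (μ : ℝ) : Submodule ℂ H where
  carrier := {u | ∃ g ∈ G, g.1 = u ∧ ∀ w ∈ G, formInner w g = μ * inner ℂ w.1 u}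
  zero_mem' := ⟨0, zero_mem _, rfl, fun w _ => by simp [formInner]⟩
  add_mem' := by
    rintro u v ⟨g, hg, h1, h2⟩ ⟨g', hg', h1', h2'⟩
    refine ⟨g + g', add_mem hg hg', by simp [h1, h1'], fun w hw => ?_⟩
    rw [formInner_add_right, h2 w hw, h2' w hw, inner_add_right]; ring
  smul_mem' := by
    rintro c u ⟨g, hg, h1, h2⟩
    refine ⟨c • g, Submodule.smul_mem _ _ hg, by simp [h1], fun w hw => ?_⟩
    rw [formInner_smul_right, h2 w hw, inner_smul_right]; ring

/-- The span of the eigenvectors with eigenvalue below `t`. -/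
def lowSpace (G : Submodule ℂ (H × H × H)) (t : ℝ) : Submodule ℂ H :=
  ⨆ μ : Iio t, formEigenspace G μ

theorem inner_formEigenspace_eq_zero {G : Submodule ℂ (H × H × H)} {μ ν : ℝ} (hμν : μ ≠ ν)
    {u v : H} (hu : u ∈ formEigenspace G μ) (hv : v ∈ formEigenspace G ν) : inner ℂ u v = 0 := by
  obtain ⟨g, hg, rfl, h2⟩ := hu
  obtain ⟨k, hk, rfl, k2⟩ := hv
  have e1 := k2 g hg
  have e2 := h2 k hk
  rw [← formInner_conj, e1] at e2
  simp only [map_mul, Complex.conj_ofReal, inner_conj_symm] at e2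
  have e3 : ((ν : ℂ) - μ) * inner ℂ k.1 g.1 = 0 := by rw [sub_mul, e2, sub_self]
  have hne : ((ν : ℂ) - μ) ≠ 0 := sub_ne_zero.2 (by exact_mod_cast hμν.symm)
  have e4 := (mul_eq_zero.1 e3).resolve_left hne
  rw [← inner_conj_symm, e4, map_zero]

theorem orthogonalFamily_formEigenspace (G : Submodule ℂ (H × H × H)) (t : ℝ) :
    OrthogonalFamily ℂ (fun μ : Iio t => formEigenspace G μ)
      (fun μ => (formEigenspace G μ).subtypeₗᵢ) := by
  intro μ ν hne u v
  exact inner_formEigenspace_eq_zero (fun h => hne (Subtype.ext h)) u.2 v.2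

/-- Eigenspaces are mutually orthogonal for the inner product and for the form, so the energy of `∑
f i` is `∑ i ‖f i‖²`, with every weight `i < t`. -/
theorem exists_energy_lt_of_mem_lowSpace {G : Submodule ℂ (H × H × H)} {t : ℝ} {u : H}
    (hu : u ∈ lowSpace G t) (hu0 : u ≠ 0) :
    ∃ g ∈ G, g.1 = u ∧ energy g < t * ‖u‖ ^ 2 := by
  classical
  rw [lowSpace, Submodule.mem_iSup_iff_exists_finsupp] at hu
  obtain ⟨f, hf, hfu⟩ := hu
  choose g hg hgf hgw using hf
  rw [Finsupp.sum] at hfu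
  have hinner : ∀ i ∈ f.support, inner ℂ u (f i) = ((‖f i‖ ^ 2 : ℝ) : ℂ) := by
    intro i hi
    rw [← hfu, sum_inner, Finset.sum_eq_single i]
    · simp [inner_self_eq_norm_sq_to_K]
    · intro j _ hj
      exact inner_formEigenspace_eq_zero (G := G) (fun h => hj (Subtype.ext h))
        ⟨g j, hg j, hgf j, hgw j⟩ ⟨g i, hg i, hgf i, hgw i⟩
    · intro h; exact absurd hi h
  have hgG : ∑ i ∈ f.support, g i ∈ G := Submodule.sum_mem _ fun i _ => hg i
  have hg1 : (∑ i ∈ f.support, g i).1 = u := by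
    rw [Prod.fst_sum, ← hfu]; exact Finset.sum_congr rfl fun i _ => hgf i
  refine ⟨∑ i ∈ f.support, g i, hgG, hg1, ?_⟩
  have hE : energy (∑ i ∈ f.support, g i) = ∑ i ∈ f.support, (i : ℝ) * ‖f i‖ ^ 2 := by
    apply Complex.ofReal_injective
    rw [← formInner_self]
    nth_rewrite 2 [show (∑ i ∈ f.support, g i) = ∑ i ∈ f.support, g i from rfl]
    rw [formInner_sum_right]
    push_cast
    refine Finset.sum_congr rfl fun i hi => ?_
    rw [hgw i _ hgG, hg1, hinner i hi]
    push_cast; ring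
  have hN : ‖u‖ ^ 2 = ∑ i ∈ f.support, ‖f i‖ ^ 2 := by
    apply Complex.ofReal_injective
    have : ((‖u‖ ^ 2 : ℝ) : ℂ) = inner ℂ u u := by simp [inner_self_eq_norm_sq_to_K]
    rw [this]
    nth_rewrite 2 [← hfu]
    rw [inner_sum]
    push_cast
    refine Finset.sum_congr rfl fun i hi => ?_
    rw [hinner i hi]; push_cast; rfl
  rw [hE, hN, Finset.mul_sum]
  have hne : f.support.Nonempty := by
    rw [Finset.nonempty_iff_ne_empty]
    intro h; rw [h] at hfu; exact hu0 (by simpa using hfu.symm)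
  refine Finset.sum_lt_sum_of_nonempty hne fun i hi => ?_
  have : f i ≠ 0 := Finsupp.mem_support_iff.1 hi
  have : 0 < ‖f i‖ := norm_pos_iff.2 this
  exact mul_lt_mul_of_pos_right i.2 (by positivity)

/-- Up to a finite-rank correction the form dominates every multiple of the squared norm; this
is how compactness of the resolvent enters. -/
def FormCompact (G : Submodule ℂ (H × H × H)) : Prop :=
  ∀ T : ℝ, 0 < T → ∃ (n : ℕ) (e : Fin n → H), ∀ g ∈ G,
    T * ‖g.1‖ ^ 2 ≤ energy g + T * ∑ j, ‖inner ℂ (e j) g.1‖ ^ 2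

theorem FormCompact.finiteDimensional_lowSpace {G : Submodule ℂ (H × H × H)}
    (hc : FormCompact G) (t : ℝ) : FiniteDimensional ℂ (lowSpace G t) := by
  -- The maximum with `1` supplies a positive parameter. The vectors `e j` then separate the points
  -- of `lowSpace`: a common zero would have energy at least `t ‖u‖²`.
  obtain ⟨n, e, he⟩ := hc (max t 1) (by positivity)
  let φ : lowSpace G t →ₗ[ℂ] (Fin n → ℂ) :=
    LinearMap.pi fun j => (innerSL ℂ (e j)).toLinearMap ∘ₗ (lowSpace G t).subtype
  refine FiniteDimensional.of_injective φ (LinearMap.ker_eq_bot.1 ?_)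
  rw [LinearMap.ker_eq_bot']
  intro u hu
  by_contra h0
  obtain ⟨g, hg, hgu, hlt⟩ := exists_energy_lt_of_mem_lowSpace u.2
    (fun h => h0 (Subtype.ext h))
  have h1 := he g hg
  have h2 : ∀ j, inner ℂ (e j) g.1 = 0 := fun j => by
    rw [hgu]; exact congrFun hu j
  simp only [h2, norm_zero, ne_eq, OfNat.ofNat_ne_zero, not_false_eq_true, zero_pow,
    Finset.sum_const_zero, mul_zero, add_zero] at h1
  rw [hgu] at h1
  have := mul_le_mul_of_nonneg_right (le_max_left t 1) (sq_nonneg ‖(u : H)‖)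
  linarith

/-- The form of an eigenvector against `w` is a multiple of their inner product, so low vectors
decouple from the orthogonal complement. This is what extends an Euler–Lagrange equation from the
complement to the whole form domain. -/
theorem exists_lift_of_mem_lowSpace {G : Submodule ℂ (H × H × H)} {t : ℝ} {u : H}
    (hu : u ∈ lowSpace G t) :
    ∃ g ∈ G, g.1 = u ∧ ∀ w ∈ G, (∀ v ∈ lowSpace G t, inner ℂ v w.1 = 0) → formInner w g = 0 := by
  induction hu using Submodule.iSup_induction' with
  | mem μ u hu =>
    obtain ⟨g, hg, hgu, h⟩ := hu
    refine ⟨g, hg, hgu, fun w hw hw0 => ?_⟩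
    have : u ∈ lowSpace G t := le_iSup (fun μ : Iio t => formEigenspace G μ) μ
      ⟨g, hg, hgu, h⟩
    rw [h w hw, ← inner_conj_symm, hw0 u this, map_zero, mul_zero]
  | zero => exact ⟨0, zero_mem _, rfl, fun w _ _ => by simp [formInner]⟩
  | add u v _ _ ihu ihv =>
    obtain ⟨g, hg, hgu, h⟩ := ihu
    obtain ⟨k, hk, hkv, h'⟩ := ihv
    refine ⟨g + k, add_mem hg hk, by simp [hgu, hkv], fun w hw hw0 => ?_⟩
    rw [formInner_add_right, h w hw hw0, h' w hw hw0, add_zero]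

/-- A minimizing sequence for a closed form on a subspace has a convergent subsequence. -/
theorem exists_minimizer [CompleteSpace H] {G K : Submodule ℂ (H × H × H)}
    (hc : FormCompact G) (hK : IsClosed (K : Set (H × H × H))) (hKG : K ≤ G)
    {μ : ℝ} (hμ : 0 ≤ μ) (hlow : ∀ g ∈ K, μ * ‖g.1‖ ^ 2 ≤ energy g)
    (hseq : ∀ δ > 0, ∃ g ∈ K, ‖g.1‖ = 1 ∧ energy g < μ + δ) :
    ∃ g ∈ K, ‖g.1‖ = 1 ∧ energy g = μ := by
  choose! g hgK hg1 hge using fun k : ℕ => hseq (1 / ((k : ℝ) + 1)) (by positivity)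
  -- The parameter exceeds `μ` by one: after the parallelogram bound `hpair` cancels `μ ‖·‖²`, a
  -- full `‖·‖²` remains to be estimated by the finitely many coefficients.
  obtain ⟨n, e, he⟩ := hc (μ + 1) (by positivity)
  let a : ℕ → Fin n → ℂ := fun k j => inner ℂ (e j) (g k).1
  have hab : ∀ k, a k ∈ Metric.closedBall (0 : Fin n → ℂ) (∑ j, ‖e j‖) := by
    intro k
    rw [mem_closedBall_zero_iff, pi_norm_le_iff_of_nonneg (by positivity)]
    intro j
    calc ‖inner ℂ (e j) (g k).1‖ ≤ ‖e j‖ * ‖(g k).1‖ := norm_inner_le_norm _ _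
      _ = ‖e j‖ := by rw [hg1, mul_one]
      _ ≤ ∑ j, ‖e j‖ := Finset.single_le_sum (f := fun j => ‖e j‖) (fun _ _ => norm_nonneg _)
          (Finset.mem_univ j)
  obtain ⟨a₀, -, φ, hφ, hlim⟩ := tendsto_subseq_of_bounded Metric.isBounded_closedBall hab
  have hδ : ∀ k, energy (g (φ k)) < μ + 1 / ((k : ℝ) + 1) := by
    intro k
    refine (hge (φ k)).trans_le ?_
    have : (k : ℝ) ≤ φ k := by exact_mod_cast hφ.id_le k
    gcongr
  -- The parallelogram law applies both to the energy and to the norm; the sum of two near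
  -- minimizers has energy at least `μ` times its squared norm.
  have hpair : ∀ k l, energy (g (φ k) - g (φ l)) ≤ μ * ‖(g (φ k)).1 - (g (φ l)).1‖ ^ 2 +
      2 * (1 / ((k : ℝ) + 1) + 1 / ((l : ℝ) + 1)) := by
    intro k l
    have h1 := energy_parallelogram (g (φ k)) (g (φ l))
    have h2 := hlow _ (add_mem (hgK (φ k)) (hgK (φ l)))
    have h3 := parallelogram_law_with_norm ℂ (g (φ k)).1 (g (φ l)).1
    rw [hg1, hg1] at h3
    rw [Prod.fst_add] at h2
    have h4 := hδ k
    have h5 := hδ l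
    have h6 : μ * (‖(g (φ k)).1 + (g (φ l)).1‖ ^ 2 + ‖(g (φ k)).1 - (g (φ l)).1‖ ^ 2)
      = μ * 4 := by congr 1; linarith
    linarith
  have hca : CauchySeq (a ∘ φ) := hlim.cauchySeq
  have hsmall : ∀ ε > 0, ∃ N, ∀ k ≥ N, ∀ l ≥ N, ‖(g (φ k)).1 - (g (φ l)).1‖ ^ 2 < ε ∧
      2 * (1 / ((k : ℝ) + 1) + 1 / ((l : ℝ) + 1)) < ε := by
    intro ε hε
    obtain ⟨N₁, hN₁⟩ := exists_nat_one_div_lt (show 0 < ε / 8 by positivity)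
    obtain ⟨δ, hδ0, hδε⟩ : ∃ δ > 0, (μ + 1) * (n * δ ^ 2) < ε / 4 := by
      refine ⟨√(ε / (8 * ((μ + 1) * (n + 1)))), by positivity, ?_⟩
      rw [Real.sq_sqrt (by positivity)]
      have : (μ + 1) * (n * (ε / (8 * ((μ + 1) * (n + 1))))) = ε / 8 * (n / (n + 1)) := by
        field_simp
      rw [this]
      have h1 : (n : ℝ) / (n + 1) ≤ 1 := by
        rw [div_le_one (by positivity)]; linarith
      nlinarith
    obtain ⟨N₂, hN₂⟩ := Metric.cauchySeq_iff.1 hca δ hδ0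
    refine ⟨max N₁ N₂, fun k hk l hl => ?_⟩
    have hk1 : 1 / ((k : ℝ) + 1) < ε / 8 := lt_of_le_of_lt (by
      have : (N₁ : ℝ) ≤ k := by exact_mod_cast (le_max_left _ _).trans hk
      gcongr) hN₁
    have hl1 : 1 / ((l : ℝ) + 1) < ε / 8 := lt_of_le_of_lt (by
      have : (N₁ : ℝ) ≤ l := by exact_mod_cast (le_max_left _ _).trans hl
      gcongr) hN₁
    refine ⟨?_, by linarith⟩
    have h1 := he _ (hKG (sub_mem (hgK (φ k)) (hgK (φ l))))
    rw [Prod.fst_sub] at h1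
    have h2 := hpair k l
    have h3 : ∑ j, ‖inner ℂ (e j) ((g (φ k)).1 - (g (φ l)).1)‖ ^ 2 ≤ n * δ ^ 2 := by
      calc _ ≤ ∑ _j : Fin n, δ ^ 2 := by
            refine Finset.sum_le_sum fun j _ => ?_
            have := hN₂ k ((le_max_right _ _).trans hk) l ((le_max_right _ _).trans hl)
            have h4 := (dist_le_pi_dist (a (φ k)) (a (φ l)) j).trans this.le
            rw [dist_eq_norm] at h4
            rw [inner_sub_right]
            gcongr
        _ = n * δ ^ 2 := by simp
    have h4 := mul_le_mul_of_nonneg_left h3 (show 0 ≤ μ + 1 by positivity)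
    linarith
  have hcs : CauchySeq (fun k => g (φ k)) := by
    rw [Metric.cauchySeq_iff]
    intro ε hε
    -- With this tolerance the energy of a difference is below `ε² (μ + 1)/(μ + 2)`, hence below
    -- `ε²`. So the sequence is Cauchy in all three components of the graph.
    obtain ⟨N, hN⟩ := hsmall (ε ^ 2 / (μ + 2)) (by positivity)
    refine ⟨N, fun k hk l hl => ?_⟩
    obtain ⟨h1, h2⟩ := hN k hk l hl
    have h3 := hpair k l
    have hb : ε ^ 2 / (μ + 2) ≤ ε ^ 2 := div_le_self (by positivity) (by linarith)
    have hE : energy (g (φ k) - g (φ l)) < ε ^ 2 := by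
      have h4 := mul_le_mul_of_nonneg_left h1.le hμ
      have h5 : μ * (ε ^ 2 / (μ + 2)) + ε ^ 2 / (μ + 2) = ε ^ 2 / (μ + 2) * (μ + 1) := by ring
      have h6 : ε ^ 2 / (μ + 2) * (μ + 1) ≤ ε ^ 2 / (μ + 2) * (μ + 2) := by gcongr; linarith
      rw [div_mul_cancel₀ _ (by positivity)] at h6
      linarith
    unfold energy at hE
    rw [dist_eq_norm, Prod.norm_def, Prod.norm_def, max_lt_iff, max_lt_iff]
    refine ⟨lt_of_pow_lt_pow_left₀ 2 hε.le (by rw [Prod.fst_sub]; linarith),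
      lt_of_pow_lt_pow_left₀ 2 hε.le (by nlinarith [sq_nonneg ‖(g (φ k) - g (φ l)).2.2‖]),
      lt_of_pow_lt_pow_left₀ 2 hε.le (by nlinarith [sq_nonneg ‖(g (φ k) - g (φ l)).2.1‖])⟩
  obtain ⟨g₀, hg₀⟩ := cauchySeq_tendsto_of_complete hcs
  have hmem : g₀ ∈ K := hK.mem_of_tendsto hg₀ (Filter.Eventually.of_forall fun k => hgK _)
  have hn : ‖g₀.1‖ = 1 := by
    have h1 : Filter.Tendsto (fun k => ‖(g (φ k)).1‖) Filter.atTop (nhds ‖g₀.1‖) :=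
      ((continuous_fst.norm).tendsto g₀).comp hg₀
    simp only [hg1] at h1
    exact tendsto_nhds_unique h1 tendsto_const_nhds
  refine ⟨g₀, hmem, hn, le_antisymm ?_ ?_⟩
  · have h1 := (continuous_energy.tendsto g₀).comp hg₀
    have h2 : Filter.Tendsto (fun k : ℕ => μ + 1 / ((k : ℝ) + 1)) Filter.atTop (nhds (μ + 0)) :=
      tendsto_one_div_add_atTop_nhds_zero_nat.const_add μ
    rw [add_zero] at h2
    exact le_of_tendsto_of_tendsto' h1 h2 fun k => (hδ k).le
  · simpa [hn] using hlow g₀ hmem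

/-- First-variation argument: for small positive `s` the linear term would dominate and make the
expression negative. -/
theorem eq_zero_of_nonneg_quadratic {a B : ℝ} (ha : 0 ≤ a)
    (h : ∀ s : ℝ, 0 ≤ -2 * s * a + s ^ 2 * (a * B)) : a = 0 := by
  by_contra hne
  have hpos : 0 < a := lt_of_le_of_ne ha (Ne.symm hne)
  have h1 := h (1 / (|B| + 1))
  have h2 : -2 * (1 / (|B| + 1)) * a + (1 / (|B| + 1)) ^ 2 * (a * B) =
      a * (1 / (|B| + 1)) * (-2 + B / (|B| + 1)) := by field_simp
  rw [h2] at h1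
  have h3 : B / (|B| + 1) < 1 := by
    rw [div_lt_one (by positivity)]; linarith [le_abs_self B]
  have : 0 < a * (1 / (|B| + 1)) := by positivity
  nlinarith

/-- Variational principle: the form is at least `t` on the orthogonal complement of the
eigenvectors with eigenvalue below `t`. -/
theorem FormCompact.le_energy_of_orthogonal [CompleteSpace H] {G : Submodule ℂ (H × H × H)}
    (hc : FormCompact G) (hG : IsClosed (G : Set (H × H × H))) {t : ℝ} {g₁ : H × H × H}
    (hg₁ : g₁ ∈ G) (horth : ∀ v ∈ lowSpace G t, inner ℂ v g₁.1 = 0) :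
    t * ‖g₁.1‖ ^ 2 ≤ energy g₁ := by
  by_contra! hlt
  -- The energy is minimized over unit vectors of this closed subspace. If the infimum were below
  -- `t`, the minimizer would be an eigenvector belonging to `lowSpace` and orthogonal to it.
  let K : Submodule ℂ (H × H × H) :=
    G ⊓ (lowSpace G t)ᗮ.comap (LinearMap.fst ℂ H (H × H))
  have hKmem : ∀ g, g ∈ K ↔ g ∈ G ∧ ∀ v ∈ lowSpace G t, inner ℂ v g.1 = 0 := by
    intro g
    simp [K, Submodule.mem_orthogonal]
  have hK : IsClosed (K : Set (H × H × H)) := by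
    have : (K : Set (H × H × H)) = (G : Set (H × H × H)) ∩
        Prod.fst ⁻¹' ((lowSpace G t)ᗮ : Set H) := by ext; simp [K]
    rw [this]
    exact hG.inter ((Submodule.isClosed_orthogonal _).preimage continuous_fst)
  have hn1 : 0 < ‖g₁.1‖ := by
    rw [norm_pos_iff]
    intro h
    rw [h] at hlt
    simp only [norm_zero, ne_eq, OfNat.ofNat_ne_zero, not_false_eq_true, zero_pow, mul_zero] at hlt
    exact absurd hlt (not_lt.2 (energy_nonneg _))
  let S : Set ℝ := {r | ∃ g ∈ K, ‖g.1‖ = 1 ∧ energy g = r}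
  have hnormalize : ∀ g ∈ K, 0 < ‖g.1‖ → energy g / ‖g.1‖ ^ 2 ∈ S := by
    intro g hg hp
    refine ⟨((‖g.1‖⁻¹ : ℝ) : ℂ) • g, Submodule.smul_mem _ _ hg, ?_, ?_⟩
    · rw [Prod.smul_fst, norm_smul]; simp [hp.ne']
    · rw [energy_smul]; simp; field_simp
  have hbdd : BddBelow S := ⟨0, by rintro _ ⟨g, _, _, rfl⟩; exact energy_nonneg g⟩
  have hne : S.Nonempty := ⟨_, hnormalize g₁ ((hKmem _).2 ⟨hg₁, horth⟩) hn1⟩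
  have hμ0 : 0 ≤ sInf S := le_csInf hne (by rintro _ ⟨g, _, _, rfl⟩; exact energy_nonneg g)
  have hμt : sInf S < t := by
    refine (csInf_le hbdd (hnormalize g₁ ((hKmem _).2 ⟨hg₁, horth⟩) hn1)).trans_lt ?_
    rw [div_lt_iff₀ (by positivity)]; exact hlt
  have hlow : ∀ g ∈ K, sInf S * ‖g.1‖ ^ 2 ≤ energy g := by
    intro g hg
    rcases (norm_nonneg g.1).eq_or_lt with h | h
    · rw [← h]; simpa using energy_nonneg g
    · rw [← le_div_iff₀ (by positivity)]
      exact csInf_le hbdd (hnormalize g hg h)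
  obtain ⟨g, hgK, hgn, hge⟩ := exists_minimizer hc hK inf_le_left hμ0 hlow (by
    intro δ hδ
    obtain ⟨_, ⟨g, hg, hg1, rfl⟩, hlt⟩ := exists_lt_of_csInf_lt hne
      (show sInf S < sInf S + δ by linarith)
    exact ⟨g, hg, hg1, hlt⟩)
  set μ := sInf S
  have hEL : ∀ w ∈ K, formInner w g = μ * inner ℂ w.1 g.1 := by
    intro w hw
    set F : ℂ := formInner w g - μ * inner ℂ w.1 g.1 with hF
    -- Varying in the direction `-s F w` aligns the phase with that of `F`, so the linear term is
    -- `-2 s ‖F‖²` and a real parameter suffices.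
    have hquad : ∀ s : ℝ, 0 ≤ -2 * s * ‖F‖ ^ 2 + s ^ 2 * (‖F‖ ^ 2 *
        (energy w - μ * ‖w.1‖ ^ 2)) := by
      intro s
      have h1 := hlow _ (add_mem hgK (Submodule.smul_mem K (-(s : ℂ) * F) hw))
      have key : ((energy (g + (-(s : ℂ) * F) • w) - μ * ‖(g + (-(s : ℂ) * F) • w).1‖ ^ 2 : ℝ) : ℂ)
          = ((-2 * s * ‖F‖ ^ 2 + s ^ 2 * (‖F‖ ^ 2 * (energy w - μ * ‖w.1‖ ^ 2)) : ℝ) : ℂ) := by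
        have hn : ∀ x : H, ((‖x‖ : ℂ)) ^ 2 = inner ℂ x x := fun x => by
          simp [inner_self_eq_norm_sq_to_K]
        have hFF : ((‖F‖ : ℂ)) ^ 2 = (starRingEnd ℂ) F * F := by
          rw [← Complex.normSq_eq_conj_mul_self, Complex.normSq_eq_norm_sq]; push_cast; rfl
        have hFc : (starRingEnd ℂ) F = formInner g w - μ * inner ℂ g.1 w.1 := by
          simp [hF, formInner_conj]
        push_cast
        rw [← formInner_self, ← formInner_self, hn, hn, hFF, Prod.fst_add, Prod.smul_fst]
        simp only [formInner_add_left, formInner_add_right, formInner_smul_left,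
          formInner_smul_right, inner_add_left, inner_add_right, inner_smul_left,
          inner_smul_right, map_mul, map_neg, Complex.conj_ofReal]
        have hgg : formInner g g = μ * inner ℂ g.1 g.1 := by
          rw [formInner_self, hge, ← hn, hgn]; simp
        rw [hgg]
        have e1 : formInner w g = F + μ * inner ℂ w.1 g.1 := by rw [hF]; ring
        have e2 : formInner g w = (starRingEnd ℂ) F + μ * inner ℂ g.1 w.1 := by rw [hFc]; ring
        rw [e1, e2]
        ring
      have key' := Complex.ofReal_injective key
      rw [← key']
      linarith
    have := eq_zero_of_nonneg_quadratic (sq_nonneg ‖F‖) hquad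
    have h0 : F = 0 := by simpa using this
    exact sub_eq_zero.1 (hF ▸ h0)
  have hfd := hc.finiteDimensional_lowSpace t
  have hmem : g.1 ∈ formEigenspace G μ := by
    refine ⟨g, ((hKmem g).1 hgK).1, rfl, fun w hw => ?_⟩
    -- An arbitrary `w` is split into a lift `k` of its projection to `lowSpace`, which contributes
    -- nothing against `g`, and a remainder in `K`, where the equation is known.
    obtain ⟨k, hk, hk1, hk0⟩ := exists_lift_of_mem_lowSpace (G := G) (t := t)
      (u := (lowSpace G t).starProjection w.1) (Submodule.starProjection_apply_mem _ _)
    have hwk : w - k ∈ K := by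
      rw [hKmem]
      refine ⟨sub_mem hw hk, fun v hv => ?_⟩
      rw [Prod.fst_sub, hk1]
      exact (Submodule.mem_orthogonal _ _).1 (Submodule.sub_starProjection_mem_orthogonal w.1) v hv
    have e1 := hEL _ hwk
    have e2 : formInner k g = 0 := by
      rw [← formInner_conj, hk0 g ((hKmem g).1 hgK).1 ((hKmem g).1 hgK).2, map_zero]
    have e3 : inner ℂ k.1 g.1 = 0 := by
      rw [hk1]; exact ((hKmem g).1 hgK).2 _ (Submodule.starProjection_apply_mem _ _)
    have : w = (w - k) + k := by abel
    rw [this, formInner_add_left, e1, e2, Prod.fst_add, inner_add_left, e3]; ring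
  have h0 := ((hKmem g).1 hgK).2 g.1
    (le_iSup (fun μ : Iio t => formEigenspace G μ) ⟨μ, hμt⟩ hmem)
  rw [inner_self_eq_zero] at h0
  rw [h0, norm_zero] at hgn
  exact zero_ne_one hgn

end Form

/-! ### The eigenvalue count as a dimension -/

theorem eigenspace_dirichletOperator (b : ℝ) {Ω : Set (ℝ × ℝ)} (hΩ : IsOpen Ω) (μ : ℝ) :
    eigenspace (dirichletOperator b Ω) μ = formEigenspace (formGraph b Ω) μ := by
  have hgraph := dirichletOperator_graph b hΩ
  ext u
  have h1 : u ∈ eigenspace (dirichletOperator b Ω) μ ↔ (u, (μ : ℂ) • u) ∈ operatorGraph b Ω := by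
    rw [← hgraph, LinearPMap.mem_graph_iff]
    constructor
    · rintro ⟨h, h'⟩; exact ⟨⟨u, h⟩, rfl, h'⟩
    · rintro ⟨⟨y, hy⟩, hyu, h'⟩
      change y = u at hyu
      subst hyu
      exact ⟨hy, h'⟩
  rw [h1]
  constructor
  · rintro ⟨g, hg, hgu, h⟩
    refine ⟨g, hg, hgu, fun w hw => ?_⟩
    rw [formInner, h w hw, inner_smul_right]
  · rintro ⟨g, hg, hgu, h⟩
    refine ⟨g, hg, hgu, fun w hw => ?_⟩
    have := h w hw
    rw [formInner] at this
    rw [this, inner_smul_right]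

theorem eigenvalueCount_eq_finrank (b : ℝ) {Ω : Set (ℝ × ℝ)} (hΩ : IsOpen Ω) (t : ℝ)
    (hc : FormCompact (formGraph b Ω)) :
    eigenvalueCount (dirichletOperator b Ω) t =
      ((Module.finrank ℂ (lowSpace (formGraph b Ω) t) : ℕ) : ℝ≥0∞) := by
  have hfd : FiniteDimensional ℂ (⨆ μ : Iio t, formEigenspace (formGraph b Ω) (μ : ℝ) :
    Submodule ℂ (L2 Ω)) := hc.finiteDimensional_lowSpace t
  rw [eigenvalueCount, lowSpace, ← tsum_rank_eq_finrank_iSup _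
    (orthogonalFamily_formEigenspace (formGraph b Ω) t).independent]
  exact tsum_congr fun μ => by rw [eigenspace_dirichletOperator b hΩ]

/-! ### Hermite functions -/

open Polynomial in
/-- The Hermite polynomials for the weight `exp (-b x²)`, normalized by
`p₀ = 1`, `pₙ₊₁ = 2 b x pₙ - pₙ'`. -/
def hermitePoly (b : ℝ) : ℕ → Polynomial ℝ
  | 0 => 1
  | n + 1 => C (2 * b) * X * hermitePoly b n - derivative (hermitePoly b n)

/-- A polynomial times the Gaussian `exp (-b x² / 2)`. -/
def gaussPoly (b : ℝ) (p : Polynomial ℝ) (x : ℝ) : ℝ := p.eval x * Real.exp (-(b / 2) * x ^ 2)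

open Polynomial in
theorem derivative_hermitePoly_succ (b : ℝ) (n : ℕ) :
    derivative (hermitePoly b (n + 1)) = C (2 * b * ((n : ℝ) + 1)) * hermitePoly b n := by
  induction n with
  | zero => simp [hermitePoly]
  | succ n ih =>
    rw [hermitePoly, derivative_sub, ih]
    simp only [derivative_mul, derivative_C, derivative_X, zero_mul, mul_one, zero_add]
    rw [ih]
    have : C (2 * b) * X * (C (2 * b * ((n : ℝ) + 1)) * hermitePoly b n) -
        C (2 * b * ((n : ℝ) + 1)) * derivative (hermitePoly b n) =
        C (2 * b * ((n : ℝ) + 1)) * hermitePoly b (n + 1) := by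
      rw [hermitePoly]; ring
    have h2 : C (2 * b * (((n + 1 : ℕ) : ℝ) + 1)) = C (2 * b) + C (2 * b * ((n : ℝ) + 1)) := by
      rw [← C_add]; congr 1; push_cast; ring
    rw [h2, add_mul, ← this]
    ring

theorem integrable_polynomial_mul_gaussian {c : ℝ} (hc : 0 < c) (p : Polynomial ℝ) :
    Integrable (fun x : ℝ => p.eval x * Real.exp (-c * x ^ 2)) := by
  induction p using Polynomial.induction_on' with
  | add p q hp hq =>
    simp only [Polynomial.eval_add, add_mul]; exact hp.add hq
  | monomial n a =>
    have h := (integrable_rpow_mul_exp_neg_mul_sq hc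
      (s := (n : ℝ)) (by linarith [(Nat.cast_nonneg n : (0 : ℝ) ≤ n)])).const_mul a
    refine h.congr (Filter.Eventually.of_forall fun x => ?_)
    simp [mul_assoc]

theorem gaussPoly_mul (b : ℝ) (p q : Polynomial ℝ) (x : ℝ) :
    gaussPoly b p x * gaussPoly b q x = (p * q).eval x * Real.exp (-b * x ^ 2) := by
  unfold gaussPoly
  rw [Polynomial.eval_mul]
  have : Real.exp (-b * x ^ 2) =
      Real.exp (-(b / 2) * x ^ 2) * Real.exp (-(b / 2) * x ^ 2) := by
    rw [← Real.exp_add]; ring_nf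
  rw [this]; ring

theorem continuous_gaussPoly (b : ℝ) (p : Polynomial ℝ) : Continuous (gaussPoly b p) := by
  unfold gaussPoly; fun_prop

theorem contDiff_gaussPoly (b : ℝ) (p : Polynomial ℝ) : ContDiff ℝ ∞ (gaussPoly b p) := by
  unfold gaussPoly
  exact (p.contDiff_aeval ∞).mul (Real.contDiff_exp.comp (by fun_prop))

theorem integrable_gaussPoly_mul {b : ℝ} (hb : 0 < b) (p q : Polynomial ℝ) :
    Integrable (fun x => gaussPoly b p x * gaussPoly b q x) := by
  simp_rw [gaussPoly_mul]; exact integrable_polynomial_mul_gaussian hb _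

open Polynomial in
theorem hasDerivAt_gaussPoly (b : ℝ) (p : Polynomial ℝ) (x : ℝ) :
    HasDerivAt (gaussPoly b p) (gaussPoly b (derivative p - C b * X * p) x) x := by
  unfold gaussPoly
  have h1 : HasDerivAt (fun y : ℝ => -(b / 2) * y ^ 2) (-(b / 2) * (2 * x)) x := by
    have := (hasDerivAt_pow 2 x).const_mul (-(b / 2))
    simpa using this
  refine ((p.hasDerivAt x).fun_mul h1.exp).congr_deriv ?_
  simp
  ring

-- For the weight `exp (-b x²)` the raising map `p ↦ 2 b x p - p'` is the adjoint of
-- differentiation: the difference of the two integrands is a total derivative.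
open Polynomial in
theorem integral_gaussPoly_adjoint {b : ℝ} (hb : 0 < b) (p q : Polynomial ℝ) :
    ∫ x, gaussPoly b (C (2 * b) * X * p - derivative p) x * gaussPoly b q x =
      ∫ x, gaussPoly b p x * gaussPoly b (derivative q) x := by
  have hd : ∀ x, HasDerivAt (fun x => gaussPoly b p x * gaussPoly b q x)
      (gaussPoly b p x * gaussPoly b (derivative q) x -
        gaussPoly b (C (2 * b) * X * p - derivative p) x * gaussPoly b q x) x := by
    intro x
    refine ((hasDerivAt_gaussPoly b p x).fun_mul (hasDerivAt_gaussPoly b q x)).congr_deriv ?_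
    unfold gaussPoly
    simp
    ring
  have h := integral_eq_zero_of_hasDerivAt_of_integrable hd
    ((integrable_gaussPoly_mul hb _ _).sub (integrable_gaussPoly_mul hb _ _))
    (integrable_gaussPoly_mul hb _ _)
  rw [integral_sub (integrable_gaussPoly_mul hb _ _) (integrable_gaussPoly_mul hb _ _)] at h
  linarith

theorem gaussPoly_C_mul (b c : ℝ) (p : Polynomial ℝ) (x : ℝ) :
    gaussPoly b (Polynomial.C c * p) x = c * gaussPoly b p x := by
  unfold gaussPoly; simp; ring

/-- The unnormalized inner products of Hermite functions. -/
theorem integral_hermitePoly_succ_succ {b : ℝ} (hb : 0 < b) (n m : ℕ) :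
    ∫ x, gaussPoly b (hermitePoly b (n + 1)) x * gaussPoly b (hermitePoly b (m + 1)) x =
      2 * b * ((m : ℝ) + 1) *
        ∫ x, gaussPoly b (hermitePoly b n) x * gaussPoly b (hermitePoly b m) x := by
  have := integral_gaussPoly_adjoint hb (hermitePoly b n) (hermitePoly b (m + 1))
  rw [derivative_hermitePoly_succ] at this
  rw [hermitePoly, this, ← integral_const_mul]
  refine integral_congr_ae (Filter.Eventually.of_forall fun x => ?_)
  simp only [gaussPoly_C_mul]; ring

theorem integral_hermitePoly_succ_zero {b : ℝ} (hb : 0 < b) (n : ℕ) :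
    ∫ x, gaussPoly b (hermitePoly b (n + 1)) x * gaussPoly b (hermitePoly b 0) x = 0 := by
  have := integral_gaussPoly_adjoint hb (hermitePoly b n) (hermitePoly b 0)
  rw [show hermitePoly b (n + 1) = Polynomial.C (2 * b) * Polynomial.X * hermitePoly b n -
    Polynomial.derivative (hermitePoly b n) from rfl, this]
  simp [hermitePoly, gaussPoly]

theorem integral_hermitePoly_of_ne {b : ℝ} (hb : 0 < b) {n m : ℕ} (h : n ≠ m) :
    ∫ x, gaussPoly b (hermitePoly b n) x * gaussPoly b (hermitePoly b m) x = 0 := by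
  induction n generalizing m with
  | zero =>
    obtain ⟨m, rfl⟩ := Nat.exists_eq_succ_of_ne_zero h.symm
    simp_rw [mul_comm (gaussPoly b (hermitePoly b 0) _)]
    exact integral_hermitePoly_succ_zero hb m
  | succ n ih =>
    cases m with
    | zero => exact integral_hermitePoly_succ_zero hb n
    | succ m =>
      rw [integral_hermitePoly_succ_succ hb, ih (fun e => h (by rw [e])), mul_zero]

/-- The squared `L²` norm of the `n`-th unnormalized Hermite function. -/
def hermiteNormSq (b : ℝ) (n : ℕ) : ℝ :=
  ∫ x, gaussPoly b (hermitePoly b n) x * gaussPoly b (hermitePoly b n) x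

theorem hermiteNormSq_succ {b : ℝ} (hb : 0 < b) (n : ℕ) :
    hermiteNormSq b (n + 1) = 2 * b * ((n : ℝ) + 1) * hermiteNormSq b n :=
  integral_hermitePoly_succ_succ hb n n

theorem hermiteNormSq_pos {b : ℝ} (hb : 0 < b) (n : ℕ) : 0 < hermiteNormSq b n := by
  induction n with
  | zero =>
    unfold hermiteNormSq
    simp_rw [gaussPoly_mul, hermitePoly]
    simp only [mul_one, Polynomial.eval_one, one_mul]
    rw [integral_gaussian]
    positivity
  | succ n ih => rw [hermiteNormSq_succ hb]; positivity

/-- The normalized Hermite functions of the harmonic oscillator `-d²/dx² + b² x²`. -/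
def hermiteFun (b : ℝ) (n : ℕ) (x : ℝ) : ℝ :=
  gaussPoly b (hermitePoly b n) x / √(hermiteNormSq b n)

/-- The derivative of `hermiteFun`. -/
def hermiteFunDeriv (b : ℝ) (n : ℕ) (x : ℝ) : ℝ :=
  gaussPoly b (Polynomial.derivative (hermitePoly b n) -
    Polynomial.C b * Polynomial.X * hermitePoly b n) x / √(hermiteNormSq b n)

theorem continuous_hermiteFun (b : ℝ) (n : ℕ) : Continuous (hermiteFun b n) :=
  (continuous_gaussPoly b _).div_const _

theorem continuous_hermiteFunDeriv (b : ℝ) (n : ℕ) : Continuous (hermiteFunDeriv b n) :=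
  (continuous_gaussPoly b _).div_const _

theorem contDiff_hermiteFun (b : ℝ) (n : ℕ) : ContDiff ℝ ∞ (hermiteFun b n) :=
  (contDiff_gaussPoly b _).div_const _

theorem hasDerivAt_hermiteFun (b : ℝ) (n : ℕ) (x : ℝ) :
    HasDerivAt (hermiteFun b n) (hermiteFunDeriv b n x) x :=
  (hasDerivAt_gaussPoly b _ x).div_const _

theorem integrable_hermiteFun_mul {b : ℝ} (hb : 0 < b) (n m : ℕ) :
    Integrable (fun x => hermiteFun b n x * hermiteFun b m x) := by
  refine ((integrable_gaussPoly_mul hb (hermitePoly b n) (hermitePoly b m)).div_const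
    (√(hermiteNormSq b n) * √(hermiteNormSq b m))).congr (Filter.Eventually.of_forall fun x => ?_)
  simp only [hermiteFun]; rw [div_mul_div_comm]

theorem integral_hermiteFun_mul {b : ℝ} (hb : 0 < b) (n m : ℕ) :
    ∫ x, hermiteFun b n x * hermiteFun b m x = if n = m then 1 else 0 := by
  have : ∀ x, hermiteFun b n x * hermiteFun b m x =
      gaussPoly b (hermitePoly b n) x * gaussPoly b (hermitePoly b m) x /
      (√(hermiteNormSq b n) * √(hermiteNormSq b m)) := fun x => by
    simp only [hermiteFun]; rw [div_mul_div_comm]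
  simp_rw [this]
  rw [integral_div]
  split_ifs with h
  · subst h
    rw [Real.mul_self_sqrt (hermiteNormSq_pos hb n).le]
    exact div_self (hermiteNormSq_pos hb n).ne'
  · rw [integral_hermitePoly_of_ne hb h, zero_div]

theorem integrable_hermite_energy {b : ℝ} (hb : 0 < b) (n m : ℕ) :
    Integrable (fun x => hermiteFunDeriv b n x * hermiteFunDeriv b m x +
      (b * x) ^ 2 * (hermiteFun b n x * hermiteFun b m x)) := by
  have h1 := (integrable_gaussPoly_mul hb (Polynomial.derivative (hermitePoly b n) -
    Polynomial.C b * Polynomial.X * hermitePoly b n) (Polynomial.derivative (hermitePoly b m) -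
    Polynomial.C b * Polynomial.X * hermitePoly b m)).div_const
    (√(hermiteNormSq b n) * √(hermiteNormSq b m))
  have h2 := (integrable_gaussPoly_mul hb (Polynomial.C b * Polynomial.X * hermitePoly b n)
    (Polynomial.C b * Polynomial.X * hermitePoly b m)).div_const
    (√(hermiteNormSq b n) * √(hermiteNormSq b m))
  refine (h1.add h2).congr (Filter.Eventually.of_forall fun x => ?_)
  simp only [Pi.add_apply, hermiteFun, hermiteFunDeriv]
  rw [div_mul_div_comm, div_mul_div_comm]
  congr 1
  rw [← mul_div_assoc]
  congr 1
  simp [gaussPoly]; ring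

/-- Up to the total derivative of `b x hₙ hₘ`, the energy density is `b hₙ hₘ` plus the product of
the differentiated polynomials with the Gaussian. The lowering relation turns the latter into `2 n
b` on the diagonal and zero elsewhere. -/
theorem integral_hermite_energy {b : ℝ} (hb : 0 < b) (n m : ℕ) :
    ∫ x, (hermiteFunDeriv b n x * hermiteFunDeriv b m x +
      (b * x) ^ 2 * (hermiteFun b n x * hermiteFun b m x)) =
      if n = m then (2 * (n : ℝ) + 1) * b else 0 := by
  open Polynomial in
  set N := √(hermiteNormSq b n) * √(hermiteNormSq b m) with hN
  set P := hermitePoly b n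
  set Q := hermitePoly b m
  have hpt : ∀ x, hermiteFunDeriv b n x * hermiteFunDeriv b m x +
      (b * x) ^ 2 * (hermiteFun b n x * hermiteFun b m x) =
      (gaussPoly b (derivative P) x * gaussPoly b (derivative Q) x) / N +
      b * (hermiteFun b n x * hermiteFun b m x) -
      (b * (gaussPoly b P x * gaussPoly b Q x) +
        b * x * (gaussPoly b (derivative P - C b * X * P) x * gaussPoly b Q x
        + gaussPoly b P x * gaussPoly b (derivative Q - C b * X * Q) x)) / N := by
    intro x
    simp only [hermiteFun, hermiteFunDeriv]
    rw [div_mul_div_comm, div_mul_div_comm, ← hN, ← mul_div_assoc, ← mul_div_assoc, ← add_div,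
      ← add_div, ← sub_div]
    congr 1
    simp [gaussPoly, P, Q]; ring
  have hd : ∀ x, HasDerivAt (fun x => b * x * (gaussPoly b P x * gaussPoly b Q x))
      (b * (gaussPoly b P x * gaussPoly b Q x) +
        b * x * (gaussPoly b (derivative P - C b * X * P) x * gaussPoly b Q x
        + gaussPoly b P x * gaussPoly b (derivative Q - C b * X * Q) x)) x := by
    intro x
    refine (((hasDerivAt_id x).const_mul b).fun_mul
      ((hasDerivAt_gaussPoly b P x).fun_mul (hasDerivAt_gaussPoly b Q x))).congr_deriv ?_
    simp
  have hi1 : Integrable (fun x => b * x * (gaussPoly b P x * gaussPoly b Q x)) := by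
    refine (integrable_gaussPoly_mul hb (C b * X * P) Q).congr
      (Filter.Eventually.of_forall fun x => ?_)
    simp [gaussPoly]; ring
  have hi2 : Integrable (fun x => (b * (gaussPoly b P x * gaussPoly b Q x) +
        b * x * (gaussPoly b (derivative P - C b * X * P) x * gaussPoly b Q x
        + gaussPoly b P x * gaussPoly b (derivative Q - C b * X * Q) x))) := by
    refine (((integrable_gaussPoly_mul hb P Q).const_mul b).add
      ((integrable_gaussPoly_mul hb (C b * X * (derivative P - C b * X * P)) Q).add
       (integrable_gaussPoly_mul hb (C b * X * P) (derivative Q - C b * X * Q)))).congr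
      (Filter.Eventually.of_forall fun x => ?_)
    simp [gaussPoly]; ring
  have h0 := integral_eq_zero_of_hasDerivAt_of_integrable hd hi2 hi1
  simp_rw [hpt]
  rw [integral_sub (f := fun x => gaussPoly b (derivative P) x * gaussPoly b (derivative Q) x / N +
    b * (hermiteFun b n x * hermiteFun b m x)) ((((integrable_gaussPoly_mul hb _ _).div_const N).add
    ((integrable_hermiteFun_mul hb n m).const_mul b))) (hi2.div_const N), integral_div N,
    h0, zero_div, sub_zero, integral_add ((integrable_gaussPoly_mul hb _ _).div_const N)
    ((integrable_hermiteFun_mul hb n m).const_mul b), integral_div, integral_const_mul,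
    integral_hermiteFun_mul hb]
  have hder : (∫ x, gaussPoly b (derivative P) x * gaussPoly b (derivative Q) x) =
      if n = m then 2 * b * n * hermiteNormSq b n else 0 := by
    simp only [P, Q]
    cases n with
    | zero =>
      simp only [hermitePoly, gaussPoly]
      simp
    | succ n =>
      cases m with
      | zero => simp [hermitePoly, gaussPoly]
      | succ m =>
        rw [derivative_hermitePoly_succ, derivative_hermitePoly_succ]
        simp_rw [gaussPoly_C_mul]
        have : ∀ x, 2 * b * ((n : ℝ) + 1) * gaussPoly b (hermitePoly b n) x *
            (2 * b * ((m : ℝ) + 1) * gaussPoly b (hermitePoly b m) x) =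
            2 * b * ((n : ℝ) + 1) * (2 * b * ((m : ℝ) + 1)) *
            (gaussPoly b (hermitePoly b n) x * gaussPoly b (hermitePoly b m) x) :=
          fun x => by ring
        simp_rw [this]
        rw [integral_const_mul]
        by_cases h : n = m
        · subst h
          rw [if_pos rfl, hermiteNormSq_succ hb]
          unfold hermiteNormSq
          push_cast; ring
        · rw [if_neg (by omega), integral_hermitePoly_of_ne hb h, mul_zero]
  rw [hder]
  split_ifs with h
  · subst h
    rw [hN, Real.mul_self_sqrt (hermiteNormSq_pos hb n).le]
    have := (hermiteNormSq_pos hb n).ne'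
    field_simp
  · simp

/-! ### Completeness of the Hermite functions -/

theorem memLp_gaussPoly {b : ℝ} (hb : 0 < b) (p : Polynomial ℝ) :
    MemLp (fun x => (gaussPoly b p x : ℂ)) 2 volume := by
  have h : MemLp (gaussPoly b p) 2 volume := by
    rw [memLp_two_iff_integrable_sq (continuous_gaussPoly b p).aestronglyMeasurable]
    simpa only [sq] using integrable_gaussPoly_mul hb p p
  exact h.ofReal

theorem memLp_hermiteFun {b : ℝ} (hb : 0 < b) (n : ℕ) :
    MemLp (fun x => (hermiteFun b n x : ℂ)) 2 volume := by
  have h : MemLp (hermiteFun b n) 2 volume := by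
    rw [memLp_two_iff_integrable_sq (continuous_hermiteFun b n).aestronglyMeasurable]
    simpa only [sq] using integrable_hermiteFun_mul hb n n
  exact h.ofReal

theorem integrable_gaussPoly_mul_memLp {b : ℝ} (hb : 0 < b) (p : Polynomial ℝ) {f : ℝ → ℂ}
    (hf : MemLp f 2 volume) : Integrable (fun x => (gaussPoly b p x : ℂ) * f x) :=
  (memLp_gaussPoly hb p).integrable_mul hf

-- The span contains `1` and is stable under multiplication by `X`, because `2 b X pₙ = pₙ₊₁ + pₙ'`
-- and `pₙ'` is a multiple of the preceding polynomial (or zero).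
open Polynomial in
theorem mem_span_hermitePoly {b : ℝ} (hb : 0 < b) (p : Polynomial ℝ) :
    p ∈ Submodule.span ℝ (range (hermitePoly b)) := by
  have hX : ∀ q ∈ Submodule.span ℝ (range (hermitePoly b)),
      X * q ∈ Submodule.span ℝ (range (hermitePoly b)) := by
    intro q hq
    induction hq using Submodule.span_induction with
    | mem q hq =>
      obtain ⟨n, rfl⟩ := hq
      have h1 : X * hermitePoly b n = (2 * b)⁻¹ • (hermitePoly b (n + 1) +
          derivative (hermitePoly b n)) := by
        have hC : C (2 * b)⁻¹ * C (2 * b) = (1 : Polynomial ℝ) := by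
          rw [← C_mul, inv_mul_cancel₀ (by positivity), C_1]
        rw [hermitePoly, sub_add_cancel, smul_eq_C_mul, ← mul_assoc, ← mul_assoc, hC, one_mul]
      have h2 : derivative (hermitePoly b n) ∈ Submodule.span ℝ (range (hermitePoly b)) := by
        cases n with
        | zero => simp [hermitePoly]
        | succ n =>
          rw [derivative_hermitePoly_succ, ← smul_eq_C_mul]
          exact Submodule.smul_mem _ _ (Submodule.subset_span ⟨n, rfl⟩)
      rw [h1]
      exact Submodule.smul_mem _ _ (add_mem (Submodule.subset_span ⟨n + 1, rfl⟩) h2)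
    | zero => simp
    | add x y _ _ hx hy => rw [mul_add]; exact add_mem hx hy
    | smul c x _ hx => rw [mul_smul_comm]; exact Submodule.smul_mem _ _ hx
  have hpow : ∀ n : ℕ, (X ^ n : Polynomial ℝ) ∈ Submodule.span ℝ (range (hermitePoly b)) := by
    intro n
    induction n with
    | zero => exact Submodule.subset_span ⟨0, by simp [hermitePoly]⟩
    | succ n ih => rw [pow_succ']; exact hX _ ih
  induction p using Polynomial.induction_on' with
  | add p q hp hq => exact add_mem hp hq
  | monomial n a =>
    rw [← C_mul_X_pow_eq_monomial, ← smul_eq_C_mul]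
    exact Submodule.smul_mem _ _ (hpow n)

theorem integral_gaussPoly_mul_eq_zero {b : ℝ} (hb : 0 < b) {f : ℝ → ℂ} (hf : MemLp f 2 volume)
    (h : ∀ n, ∫ x, (gaussPoly b (hermitePoly b n) x : ℂ) * f x = 0) (p : Polynomial ℝ) :
    ∫ x, (gaussPoly b p x : ℂ) * f x = 0 := by
  have hp := mem_span_hermitePoly hb p
  induction hp using Submodule.span_induction with
  | mem q hq => obtain ⟨n, rfl⟩ := hq; exact h n
  | zero => simp [gaussPoly]
  | add x y _ _ hx hy =>
    have : ∀ z, (gaussPoly b (x + y) z : ℂ) * f z =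
        gaussPoly b x z * f z + gaussPoly b y z * f z := fun z => by
      simp only [gaussPoly, Polynomial.eval_add]; push_cast; ring
    simp_rw [this]
    rw [integral_add (integrable_gaussPoly_mul_memLp hb x hf)
      (integrable_gaussPoly_mul_memLp hb y hf), hx, hy, add_zero]
  | smul c x _ hx =>
    have : ∀ z, (gaussPoly b (c • x) z : ℂ) * f z = c * (gaussPoly b x z * f z) := fun z => by
      simp only [gaussPoly, Polynomial.eval_smul, smul_eq_mul]; push_cast; ring
    simp_rw [this]
    rw [integral_const_mul, hx, mul_zero]

/-- Expanding the exponential gives polynomials times the Gaussian, each orthogonal to `f`. Sum and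
integral may be exchanged because `|ξ x| ≤ ξ²/b + b x²/4`, so half of the Gaussian decay absorbs
`exp |ξ x|` and the other half is still square integrable. -/
theorem integral_exp_mul_gaussian_eq_zero {b : ℝ} (hb : 0 < b) {f : ℝ → ℂ}
    (hf : MemLp f 2 volume)
    (h : ∀ p : Polynomial ℝ, ∫ x, (gaussPoly b p x : ℂ) * f x = 0) (ξ : ℝ) :
    ∫ x : ℝ, Complex.exp ((ξ * x : ℝ) * Complex.I) * ((gaussPoly b 1 x : ℂ) * f x) = 0 := by
  have hF := integrable_gaussPoly_mul_memLp hb 1 hf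
  have hs := hasSum_integral_of_dominated_convergence (μ := (volume : Measure ℝ))
    (F := fun (n : ℕ) (x : ℝ) => (((ξ * x : ℝ) * Complex.I) ^ n / (n.factorial : ℂ)) *
      ((gaussPoly b 1 x : ℂ) * f x))
    (f := fun x => Complex.exp ((ξ * x : ℝ) * Complex.I) * ((gaussPoly b 1 x : ℂ) * f x))
    (fun n x => |ξ * x| ^ n / n.factorial * ‖(gaussPoly b 1 x : ℂ) * f x‖)
    (fun n => by
      refine AEStronglyMeasurable.mul ?_ hF.aestronglyMeasurable
      exact Continuous.aestronglyMeasurable (by fun_prop))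
    (fun n => Filter.Eventually.of_forall fun x => by
      rw [norm_mul, norm_div, norm_pow, norm_mul]; simp)
    (Filter.Eventually.of_forall fun x =>
      (Real.summable_pow_div_factorial _).mul_right _)
    (by
      have hmem : Integrable (fun x => (Real.exp (ξ ^ 2 / b) : ℂ) *
          ((gaussPoly (b / 2) 1 x : ℂ) * f x)) :=
        (integrable_gaussPoly_mul_memLp (by positivity) 1 hf).const_mul _
      have hsum : ∀ x : ℝ, ∑' n : ℕ, |ξ * x| ^ n / n.factorial * ‖(gaussPoly b 1 x : ℂ) * f x‖ =
          Real.exp |ξ * x| * ‖(gaussPoly b 1 x : ℂ) * f x‖ := by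
        intro x
        rw [tsum_mul_right, Real.exp_eq_exp_ℝ, NormedSpace.exp_eq_tsum_div]
      simp_rw [hsum]
      refine hmem.mono ?_ (Filter.Eventually.of_forall fun x => ?_)
      · exact AEStronglyMeasurable.mul (Continuous.aestronglyMeasurable (by fun_prop))
          hF.aestronglyMeasurable.norm
      · simp only [norm_mul, Complex.norm_real, norm_norm]
        rw [← mul_assoc, ← mul_assoc]
        refine mul_le_mul_of_nonneg_right ?_ (norm_nonneg _)
        simp only [gaussPoly, Polynomial.eval_one, one_mul, Real.norm_eq_abs, Real.abs_exp]
        rw [← Real.exp_add, ← Real.exp_add]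
        refine Real.exp_le_exp.2 ?_
        have h1 : |ξ * x| ≤ ξ ^ 2 / b + b / 4 * x ^ 2 := by
          have h2 : ξ ^ 2 / b + b / 4 * x ^ 2 - |ξ * x| = (|ξ| - b / 2 * |x|) ^ 2 / b := by
            rw [abs_mul]; field_simp; ring_nf; rw [sq_abs, sq_abs]; ring
          have : 0 ≤ (|ξ| - b / 2 * |x|) ^ 2 / b := by positivity
          linarith
        linarith)
    (Filter.Eventually.of_forall fun x => by
      refine HasSum.mul_right _ ?_
      rw [Complex.exp_eq_exp_ℂ]
      exact NormedSpace.expSeries_div_hasSum_exp _)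
  have hz : ∀ n : ℕ, ∫ x : ℝ, (((ξ * x : ℝ) * Complex.I) ^ n / (n.factorial : ℂ)) *
      ((gaussPoly b 1 x : ℂ) * f x) = 0 := by
    intro n
    have : ∀ x : ℝ, (((ξ * x : ℝ) * Complex.I) ^ n / (n.factorial : ℂ)) *
        ((gaussPoly b 1 x : ℂ) * f x) = ((ξ * Complex.I) ^ n / (n.factorial : ℂ)) *
        ((gaussPoly b (Polynomial.X ^ n) x : ℂ) * f x) := by
      intro x
      simp only [gaussPoly, Polynomial.eval_one, one_mul, Polynomial.eval_pow, Polynomial.eval_X]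
      push_cast; ring
    simp_rw [this]
    rw [integral_const_mul, h, mul_zero]
  simp_rw [hz] at hs
  exact (hs.unique hasSum_zero)

-- Injectivity by duality: a test function is the Fourier transform of a Schwartz function, and the
-- transform can be moved from that function onto `F`, where it vanishes.
open FourierTransform in
theorem ae_eq_zero_of_fourier_eq_zero {F : ℝ → ℂ} (hF : Integrable F)
    (h : ∀ ξ : ℝ, ∫ x : ℝ, Complex.exp ((ξ * x : ℝ) * Complex.I) * F x = 0) :
    ∀ᵐ x, F x = 0 := by
  have hft : ∀ w, 𝓕 F w = 0 := by
    intro w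
    rw [Real.fourier_real_eq_integral_exp_smul, ← h (-2 * Real.pi * w)]
    refine integral_congr_ae (Filter.Eventually.of_forall fun x => ?_)
    simp only [smul_eq_mul]
    congr 3
    push_cast; ring
  refine ae_eq_zero_of_integral_contDiff_smul_eq_zero hF.locallyIntegrable fun g hg hgc => ?_
  have hgc' : HasCompactSupport (fun x => (g x : ℂ)) := hgc.comp_left Complex.ofReal_zero
  let G : SchwartzMap ℝ ℂ := hgc'.toSchwartzMap (Complex.ofRealCLM.contDiff.comp hg)
  have hG : 𝓕 (𝓕⁻ G) = G := FourierTransform.fourier_fourierInv_eq G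
  have key := VectorFourier.integral_fourierIntegral_smul_eq_flip (L := innerₗ ℝ)
      Real.continuous_fourierChar continuous_inner hF ((𝓕⁻ G).integrable (μ := volume))
  have e1 : ∀ ξ, VectorFourier.fourierIntegral Real.fourierChar volume (innerₗ ℝ) F ξ = 0 := hft
  have e2 : ∀ x, VectorFourier.fourierIntegral Real.fourierChar volume (innerₗ ℝ).flip
      (𝓕⁻ G : SchwartzMap ℝ ℂ) x = (g x : ℂ) := by
    intro x
    have : (𝓕 (𝓕⁻ G)) x = (g x : ℂ) := by rw [hG]; rfl
    rw [← this, SchwartzMap.fourier_coe, flip_innerₗ]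
    rfl
  simp_rw [e1, e2] at key
  have e3 : ∫ ξ : ℝ, (0 : ℂ) • (𝓕⁻ G : SchwartzMap ℝ ℂ) ξ = 0 := by simp
  rw [e3] at key
  rw [key]
  refine integral_congr_ae (Filter.Eventually.of_forall fun x => ?_)
  simp [mul_comm]

theorem ae_eq_zero_of_hermite_orthogonal {b : ℝ} (hb : 0 < b) {f : ℝ → ℂ}
    (hf : MemLp f 2 volume) (h : ∀ n, ∫ x, (hermiteFun b n x : ℂ) * f x = 0) :
    ∀ᵐ x, f x = 0 := by
  have h1 : ∀ n, ∫ x, (gaussPoly b (hermitePoly b n) x : ℂ) * f x = 0 := by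
    intro n
    have hne : (√(hermiteNormSq b n) : ℂ) ≠ 0 := by
      exact_mod_cast (Real.sqrt_pos.2 (hermiteNormSq_pos hb n)).ne'
    have : ∀ x, (gaussPoly b (hermitePoly b n) x : ℂ) * f x =
        (√(hermiteNormSq b n) : ℂ) * ((hermiteFun b n x : ℂ) * f x) := by
      intro x
      simp only [hermiteFun]; push_cast; field_simp
    simp_rw [this]
    rw [integral_const_mul, h, mul_zero]
  have h2 := ae_eq_zero_of_fourier_eq_zero (integrable_gaussPoly_mul_memLp hb 1 hf)
    (integral_exp_mul_gaussian_eq_zero hb hf (integral_gaussPoly_mul_eq_zero hb hf h1))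
  filter_upwards [h2] with x hx
  refine (mul_eq_zero.1 hx).resolve_left ?_
  simp [gaussPoly, Complex.exp_ne_zero]

/-- The Hermite functions as vectors in `L²(ℝ)`. -/
def hermiteLp {b : ℝ} (hb : 0 < b) (n : ℕ) : Lp ℂ 2 (volume : Measure ℝ) :=
  (memLp_hermiteFun hb n).toLp

theorem inner_hermiteLp {b : ℝ} (hb : 0 < b) (n : ℕ) {f : ℝ → ℂ} (hf : MemLp f 2 volume) :
    inner ℂ (hermiteLp hb n) hf.toLp = ∫ x, (hermiteFun b n x : ℂ) * f x := by
  rw [L2.inner_def]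
  refine integral_congr_ae ?_
  filter_upwards [(memLp_hermiteFun hb n).coeFn_toLp, hf.coeFn_toLp] with x h1 h2
  rw [hermiteLp, h1, h2]
  simp [mul_comm]

theorem orthonormal_hermiteLp {b : ℝ} (hb : 0 < b) : Orthonormal ℂ (hermiteLp hb) := by
  classical
  rw [orthonormal_iff_ite]
  intro i j
  rw [show hermiteLp hb j = (memLp_hermiteFun hb j).toLp from rfl, inner_hermiteLp]
  have := integral_hermiteFun_mul hb i j
  rw [← Complex.ofReal_inj, ← integral_complex_ofReal] at this
  push_cast at this
  rw [this]
  split_ifs <;> simp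

theorem norm_toLp_sq {α : Type*} [MeasurableSpace α] {μ : Measure α} {f : α → ℂ}
    (hf : MemLp f 2 μ) : ‖hf.toLp‖ ^ 2 = ∫ x, ‖f x‖ ^ 2 ∂μ := by
  rw [← Complex.ofReal_inj, ← integral_complex_ofReal]
  have : ((‖hf.toLp‖ ^ 2 : ℝ) : ℂ) = inner ℂ hf.toLp hf.toLp := by
    simp [inner_self_eq_norm_sq_to_K]
  rw [this, L2.inner_def]
  refine integral_congr_ae ?_
  filter_upwards [hf.coeFn_toLp] with x h1
  rw [h1]
  simp [inner_self_eq_norm_sq_to_K]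

theorem hasSum_sq_hermiteCoeff {b : ℝ} (hb : 0 < b) {f : ℝ → ℂ} (hf : MemLp f 2 volume) :
    HasSum (fun n => ‖∫ x, (hermiteFun b n x : ℂ) * f x‖ ^ 2) (∫ x, ‖f x‖ ^ 2) := by
  have hbot : (Submodule.span ℂ (range (hermiteLp hb)))ᗮ = ⊥ := by
    rw [Submodule.eq_bot_iff]
    intro u hu
    rw [Submodule.mem_orthogonal] at hu
    have h0 := ae_eq_zero_of_hermite_orthogonal hb (Lp.memLp u) (fun n => by
      rw [← inner_hermiteLp hb n (Lp.memLp u), Lp.toLp_coeFn]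
      exact hu _ (Submodule.subset_span ⟨n, rfl⟩))
    exact (Lp.eq_zero_iff_ae_eq_zero).2 h0
  let B := HilbertBasis.mkOfOrthogonalEqBot (orthonormal_hermiteLp hb) hbot
  have hB : ⇑B = hermiteLp hb := HilbertBasis.coe_mkOfOrthogonalEqBot _ _
  have h := B.hasSum_inner_mul_inner hf.toLp hf.toLp
  rw [hB] at h
  rw [← norm_toLp_sq hf, ← Complex.hasSum_ofReal]
  have e1 : ∀ n, inner ℂ hf.toLp (hermiteLp hb n) * inner ℂ (hermiteLp hb n) hf.toLp =
      ((‖∫ x, (hermiteFun b n x : ℂ) * f x‖ ^ 2 : ℝ) : ℂ) := by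
    intro n
    rw [← inner_hermiteLp hb n hf, ← inner_conj_symm (hf.toLp) (hermiteLp hb n),
      ← Complex.normSq_eq_conj_mul_self, Complex.normSq_eq_norm_sq]
  have e2 : inner ℂ hf.toLp hf.toLp = ((‖hf.toLp‖ ^ 2 : ℝ) : ℂ) := by
    rw [inner_self_eq_norm_sq_to_K]; push_cast; rfl
  rw [e2] at h
  simp_rw [e1] at h
  exact h

/-! ### The harmonic oscillator -/

/-- The cross term of the square is `b x` times the derivative of `‖f‖²`; integration by parts turns
it into `-b ‖f‖²`. -/
theorem integral_annihilation_sq (b : ℝ) {f f' : ℝ → ℂ} (hf : ∀ x, HasDerivAt f (f' x) x)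
    (hf' : Continuous f') (hs : HasCompactSupport f) :
    ∫ x, ‖f' x + (b * x) • f x‖ ^ 2 =
      (∫ x, (‖f' x‖ ^ 2 + (b * x) ^ 2 * ‖f x‖ ^ 2)) - b * ∫ x, ‖f x‖ ^ 2 := by
  have hfc : Continuous f := continuous_iff_continuousAt.2 fun x => (hf x).continuousAt
  have hs' : HasCompactSupport f' := by
    have : f' = deriv f := funext fun x => (hf x).deriv.symm
    rw [this]; exact hs.deriv
  have hd : ∀ x, HasDerivAt (fun x => x * ‖f x‖ ^ 2)
      (‖f x‖ ^ 2 + x * (2 * inner ℝ (f x) (f' x))) x := by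
    intro x
    refine ((hasDerivAt_id x).fun_mul (hf x).norm_sq).congr_deriv ?_
    simp
  have hn : HasCompactSupport (fun x => ‖f x‖ ^ 2) :=
    hs.norm.comp_left (g := fun r : ℝ => r ^ 2) (by simp)
  have hn' : HasCompactSupport (fun x => ‖f' x‖ ^ 2) :=
    hs'.norm.comp_left (g := fun r : ℝ => r ^ 2) (by simp)
  have hin : HasCompactSupport (fun x => inner ℝ (f x) (f' x)) :=
    HasCompactSupport.mono hs (fun x hx => by
      simp only [Function.mem_support, ne_eq] at hx ⊢
      intro h; rw [h] at hx; simp at hx)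
  have i1 : Integrable (fun x => ‖f x‖ ^ 2) :=
    Continuous.integrable_of_hasCompactSupport (by fun_prop) hn
  have i2 : Integrable (fun x => x * (2 * inner ℝ (f x) (f' x))) :=
    Continuous.integrable_of_hasCompactSupport (by fun_prop) (hin.mul_left.mul_left)
  have i3 : Integrable (fun x => x * ‖f x‖ ^ 2) :=
    Continuous.integrable_of_hasCompactSupport (by fun_prop) hn.mul_left
  have i4 : Integrable (fun x => ‖f' x‖ ^ 2 + (b * x) ^ 2 * ‖f x‖ ^ 2) :=
    Continuous.integrable_of_hasCompactSupport (by fun_prop) (hn'.add hn.mul_left)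
  have h0 := integral_eq_zero_of_hasDerivAt_of_integrable hd (i1.add i2) i3
  rw [integral_add i1 i2] at h0
  have hpt : ∀ x, ‖f' x + (b * x) • f x‖ ^ 2 = (‖f' x‖ ^ 2 + (b * x) ^ 2 * ‖f x‖ ^ 2) +
      b * (x * (2 * inner ℝ (f x) (f' x))) := by
    intro x
    rw [norm_add_sq_real, norm_smul, inner_smul_right, real_inner_comm, mul_pow,
      Real.norm_eq_abs, sq_abs]
    ring
  simp_rw [hpt]
  rw [integral_add i4 (i2.const_mul b), integral_const_mul]
  linear_combination b * h0

/-- Integration by parts moves the annihilation operator from `f` to the Hermite function as the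
creation operator, which raises the index with factor `κ`, where `κ² = 2 b (n + 1)`. -/
theorem integral_hermiteFun_mul_annihilation {b : ℝ} (hb : 0 < b) (n : ℕ) {f f' : ℝ → ℂ}
    (hf : ∀ x, HasDerivAt f (f' x) x) (hf' : Continuous f') (hs : HasCompactSupport f) :
    ‖∫ x, (hermiteFun b n x : ℂ) * (f' x + (b * x) • f x)‖ ^ 2 =
      2 * b * ((n : ℝ) + 1) * ‖∫ x, (hermiteFun b (n + 1) x : ℂ) * f x‖ ^ 2 := by
  have hfc : Continuous f := continuous_iff_continuousAt.2 fun x => (hf x).continuousAt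
  have hs' : HasCompactSupport f' := by
    have : f' = deriv f := funext fun x => (hf x).deriv.symm
    rw [this]; exact hs.deriv
  have hN := hermiteNormSq_pos hb n
  have hN1 := hermiteNormSq_pos hb (n + 1)
  set κ : ℝ := √(hermiteNormSq b (n + 1)) / √(hermiteNormSq b n) with hκ
  have hκ2 : κ ^ 2 = 2 * b * ((n : ℝ) + 1) := by
    rw [hκ, div_pow, Real.sq_sqrt hN1.le, Real.sq_sqrt hN.le, hermiteNormSq_succ hb]
    field_simp
  have hpt : ∀ x, hermiteFunDeriv b n x = b * x * hermiteFun b n x -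
      κ * hermiteFun b (n + 1) x := by
    intro x
    have e : κ * hermiteFun b (n + 1) x =
        gaussPoly b (hermitePoly b (n + 1)) x / √(hermiteNormSq b n) := by
      have := (Real.sqrt_pos.2 hN1).ne'
      simp only [hκ, hermiteFun]; field_simp
    rw [e]
    simp only [hermiteFun, hermiteFunDeriv, hermitePoly, gaussPoly]
    rw [← mul_div_assoc, ← sub_div]
    congr 1
    simp; ring
  have hd : ∀ x, HasDerivAt (fun x => (hermiteFun b n x : ℂ) * f x)
      ((hermiteFun b n x : ℂ) * (f' x + (b * x) • f x) -
        κ * ((hermiteFun b (n + 1) x : ℂ) * f x)) x := by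
    intro x
    refine ((hasDerivAt_hermiteFun b n x).ofReal_comp.fun_mul (hf x)).congr_deriv ?_
    rw [hpt x]
    simp only [Complex.real_smul]
    push_cast; ring
  have c0 : Continuous (hermiteFun b n) := continuous_hermiteFun b n
  have c1 : Continuous (hermiteFun b (n + 1)) := continuous_hermiteFun b (n + 1)
  have i1 : Integrable (fun x => (hermiteFun b n x : ℂ) * (f' x + (b * x) • f x)) :=
    Continuous.integrable_of_hasCompactSupport (by fun_prop)
      ((hs'.add (hs.smul_left (f := fun x => b * x))).mul_left)
  have i2 : Integrable (fun x => (κ : ℂ) * ((hermiteFun b (n + 1) x : ℂ) * f x)) :=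
    Continuous.integrable_of_hasCompactSupport (by fun_prop) hs.mul_left.mul_left
  have i3 : Integrable (fun x => (hermiteFun b n x : ℂ) * f x) :=
    Continuous.integrable_of_hasCompactSupport (by fun_prop) hs.mul_left
  have h0 := integral_eq_zero_of_hasDerivAt_of_integrable hd (i1.sub i2) i3
  rw [integral_sub i1 i2, integral_const_mul, sub_eq_zero] at h0
  rw [h0, norm_mul, mul_pow, ← hκ2]
  simp

/-- The quadratic form of the harmonic oscillator dominates `t` up to the projections on the
eigenfunctions with eigenvalue `(2k+1)b < t`. -/
theorem oscillator_inequality {b t : ℝ} (hb : 0 < b) (_ht : 0 ≤ t) {M : ℕ}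
    (hM : t ≤ (2 * (M : ℝ) + 1) * b) {f f' : ℝ → ℂ}
    (hf : ∀ x, HasDerivAt f (f' x) x) (hf' : Continuous f') (hs : HasCompactSupport f) :
    t * ∫ x, ‖f x‖ ^ 2 ≤ (∫ x, (‖f' x‖ ^ 2 + (b * x) ^ 2 * ‖f x‖ ^ 2)) +
      t * ∑ k ∈ Finset.range M, ‖∫ x, (hermiteFun b k x : ℂ) * f x‖ ^ 2 := by
  have hfc : Continuous f := continuous_iff_continuousAt.2 fun x => (hf x).continuousAt
  have hs' : HasCompactSupport f' := by
    have : f' = deriv f := funext fun x => (hf x).deriv.symm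
    rw [this]; exact hs.deriv
  have hfm : MemLp f 2 volume := hfc.memLp_of_hasCompactSupport hs
  have hgm : MemLp (fun x => f' x + (b * x) • f x) 2 volume :=
    Continuous.memLp_of_hasCompactSupport (by fun_prop)
      (hs'.add (hs.smul_left (f := fun x => b * x)))
  have h1 := hasSum_sq_hermiteCoeff hb hfm
  have h2 := hasSum_sq_hermiteCoeff hb hgm
  rw [integral_annihilation_sq b hf hf' hs] at h2
  simp_rw [integral_hermiteFun_mul_annihilation hb _ hf hf' hs] at h2
  set c : ℕ → ℝ := fun k => ‖∫ x, (hermiteFun b k x : ℂ) * f x‖ ^ 2 with hc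
  have hc0 : ∀ k, 0 ≤ c k := fun k => by positivity
  -- The annihilated function involves only the coefficients of index `n + 1`. Reindexing is free
  -- because the new term at `0` carries the factor `n = 0`. The energy thus becomes `∑ (2n+1) b c
  -- n`, to be compared with `t ∑ c n` term by term.
  have h2' : HasSum (fun n : ℕ => 2 * b * (n : ℝ) * c n)
      ((∫ x, (‖f' x‖ ^ 2 + (b * x) ^ 2 * ‖f x‖ ^ 2)) - b * ∫ x, ‖f x‖ ^ 2) := by
    rw [← hasSum_nat_add_iff' 1]
    simpa using h2
  have h3 := (h2'.add (h1.mul_left b)).add ((hasSum_sum_of_ne_finset_zero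
    (f := fun k => if k ∈ Finset.range M then c k else 0) (s := Finset.range M)
    (fun k hk => if_neg hk)).mul_left t)
  have h4 := hasSum_le (fun n => ?_) (h1.mul_left t) h3
  · refine h4.trans (le_of_eq ?_)
    rw [Finset.sum_congr rfl (fun k hk => if_pos hk)]
    ring
  · change t * c n ≤ _
    split_ifs with hn
    · have := hc0 n
      have : 0 ≤ 2 * b * (n : ℝ) * c n + b * c n := by positivity
      linarith
    · have hMn : (M : ℝ) ≤ n := by
        rw [Finset.mem_range, not_lt] at hn; exact_mod_cast hn
      have : t ≤ (2 * (n : ℝ) + 1) * b := hM.trans (by gcongr)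
      have := mul_le_mul_of_nonneg_right this (hc0 n)
      linarith

/-- `oscillator_inequality` for the oscillator centred at `-κ/b`. -/
theorem oscillator_inequality_shift {b t : ℝ} (hb : 0 < b) (ht : 0 ≤ t) {M : ℕ}
    (hM : t ≤ (2 * (M : ℝ) + 1) * b) (κ : ℝ) {f f' : ℝ → ℂ}
    (hf : ∀ x, HasDerivAt f (f' x) x) (hf' : Continuous f') (hs : HasCompactSupport f) :
    t * ∫ x, ‖f x‖ ^ 2 ≤ (∫ x, (‖f' x‖ ^ 2 + (b * x + κ) ^ 2 * ‖f x‖ ^ 2)) +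
      t * ∑ k ∈ Finset.range M, ‖∫ x, (hermiteFun b k (x + κ / b) : ℂ) * f x‖ ^ 2 := by
  have h := oscillator_inequality hb ht hM (f := fun x => f (x - κ / b))
    (f' := fun x => f' (x - κ / b)) (fun x => (hf (x - κ / b)).comp_sub_const x (κ / b))
    (by fun_prop) (hs.comp_homeomorph (Homeomorph.subRight (κ / b)))
  have e1 := integral_sub_right_eq_self (fun x => ‖f x‖ ^ 2) (μ := volume) (κ / b)
  have e2 := integral_sub_right_eq_self
    (fun x => ‖f' x‖ ^ 2 + (b * x + κ) ^ 2 * ‖f x‖ ^ 2) (μ := volume) (κ / b)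
  have e3 : ∀ x, b * (x - κ / b) + κ = b * x := fun x => by field_simp; ring
  have e4 := fun k : ℕ => integral_sub_right_eq_self
    (fun x => (hermiteFun b k (x + κ / b) : ℂ) * f x) (μ := volume) (κ / b)
  simp_rw [e3] at e2
  simp_rw [sub_add_cancel] at e4
  simp_rw [e1, e2, e4] at h
  exact h

/-! ### Fourier analysis in the second variable -/

/-- Parseval for `exp (-i η y) g`. Since `g` vanishes outside one period, the integral over the line
is a Fourier coefficient for every offset `η`, with no boundary condition to match. -/
theorem hasSum_sq_fourierIntegral {L : ℝ} (hL : 0 < L) (η : ℝ) {g : ℝ → ℂ} (hg : Continuous g)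
    (hs : ∀ y, y ∉ Ioo (-(L / 2)) (L / 2) → g y = 0) :
    HasSum (fun m : ℤ => ‖∫ y : ℝ, Complex.exp (-(((η + 2 * Real.pi * m / L) * y : ℝ) : ℂ) *
      Complex.I) * g y‖ ^ 2) (L * ∫ y, ‖g y‖ ^ 2) := by
  have hab : -(L / 2) < L / 2 := by linarith
  have hLab : L / 2 - -(L / 2) = L := by ring
  have hinteg : ∀ {E : Type} [NormedAddCommGroup E] [NormedSpace ℝ E] (F : ℝ → E),
      (∀ y, y ∉ Ioo (-(L / 2)) (L / 2) → F y = 0) → ∫ y in (-(L / 2))..(L / 2), F y = ∫ y, F y := by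
    intro E _ _ F hF
    rw [intervalIntegral.integral_of_le hab.le]
    exact setIntegral_eq_integral_of_forall_compl_eq_zero fun y hy =>
      hF y fun h => hy (Ioo_subset_Ioc_self h)
  set G : ℝ → ℂ := fun y => Complex.exp (-((η * y : ℝ) : ℂ) * Complex.I) * g y with hG
  have hGc : Continuous G := by fun_prop
  have hGn : ∀ y, ‖G y‖ = ‖g y‖ := fun y => by
    rw [hG]; simp only [norm_mul]
    rw [← Complex.ofReal_neg, Complex.norm_exp_ofReal_mul_I, one_mul]
  have hGs : ∀ y, y ∉ Ioo (-(L / 2)) (L / 2) → G y = 0 := fun y hy => by simp [hG, hs y hy]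
  have hmem : MemLp G 2 (volume.restrict (Ioc (-(L / 2)) (L / 2))) :=
    (hGc.memLp_of_hasCompactSupport (HasCompactSupport.intro
      (isCompact_Icc (a := -(L / 2)) (b := L / 2))
      (fun y hy => hGs y (fun h => hy (Ioo_subset_Icc_self h))))).restrict _
  have h := (hasSum_sq_fourierCoeffOn hab hmem).mul_left (L ^ 2)
  rw [hLab] at h
  have e1 : ∀ m : ℤ, ‖∫ y : ℝ, Complex.exp (-(((η + 2 * Real.pi * m / L) * y : ℝ) : ℂ) *
      Complex.I) * g y‖ ^ 2 = L ^ 2 * ‖fourierCoeffOn hab G m‖ ^ 2 := by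
    intro m
    have : fourierCoeffOn hab G m = (1 / L) • ∫ y : ℝ, Complex.exp
        (-(((η + 2 * Real.pi * m / L) * y : ℝ) : ℂ) * Complex.I) * g y := by
      rw [fourierCoeffOn_eq_integral, hLab, hinteg _ (fun y hy => by rw [hGs y hy, smul_zero])]
      congr 1
      refine integral_congr_ae (Filter.Eventually.of_forall fun y => ?_)
      simp only [fourier_coe_apply, hG, smul_eq_mul]
      rw [← mul_assoc, ← Complex.exp_add]
      congr 2
      push_cast
      ring
    rw [this, norm_smul, mul_pow, Real.norm_eq_abs, sq_abs, ← mul_assoc, ← mul_pow,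
      mul_one_div_cancel hL.ne', one_pow, one_mul]
  have e2 : L * ∫ y, ‖g y‖ ^ 2 =
      L ^ 2 * L⁻¹ • ∫ y in (-(L / 2))..(L / 2), ‖G y‖ ^ 2 := by
    rw [hinteg _ (fun y hy => by rw [hGs y hy]; simp), smul_eq_mul]
    simp_rw [hGn]
    field_simp
  simp_rw [e1]
  rw [e2]
  exact h

/-- The Fourier transform in the second variable at frequency `η + b x / 2`. -/
def partialFourier (b η : ℝ) (w : ℝ × ℝ → ℂ) (x : ℝ) : ℂ :=
  ∫ y : ℝ, Complex.exp (-(((η + b * x / 2) * y : ℝ) : ℂ) * Complex.I) * w (x, y)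

section

variable {R₁ R₂ : ℝ} {w : ℝ × ℝ → ℂ}

theorem hasCompactSupport_of_eq_zero_off_rectangle (hw0 : ∀ p ∉ rectangle R₁ R₂, w p = 0) :
    HasCompactSupport w := by
  refine HasCompactSupport.intro ((isCompact_Icc (a := -(R₁ / 2)) (b := R₁ / 2)).prod
    (isCompact_Icc (a := -(R₂ / 2)) (b := R₂ / 2))) fun p hp => hw0 p fun h => hp ?_
  exact ⟨Ioo_subset_Icc_self h.1, Ioo_subset_Icc_self h.2⟩

theorem exists_norm_le_of_eq_zero_off_rectangle (hwc : Continuous w)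
    (hw0 : ∀ p ∉ rectangle R₁ R₂, w p = 0) : ∃ K, ∀ p, ‖w p‖ ≤ K := by
  obtain ⟨K, hK⟩ := hwc.bounded_above_of_compact_support
    (hasCompactSupport_of_eq_zero_off_rectangle hw0)
  exact ⟨K, hK⟩

theorem eq_zero_of_snd_notMem (hw0 : ∀ p ∉ rectangle R₁ R₂, w p = 0) (x : ℝ) {y : ℝ}
    (hy : y ∉ Ioo (-(R₂ / 2)) (R₂ / 2)) : w (x, y) = 0 := hw0 _ fun h => hy h.2

theorem norm_exp_neg_ofReal_mul_I (r : ℝ) : ‖Complex.exp (-(r : ℂ) * Complex.I)‖ = 1 := by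
  rw [← Complex.ofReal_neg, Complex.norm_exp_ofReal_mul_I]

theorem partialFourier_eq_zero (hw0 : ∀ p ∉ rectangle R₁ R₂, w p = 0) (b η : ℝ) {x : ℝ}
    (hx : x ∉ Ioo (-(R₁ / 2)) (R₁ / 2)) : partialFourier b η w x = 0 := by
  unfold partialFourier
  have : ∀ y, w (x, y) = 0 := fun y => hw0 _ fun h => hx h.1
  simp [this]

theorem integrable_bound_indicator (K R₂ : ℝ) :
    Integrable ((Icc (-(R₂ / 2)) (R₂ / 2)).indicator fun _ => K) :=
  (integrable_indicator_iff measurableSet_Icc).2 (integrableOn_const (by simp))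

theorem norm_le_bound_indicator {K : ℝ} (hK : ∀ p, ‖w p‖ ≤ K)
    (hw0 : ∀ p ∉ rectangle R₁ R₂, w p = 0) (r x y : ℝ) :
    ‖Complex.exp (-(r : ℂ) * Complex.I) * w (x, y)‖ ≤
      (Icc (-(R₂ / 2)) (R₂ / 2)).indicator (fun _ => K) y := by
  rw [norm_mul, norm_exp_neg_ofReal_mul_I, one_mul]
  by_cases hy : y ∈ Icc (-(R₂ / 2)) (R₂ / 2)
  · rw [indicator_of_mem hy]; exact hK _
  · rw [indicator_of_notMem hy, eq_zero_of_snd_notMem hw0 x fun h => hy (Ioo_subset_Icc_self h)]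
    simp

theorem continuous_partialFourier (hwc : Continuous w) (hw0 : ∀ p ∉ rectangle R₁ R₂, w p = 0)
    (b η : ℝ) : Continuous (partialFourier b η w) := by
  obtain ⟨K, hK⟩ := exists_norm_le_of_eq_zero_off_rectangle hwc hw0
  exact continuous_of_dominated (fun x => Continuous.aestronglyMeasurable (by fun_prop))
    (fun x => Filter.Eventually.of_forall fun y => norm_le_bound_indicator hK hw0 _ x y)
    (integrable_bound_indicator K R₂)
    (Filter.Eventually.of_forall fun y => by fun_prop)

/-- Parseval is applied on each line of fixed `x`, with the offset `η + b x / 2` that depends on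
`x`, and then integrated in `x`. -/
theorem hasSum_integral_partialFourier (hR₂ : 0 < R₂) (hwc : Continuous w)
    (hw0 : ∀ p ∉ rectangle R₁ R₂, w p = 0) (b η : ℝ) :
    HasSum (fun m : ℤ => ∫ x, ‖partialFourier b (η + 2 * Real.pi * m / R₂) w x‖ ^ 2)
      (R₂ * ∫ p in rectangle R₁ R₂, ‖w p‖ ^ 2) := by
  have hpt : ∀ x, HasSum (fun m : ℤ => ‖partialFourier b (η + 2 * Real.pi * m / R₂) w x‖ ^ 2)
      (R₂ * ∫ y, ‖w (x, y)‖ ^ 2) := by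
    intro x
    have h := hasSum_sq_fourierIntegral hR₂ (η + b * x / 2) (g := fun y => w (x, y))
      (by fun_prop) (fun y hy => eq_zero_of_snd_notMem hw0 x hy)
    convert h using 6 with m
    unfold partialFourier
    congr 1; funext y
    congr 5; ring
  have hw2 : Integrable (fun p : ℝ × ℝ => ‖w p‖ ^ 2) (volume.prod volume) := by
    refine Continuous.integrable_of_hasCompactSupport (by fun_prop) ?_
    exact (hasCompactSupport_of_eq_zero_off_rectangle hw0).norm.comp_left
      (g := fun r : ℝ => r ^ 2) (by simp)
  have hpi : ∀ m : ℤ, Integrable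
      (fun x => ‖partialFourier b (η + 2 * Real.pi * m / R₂) w x‖ ^ 2) := by
    intro m
    have hc := continuous_partialFourier hwc hw0 b (η + 2 * Real.pi * m / R₂)
    refine Continuous.integrable_of_hasCompactSupport (by fun_prop)
      (HasCompactSupport.intro (isCompact_Icc (a := -(R₁ / 2)) (b := R₁ / 2)) fun x hx => ?_)
    rw [partialFourier_eq_zero hw0 _ _ fun h => hx (Ioo_subset_Icc_self h)]
    simp
  have hyi : Integrable (fun x => R₂ * ∫ y, ‖w (x, y)‖ ^ 2) :=
    hw2.integral_prod_left.const_mul R₂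
  -- By Parseval, finite sums are bounded by the `L²` mass on each line; this is what permits
  -- exchanging the sum with the integral in `x`.
  have hsummable : Summable fun m : ℤ =>
      ∫ x, ‖‖partialFourier b (η + 2 * Real.pi * m / R₂) w x‖ ^ 2‖ := by
    refine summable_of_sum_le (c := ∫ x, R₂ * ∫ y, ‖w (x, y)‖ ^ 2)
      (fun m => integral_nonneg fun x => norm_nonneg _) fun s => ?_
    rw [← integral_finsetSum _ fun m _ => (hpi m).norm]
    refine integral_mono (integrable_finsetSum _ fun m _ => (hpi m).norm) hyi fun x => ?_
    simp only [norm_pow, norm_norm]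
    exact sum_le_hasSum s (fun m _ => by positivity) (hpt x)
  have h := hasSum_integral_of_summable_integral_norm hpi hsummable
  have e : R₂ * ∫ p in rectangle R₁ R₂, ‖w p‖ ^ 2 =
      ∫ x, ∑' m : ℤ, ‖partialFourier b (η + 2 * Real.pi * m / R₂) w x‖ ^ 2 := by
    rw [integral_congr_ae (Filter.Eventually.of_forall fun x => (hpt x).tsum_eq),
      integral_const_mul, setIntegral_eq_integral_of_forall_compl_eq_zero
      (fun p hp => by rw [hw0 p hp]; simp)]
    congr 1
    exact integral_prod _ hw2
  rw [e]
  exact h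

end

/-! ### Magnetic momenta under the partial Fourier transform -/

theorem IsTestFunction.eq_zero {Ω : Set (ℝ × ℝ)} {φ : ℝ × ℝ → ℂ} (hφ : IsTestFunction Ω φ)
    {p : ℝ × ℝ} (hp : p ∉ Ω) : φ p = 0 :=
  image_eq_zero_of_notMem_tsupport fun h => hp (hφ.support h)

theorem IsTestFunction.momentumX_eq_zero {Ω : Set (ℝ × ℝ)} {φ : ℝ × ℝ → ℂ}
    (hφ : IsTestFunction Ω φ) (b : ℝ) {p : ℝ × ℝ} (hp : p ∉ Ω) : momentumX b φ p = 0 := by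
  rw [momentumX, hφ.eq_zero hp, fderiv_of_notMem_tsupport ℝ fun h => hp (hφ.support h)]
  simp

theorem IsTestFunction.momentumY_eq_zero {Ω : Set (ℝ × ℝ)} {φ : ℝ × ℝ → ℂ}
    (hφ : IsTestFunction Ω φ) (b : ℝ) {p : ℝ × ℝ} (hp : p ∉ Ω) : momentumY b φ p = 0 := by
  rw [momentumY, hφ.eq_zero hp, fderiv_of_notMem_tsupport ℝ fun h => hp (hφ.support h)]
  simp

theorem IsTestFunction.continuous_fderiv_apply {Ω : Set (ℝ × ℝ)} {φ : ℝ × ℝ → ℂ}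
    (hφ : IsTestFunction Ω φ) (v : ℝ × ℝ) : Continuous fun p => fderiv ℝ φ p v :=
  (hφ.smooth.continuous_fderiv (by simp)).clm_apply continuous_const

theorem IsTestFunction.continuous_momentumX {Ω : Set (ℝ × ℝ)} {φ : ℝ × ℝ → ℂ}
    (hφ : IsTestFunction Ω φ) (b : ℝ) : Continuous (momentumX b φ) := by
  have := hφ.smooth.continuous
  have := hφ.continuous_fderiv_apply (1, 0)
  unfold momentumX
  fun_prop

theorem IsTestFunction.continuous_momentumY {Ω : Set (ℝ × ℝ)} {φ : ℝ × ℝ → ℂ}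
    (hφ : IsTestFunction Ω φ) (b : ℝ) : Continuous (momentumY b φ) := by
  have := hφ.smooth.continuous
  have := hφ.continuous_fderiv_apply (0, 1)
  unfold momentumY
  fun_prop

theorem IsTestFunction.hasDerivAt_fst {Ω : Set (ℝ × ℝ)} {φ : ℝ × ℝ → ℂ}
    (hφ : IsTestFunction Ω φ) (x y : ℝ) :
    HasDerivAt (fun s => φ (s, y)) (fderiv ℝ φ (x, y) (1, 0)) x :=
  (hφ.differentiableAt (x, y)).hasFDerivAt.comp_hasDerivAt x
    ((hasDerivAt_id x).prodMk (hasDerivAt_const x y))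

theorem IsTestFunction.hasDerivAt_snd {Ω : Set (ℝ × ℝ)} {φ : ℝ × ℝ → ℂ}
    (hφ : IsTestFunction Ω φ) (x y : ℝ) :
    HasDerivAt (fun s => φ (x, s)) (fderiv ℝ φ (x, y) (0, 1)) y :=
  (hφ.differentiableAt (x, y)).hasFDerivAt.comp_hasDerivAt y
    ((hasDerivAt_const y x).prodMk (hasDerivAt_id y))

/-- `momentumX` becomes the derivative in the first variable. -/
theorem hasDerivAt_partialFourier {R₁ R₂ : ℝ} {φ : ℝ × ℝ → ℂ}
    (hφ : IsTestFunction (rectangle R₁ R₂) φ) (b η x : ℝ) :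
    HasDerivAt (partialFourier b η φ) (Complex.I * partialFourier b η (momentumX b φ) x) x := by
  obtain ⟨K, hK⟩ := exists_norm_le_of_eq_zero_off_rectangle (hφ.continuous_momentumX b)
    fun p hp => hφ.momentumX_eq_zero b hp
  have hφc := hφ.smooth.continuous
  have hmc := hφ.continuous_momentumX b
  have h := hasDerivAt_integral_of_dominated_loc_of_deriv_le (𝕜 := ℝ) (μ := (volume : Measure ℝ))
    (F := fun x y => Complex.exp (-(((η + b * x / 2) * y : ℝ) : ℂ) * Complex.I) * φ (x, y))
    (F' := fun x y => Complex.I *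
      (Complex.exp (-(((η + b * x / 2) * y : ℝ) : ℂ) * Complex.I) * momentumX b φ (x, y)))
    (x₀ := x) (s := univ) (bound := (Icc (-(R₂ / 2)) (R₂ / 2)).indicator fun _ => K)
    Filter.univ_mem
    (Filter.Eventually.of_forall fun x => Continuous.aestronglyMeasurable (by fun_prop))
    (by
      refine Continuous.integrable_of_hasCompactSupport (by fun_prop) (HasCompactSupport.mul_left ?_)
      exact HasCompactSupport.intro (isCompact_Icc (a := -(R₂ / 2)) (b := R₂ / 2)) fun y hy =>
        hφ.eq_zero fun h => hy (Ioo_subset_Icc_self h.2))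
    (Continuous.aestronglyMeasurable (by fun_prop))
    (Filter.Eventually.of_forall fun y x _ => by
      rw [norm_mul, Complex.norm_I, one_mul]
      exact norm_le_bound_indicator hK (fun p hp => hφ.momentumX_eq_zero b hp) _ x y)
    (integrable_bound_indicator K R₂)
    (Filter.Eventually.of_forall fun y x _ => by
      have h1 : HasDerivAt (fun x : ℝ => -(((η + b * x / 2) * y : ℝ) : ℂ) * Complex.I)
          (-((b / 2 * y : ℝ) : ℂ) * Complex.I) x := by
        have h2 : HasDerivAt (fun x : ℝ => (η + b * x / 2) * y) (b / 2 * y) x := by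
          have := ((((hasDerivAt_id x).const_mul b).div_const 2).const_add η).mul_const y
          refine this.congr_deriv ?_
          ring
        exact (h2.ofReal_comp.neg).mul_const _
      refine (h1.cexp.fun_mul (hφ.hasDerivAt_fst x y)).congr_deriv ?_
      simp only [momentumX]
      have : Complex.I * (1 / Complex.I) = 1 := by field_simp
      push_cast
      linear_combination (-Complex.exp (-((η + b * x / 2) * y) * Complex.I) *
        fderiv ℝ φ (x, y) (1, 0)) * this)
  have hmain := h.2
  rw [integral_const_mul] at hmain
  exact hmain

/-- `momentumY` becomes multiplication by `b x + η`. -/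
theorem partialFourier_momentumY {R₁ R₂ : ℝ} {φ : ℝ × ℝ → ℂ}
    (hφ : IsTestFunction (rectangle R₁ R₂) φ) (b η x : ℝ) :
    partialFourier b η (momentumY b φ) x = ((b * x + η : ℝ) : ℂ) * partialFourier b η φ x := by
  have hφc := hφ.smooth.continuous
  have hmc := hφ.continuous_momentumY b
  have hd : ∀ y, HasDerivAt
      (fun y : ℝ => Complex.exp (-(((η + b * x / 2) * y : ℝ) : ℂ) * Complex.I) * φ (x, y))
      (Complex.I * (Complex.exp (-(((η + b * x / 2) * y : ℝ) : ℂ) * Complex.I) *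
        momentumY b φ (x, y)) - Complex.I * (((b * x + η : ℝ) : ℂ) *
        (Complex.exp (-(((η + b * x / 2) * y : ℝ) : ℂ) * Complex.I) * φ (x, y)))) y := by
    intro y
    have h1 : HasDerivAt (fun y : ℝ => -(((η + b * x / 2) * y : ℝ) : ℂ) * Complex.I)
        (-((η + b * x / 2 : ℝ) : ℂ) * Complex.I) y := by
      have h2 : HasDerivAt (fun y : ℝ => (η + b * x / 2) * y) (η + b * x / 2) y := by
        simpa using (hasDerivAt_id y).const_mul (η + b * x / 2)
      exact (h2.ofReal_comp.neg).mul_const _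
    refine (h1.cexp.fun_mul (hφ.hasDerivAt_snd x y)).congr_deriv ?_
    simp only [momentumY]
    have : Complex.I * (1 / Complex.I) = 1 := by field_simp
    push_cast
    linear_combination (-Complex.exp (-((η + b * x / 2) * y) * Complex.I) *
        fderiv ℝ φ (x, y) (0, 1)) * this
  have hcs : ∀ w : ℝ × ℝ → ℂ, (∀ p ∉ rectangle R₁ R₂, w p = 0) →
      HasCompactSupport fun y => w (x, y) := fun w hw =>
    HasCompactSupport.intro (isCompact_Icc (a := -(R₂ / 2)) (b := R₂ / 2)) fun y hy =>
        hw _ fun h => hy (Ioo_subset_Icc_self h.2)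
  have c1 := hcs φ fun p hp => hφ.eq_zero hp
  have c2 := hcs _ fun p hp => hφ.momentumY_eq_zero b hp
  have i1 := Continuous.integrable_of_hasCompactSupport (μ := (volume : Measure ℝ))
    (f := fun y : ℝ => Complex.exp (-(((η + b * x / 2) * y : ℝ) : ℂ) * Complex.I) * φ (x, y))
    (by fun_prop) c1.mul_left
  have i2 := Continuous.integrable_of_hasCompactSupport (μ := (volume : Measure ℝ))
    (f := fun y : ℝ => Complex.exp (-(((η + b * x / 2) * y : ℝ) : ℂ) * Complex.I) *
      momentumY b φ (x, y))
    (by fun_prop) c2.mul_left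
  have h0 := integral_eq_zero_of_hasDerivAt_of_integrable hd
    ((i2.const_mul Complex.I).sub ((i1.const_mul _).const_mul Complex.I)) i1
  rw [integral_sub (i2.const_mul Complex.I) ((i1.const_mul _).const_mul Complex.I),
    integral_const_mul, integral_const_mul, integral_const_mul, sub_eq_zero] at h0
  exact mul_left_cancel₀ Complex.I_ne_zero h0

/-! ### The upper bound -/

theorem landauCount_eq_ceil {b : ℝ} (hb : 0 < b) (t : ℝ) :
    landauCount b t = ⌈(t / b - 1) / 2⌉₊ := by
  have : {n : ℕ | (2 * (n : ℝ) + 1) * b < t} = ↑(Finset.range ⌈(t / b - 1) / 2⌉₊) := by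
    ext n
    simp only [mem_ofPred_eq, Finset.coe_range, mem_Iio, Nat.lt_ceil]
    rw [← lt_div_iff₀ hb]
    constructor <;> intro h <;> linarith
  rw [landauCount, this, ncard_coe_finset, Finset.card_range]

theorem le_landauCount_level {b : ℝ} (hb : 0 < b) (t : ℝ) :
    t ≤ (2 * (landauCount b t : ℝ) + 1) * b := by
  rw [landauCount_eq_ceil hb, ← div_le_iff₀ hb]
  have := Nat.le_ceil ((t / b - 1) / 2)
  linarith

theorem norm_sq_sum_of_disjoint {ι : Type*} (s : Finset ι) {a : ι → ℂ}
    (h : ∀ i j, i ≠ j → a i = 0 ∨ a j = 0) : ‖∑ i ∈ s, a i‖ ^ 2 = ∑ i ∈ s, ‖a i‖ ^ 2 := by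
  classical
  by_cases hz : ∃ i ∈ s, a i ≠ 0
  · obtain ⟨i, hi, hai⟩ := hz
    have h0 : ∀ j, j ≠ i → a j = 0 := fun j hj => (h j i hj).resolve_right hai
    rw [Finset.sum_eq_single i (fun j _ hj => h0 j hj) (fun h => absurd hi h),
      Finset.sum_eq_single i (fun j _ hj => by rw [h0 j hj]; simp) (fun h => absurd hi h)]
  · push Not at hz
    rw [Finset.sum_eq_zero hz, Finset.sum_eq_zero fun i hi => by rw [hz i hi]; simp]
    simp

theorem tile_disjoint {R : ℝ} (hR : 0 < R) {n : ℕ} {F : Fin n → ℝ → ℂ}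
    (hF : ∀ i, ∀ x ∉ Ioo (-(R / 2)) (R / 2), F i x = 0) (x : ℝ) (i j : Fin n) (hij : i ≠ j) :
    F i (x - i * R) = 0 ∨ F j (x - j * R) = 0 := by
  by_contra! h
  have h1 : x - i * R ∈ Ioo (-(R / 2)) (R / 2) := by by_contra hn; exact h.1 (hF i _ hn)
  have h2 : x - j * R ∈ Ioo (-(R / 2)) (R / 2) := by by_contra hn; exact h.2 (hF j _ hn)
  have hlt : |((i : ℕ) : ℝ) - ((j : ℕ) : ℝ)| < 1 := by
    rw [abs_lt]
    constructor
    · by_contra! hc; nlinarith [h1.1, h1.2, h2.1, h2.2]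
    · by_contra! hc; nlinarith [h1.1, h1.2, h2.1, h2.2]
  have : |((i : ℕ) : ℤ) - ((j : ℕ) : ℤ)| < 1 := by exact_mod_cast hlt
  rw [Int.abs_lt_one_iff] at this
  exact hij (Fin.ext (by omega))

theorem integral_norm_sq_sum_tiles {R : ℝ} (hR : 0 < R) {n : ℕ} {F : Fin n → ℝ → ℂ}
    (hF : ∀ i, ∀ x ∉ Ioo (-(R / 2)) (R / 2), F i x = 0) (hFc : ∀ i, Continuous (F i)) :
    ∫ x, ‖∑ i : Fin n, F i (x - i * R)‖ ^ 2 = ∑ i, ∫ x, ‖F i x‖ ^ 2 := by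
  have hinteg : ∀ i, Integrable (fun x => ‖F i x‖ ^ 2) := fun i =>
    Continuous.integrable_of_hasCompactSupport (by have := hFc i; fun_prop)
      (HasCompactSupport.intro (isCompact_Icc (a := -(R / 2)) (b := R / 2)) fun x hx => by
        rw [hF i x fun h => hx (Ioo_subset_Icc_self h)]; simp)
  simp_rw [fun x => norm_sq_sum_of_disjoint Finset.univ (tile_disjoint hR hF x)]
  rw [integral_finsetSum _ fun i _ => (hinteg i).comp_sub_right _]
  exact Finset.sum_congr rfl fun i _ =>
    integral_sub_right_eq_self (fun x => ‖F i x‖ ^ 2) (μ := volume) _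

/-- The offset `b i R₁` compensates for moving the `i`-th piece by `i R₁`: its potential `b x + b i
R₁ + κ` becomes `b x + κ` on the long interval. The `n` pieces therefore glue into one function on
the line with disjoint tiles, and a single oscillator inequality serves all of them. When the mode
is not `near`, the potential alone is at least `t` on the support and no projections are needed. -/
theorem oscillator_inequality_tiles {b t R₁ R₂ : ℝ} (hb : 0 < b) (ht : 0 ≤ t) (hR₁ : 0 < R₁)
    {M : ℕ} (hM : t ≤ (2 * (M : ℝ) + 1) * b) {n : ℕ} {φ : Fin n → ℝ × ℝ → ℂ}
    (hφ : ∀ i, IsTestFunction (rectangle R₁ R₂) (φ i)) (κ : ℝ) (near : Prop) [Decidable near]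
    (hfar : ¬ near → ∀ x ∈ Icc (-(R₁ / 2)) (n * R₁ - R₁ / 2), t ≤ (b * x + κ) ^ 2) :
    t * ∑ i : Fin n, ∫ x, ‖partialFourier b (b * (i * R₁) + κ) (φ i) x‖ ^ 2 ≤
      (∑ i : Fin n, ∫ x, ‖partialFourier b (b * (i * R₁) + κ) (momentumX b (φ i)) x‖ ^ 2) +
      (∑ i : Fin n, ∫ x, ‖partialFourier b (b * (i * R₁) + κ) (momentumY b (φ i)) x‖ ^ 2) +
      t * (if near then ∑ k ∈ Finset.range M, ‖∑ i : Fin n,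
        ∫ x, (hermiteFun b k (x + i * R₁ + κ / b) : ℂ) *
          partialFourier b (b * (i * R₁) + κ) (φ i) x‖ ^ 2 else 0) := by
  set F : Fin n → ℝ → ℂ := fun i => partialFourier b (b * (i * R₁) + κ) (φ i) with hFdef
  set FX : Fin n → ℝ → ℂ := fun i => partialFourier b (b * (i * R₁) + κ) (momentumX b (φ i))
  set FY : Fin n → ℝ → ℂ := fun i => partialFourier b (b * (i * R₁) + κ) (momentumY b (φ i))
  have hF0 : ∀ i, ∀ x ∉ Ioo (-(R₁ / 2)) (R₁ / 2), F i x = 0 := fun i x hx =>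
    partialFourier_eq_zero (fun p hp => (hφ i).eq_zero hp) _ _ hx
  have hFX0 : ∀ i, ∀ x ∉ Ioo (-(R₁ / 2)) (R₁ / 2), FX i x = 0 := fun i x hx =>
    partialFourier_eq_zero (fun p hp => (hφ i).momentumX_eq_zero b hp) _ _ hx
  have hFY0 : ∀ i, ∀ x ∉ Ioo (-(R₁ / 2)) (R₁ / 2), FY i x = 0 := fun i x hx =>
    partialFourier_eq_zero (fun p hp => (hφ i).momentumY_eq_zero b hp) _ _ hx
  have hFc : ∀ i, Continuous (F i) := fun i =>
    continuous_partialFourier (hφ i).smooth.continuous (fun p hp => (hφ i).eq_zero hp) _ _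
  have hFXc : ∀ i, Continuous (FX i) := fun i =>
    continuous_partialFourier ((hφ i).continuous_momentumX b)
      (fun p hp => (hφ i).momentumX_eq_zero b hp) _ _
  have hFYc : ∀ i, Continuous (FY i) := fun i =>
    continuous_partialFourier ((hφ i).continuous_momentumY b)
      (fun p hp => (hφ i).momentumY_eq_zero b hp) _ _
  have hFY : ∀ i x, FY i x = ((b * x + (b * (i * R₁) + κ) : ℝ) : ℂ) * F i x := fun i x =>
    partialFourier_momentumY (hφ i) b _ x
  -- The glued function. Differentiability across tile edges causes no trouble, since each piece,
  -- extended by zero, is differentiable on the whole line.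
  set f : ℝ → ℂ := fun x => ∑ i : Fin n, F i (x - i * R₁) with hf
  set f' : ℝ → ℂ := fun x => ∑ i : Fin n, Complex.I * FX i (x - i * R₁) with hf'
  have hd : ∀ x, HasDerivAt f (f' x) x := fun x => by
    refine HasDerivAt.fun_sum fun i _ => ?_
    exact (hasDerivAt_partialFourier (hφ i) b (b * (i * R₁) + κ) (x - i * R₁)).comp_sub_const x _
  have hf'c : Continuous f' := by
    refine continuous_finsetSum _ fun i _ => ?_
    have := hFXc i; fun_prop
  have hfz : ∀ x ∉ Icc (-(R₁ / 2)) (n * R₁ - R₁ / 2), f x = 0 := by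
    intro x hx
    refine Finset.sum_eq_zero fun i _ => hF0 i _ fun h => hx ⟨?_, ?_⟩
    · have : 0 ≤ (i : ℕ) * R₁ := by positivity
      linarith [h.1]
    · have : ((i : ℕ) : ℝ) + 1 ≤ n := by exact_mod_cast i.2
      nlinarith [h.2]
  have hs : HasCompactSupport f := HasCompactSupport.intro isCompact_Icc hfz
  have e1 : ∫ x, ‖f x‖ ^ 2 = ∑ i, ∫ x, ‖F i x‖ ^ 2 := integral_norm_sq_sum_tiles hR₁ hF0 hFc
  have e2 : ∫ x, ‖f' x‖ ^ 2 = ∑ i, ∫ x, ‖FX i x‖ ^ 2 := by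
    rw [← integral_norm_sq_sum_tiles hR₁ hFX0 hFXc]
    refine integral_congr_ae (Filter.Eventually.of_forall fun x => ?_)
    simp only [hf']
    rw [← Finset.mul_sum, norm_mul, Complex.norm_I, one_mul]
  have e3 : ∫ x, (b * x + κ) ^ 2 * ‖f x‖ ^ 2 = ∑ i, ∫ x, ‖FY i x‖ ^ 2 := by
    rw [← integral_norm_sq_sum_tiles hR₁ hFY0 hFYc]
    refine integral_congr_ae (Filter.Eventually.of_forall fun x => ?_)
    have : ∑ i : Fin n, FY i (x - i * R₁) = ((b * x + κ : ℝ) : ℂ) * f x := by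
      simp only [hf, Finset.mul_sum]
      refine Finset.sum_congr rfl fun i _ => ?_
      rw [hFY]; congr 2; ring
    simp only [this]
    rw [norm_mul, mul_pow, Complex.norm_real, Real.norm_eq_abs, sq_abs]
  have hfc : Continuous f := by
    refine continuous_finsetSum _ fun i _ => ?_
    have := hFc i; fun_prop
  have hs' : HasCompactSupport f' := by
    have : f' = deriv f := funext fun x => (hd x).deriv.symm
    rw [this]; exact hs.deriv
  have hn : HasCompactSupport (fun x => ‖f x‖ ^ 2) :=
    hs.norm.comp_left (g := fun r : ℝ => r ^ 2) (by simp)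
  have i1 : Integrable (fun x => ‖f x‖ ^ 2) :=
    Continuous.integrable_of_hasCompactSupport (by fun_prop) hn
  have i2 : Integrable (fun x => ‖f' x‖ ^ 2) :=
    Continuous.integrable_of_hasCompactSupport (by fun_prop)
      (hs'.norm.comp_left (g := fun r : ℝ => r ^ 2) (by simp))
  have i3 : Integrable (fun x => (b * x + κ) ^ 2 * ‖f x‖ ^ 2) :=
    Continuous.integrable_of_hasCompactSupport (by fun_prop) hn.mul_left
  change t * ∑ i, ∫ x, ‖F i x‖ ^ 2 ≤ (∑ i, ∫ x, ‖FX i x‖ ^ 2) + (∑ i, ∫ x, ‖FY i x‖ ^ 2) + _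
  rw [← e1, ← e2, ← e3]
  split_ifs with hnear
  · have h := oscillator_inequality_shift hb ht hM κ hd hf'c hs
    rw [integral_add i2 i3] at h
    refine h.trans (le_of_eq ?_)
    congr 2
    refine Finset.sum_congr rfl fun k _ => ?_
    congr 2
    have hinteg : ∀ i : Fin n, Integrable
        (fun x => (hermiteFun b k (x + i * R₁ + κ / b) : ℂ) * F i x) := fun i => by
      have := hFc i
      have := continuous_hermiteFun b k
      exact Continuous.integrable_of_hasCompactSupport (by fun_prop)
        (HasCompactSupport.mul_left (HasCompactSupport.intro
          (isCompact_Icc (a := -(R₁ / 2)) (b := R₁ / 2)) fun x hx =>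
            hF0 i x fun h => hx (Ioo_subset_Icc_self h)))
    rw [← Finset.sum_congr rfl fun (i : Fin n) _ => integral_sub_right_eq_self
      (fun x => (hermiteFun b k (x + i * R₁ + κ / b) : ℂ) * F i x) (μ := volume) (i * R₁),
      ← integral_finsetSum _ fun i _ => (hinteg i).comp_sub_right _]
    refine integral_congr_ae (Filter.Eventually.of_forall fun x => ?_)
    simp only [hf, Finset.mul_sum, sub_add_cancel]
  · rw [mul_zero, add_zero, ← integral_const_mul]
    have : ∫ x, t * ‖f x‖ ^ 2 ≤ ∫ x, (b * x + κ) ^ 2 * ‖f x‖ ^ 2 := by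
      refine integral_mono (i1.const_mul t) i3 fun x => ?_
      by_cases hx : x ∈ Icc (-(R₁ / 2)) (n * R₁ - R₁ / 2)
      · exact mul_le_mul_of_nonneg_right (hfar hnear x hx) (by positivity)
      · simp [hfz x hx]
    have h0 : 0 ≤ ∫ x, ‖f' x‖ ^ 2 := integral_nonneg fun x => by positivity
    linarith

/-! ### Landau functions on a tile and the tiled form inequality -/

theorem memLp_rectangle_of_continuous {R₁ R₂ : ℝ} {f : ℝ × ℝ → ℂ} (hf : Continuous f) :
    MemLp f 2 (volume.restrict (rectangle R₁ R₂)) := by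
  have hK : IsCompact (Icc (-(R₁ / 2)) (R₁ / 2) ×ˢ Icc (-(R₂ / 2)) (R₂ / 2)) :=
    isCompact_Icc.prod isCompact_Icc
  have hsub : rectangle R₁ R₂ ⊆ Icc (-(R₁ / 2)) (R₁ / 2) ×ˢ Icc (-(R₂ / 2)) (R₂ / 2) :=
    prod_mono Ioo_subset_Icc_self Ioo_subset_Icc_self
  have hm : MeasurableSet (rectangle R₁ R₂) := measurableSet_Ioo.prod measurableSet_Ioo
  obtain ⟨C, hC⟩ := hK.exists_bound_of_continuousOn hf.continuousOn
  have : IsFiniteMeasure (volume.restrict (rectangle R₁ R₂) : Measure (ℝ × ℝ)) :=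
    ⟨by simpa using (measure_mono hsub).trans_lt hK.measure_lt_top⟩
  refine MemLp.of_bound hf.aestronglyMeasurable C ?_
  filter_upwards [ae_restrict_mem hm] with p hp
  exact hC p (hsub hp)

/-- Landau functions in the gauge of the `i`-th tile. -/
def landauFun (b R₁ R₂ : ℝ) (k : ℕ) (κ s : ℝ) (p : ℝ × ℝ) : ℂ :=
  ((√R₂)⁻¹ * hermiteFun b k (p.1 + s * R₁ + κ / b) : ℝ) *
    Complex.exp ((((b * (s * R₁) + κ + b * p.1 / 2) * p.2 : ℝ) : ℂ) * Complex.I)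

theorem continuous_landauFun (b R₁ R₂ : ℝ) (k : ℕ) (κ s : ℝ) :
    Continuous (landauFun b R₁ R₂ k κ s) := by
  have := continuous_hermiteFun b k
  unfold landauFun
  fun_prop

/-- `landauFun` as a vector in `L²`. -/
def landauVec (b R₁ R₂ : ℝ) (k : ℕ) (κ s : ℝ) : L2 (rectangle R₁ R₂) :=
  (memLp_rectangle_of_continuous (continuous_landauFun b R₁ R₂ k κ s)).toLp

/-- The conjugated phase of a Landau function is the kernel of `partialFourier`, so by Fubini the
oscillator coefficients of the glued function are honest `L²` inner products on the rectangle. -/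
theorem inner_landauVec {b R₁ R₂ : ℝ} (k : ℕ) (κ s : ℝ)
    {u : L2 (rectangle R₁ R₂)} {φ : ℝ × ℝ → ℂ} (hφc : Continuous φ)
    (hφ0 : ∀ p ∉ rectangle R₁ R₂, φ p = 0) (hu : u =ᵐ[volume.restrict (rectangle R₁ R₂)] φ) :
    inner ℂ (landauVec b R₁ R₂ k κ s) u = ((√R₂)⁻¹ : ℝ) *
      ∫ x, (hermiteFun b k (x + s * R₁ + κ / b) : ℂ) *
        partialFourier b (b * (s * R₁) + κ) φ x := by
  have hcs := hasCompactSupport_of_eq_zero_off_rectangle hφ0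
  have hlc := continuous_landauFun b R₁ R₂ k κ s
  rw [L2.inner_def]
  have h1 : ∫ p in rectangle R₁ R₂, inner ℂ ((landauVec b R₁ R₂ k κ s : ℝ × ℝ → ℂ) p)
      ((u : ℝ × ℝ → ℂ) p) = ∫ p in rectangle R₁ R₂,
      (starRingEnd ℂ) (landauFun b R₁ R₂ k κ s p) * φ p := by
    refine integral_congr_ae ?_
    filter_upwards [hu, (memLp_rectangle_of_continuous hlc).coeFn_toLp] with p h1 h2
    rw [landauVec, h1, h2]
    simp [mul_comm]
  rw [h1, setIntegral_eq_integral_of_forall_compl_eq_zero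
    (fun p hp => by rw [hφ0 p hp, mul_zero]), ← integral_const_mul]
  have hi : Integrable (fun p => (starRingEnd ℂ) (landauFun b R₁ R₂ k κ s p) * φ p)
      (volume.prod volume) := by
    refine Continuous.integrable_of_hasCompactSupport ?_ hcs.mul_left
    exact (Complex.continuous_conj.comp hlc).mul hφc
  refine (integral_prod _ hi).trans (integral_congr_ae (Filter.Eventually.of_forall fun x => ?_))
  simp only [partialFourier]
  rw [← integral_const_mul, ← integral_const_mul]
  refine integral_congr_ae (Filter.Eventually.of_forall fun y => ?_)
  simp only [landauFun, map_mul, Complex.conj_ofReal, ← Complex.exp_conj, Complex.conj_I]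
  push_cast
  ring_nf

theorem norm_sq_eq_integral {Ω : Set (ℝ × ℝ)} {u : L2 Ω} {f : ℝ × ℝ → ℂ}
    (h : u =ᵐ[volume.restrict Ω] f) : ‖u‖ ^ 2 = ∫ p in Ω, ‖f p‖ ^ 2 := by
  have := norm_toLp_sq (Lp.memLp u)
  rw [Lp.toLp_coeFn] at this
  rw [this]
  refine integral_congr_ae ?_
  filter_upwards [h] with p hp
  rw [hp]

/-- Sums the oscillator inequalities over all modes. Parseval produces a factor `R₂` in front of the
norms and energies, while the normalization `1/√R₂` of the Landau functions accounts for it in the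
projections. Only the modes in `A` leave projections behind. -/
theorem tiled_test_inequality {b t R₁ R₂ : ℝ} (hb : 0 < b) (ht : 0 ≤ t) (hR₁ : 0 < R₁)
    (hR₂ : 0 < R₂) {M : ℕ} (hM : t ≤ (2 * (M : ℝ) + 1) * b) {n : ℕ} (A : Finset ℤ)
    (hA : ∀ m ∉ A, ∀ x ∈ Icc (-(R₁ / 2)) (n * R₁ - R₁ / 2),
      t ≤ (b * x + 2 * Real.pi * m / R₂) ^ 2)
    (g : Fin n → L2 (rectangle R₁ R₂) × L2 (rectangle R₁ R₂) × L2 (rectangle R₁ R₂))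
    (hg : ∀ i, g i ∈ testGraph b (rectangle R₁ R₂)) :
    t * ∑ i, ‖(g i).1‖ ^ 2 ≤ ∑ i, energy (g i) + t * ∑ j ∈ A ×ˢ Finset.range M,
      ‖∑ i : Fin n, inner ℂ (landauVec b R₁ R₂ j.2 (2 * Real.pi * j.1 / R₂) i) (g i).1‖ ^ 2 := by
  choose φ hφ h0 h1 h2 using hg
  have s0 := hasSum_sum (s := Finset.univ) fun (i : Fin n) _ => hasSum_integral_partialFourier hR₂
    (hφ i).smooth.continuous (fun p hp => (hφ i).eq_zero hp) b (b * (i * R₁))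
  have s1 := hasSum_sum (s := Finset.univ) fun (i : Fin n) _ => hasSum_integral_partialFourier hR₂
    ((hφ i).continuous_momentumX b) (fun p hp => (hφ i).momentumX_eq_zero b hp) b (b * (i * R₁))
  have s2 := hasSum_sum (s := Finset.univ) fun (i : Fin n) _ => hasSum_integral_partialFourier hR₂
    ((hφ i).continuous_momentumY b) (fun p hp => (hφ i).momentumY_eq_zero b hp) b (b * (i * R₁))
  have s3 := (hasSum_sum_of_ne_finset_zero (L := SummationFilter.unconditional ℤ)
    (f := fun m : ℤ => if m ∈ A then ∑ k ∈ Finset.range M, ‖∑ i : Fin n,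
        ∫ x, (hermiteFun b k (x + i * R₁ + 2 * Real.pi * m / R₂ / b) : ℂ) *
          partialFourier b (b * (i * R₁) + 2 * Real.pi * m / R₂) (φ i) x‖ ^ 2 else 0) (s := A)
    (fun k hk => if_neg hk)).mul_left t
  have h := hasSum_le (fun m : ℤ => oscillator_inequality_tiles hb ht hR₁ hM hφ
    (2 * Real.pi * m / R₂) (m ∈ A) (hA m)) (s0.mul_left t) ((s1.add s2).add s3)
  rw [Finset.sum_congr rfl (fun k hk => if_pos hk)] at h
  have hc : ∀ (i : Fin n) (m : ℤ) (k : ℕ),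
      inner ℂ (landauVec b R₁ R₂ k (2 * Real.pi * m / R₂) i) (g i).1 = ((√R₂)⁻¹ : ℝ) *
      ∫ x, (hermiteFun b k (x + i * R₁ + 2 * Real.pi * m / R₂ / b) : ℂ) *
        partialFourier b (b * (i * R₁) + 2 * Real.pi * m / R₂) (φ i) x := fun i m k =>
    inner_landauVec k _ _ (hφ i).smooth.continuous (fun p hp => (hφ i).eq_zero hp) (h0 i)
  have hcn : ∀ (m : ℤ) (k : ℕ),
      ‖∑ i : Fin n, inner ℂ (landauVec b R₁ R₂ k (2 * Real.pi * m / R₂) i) (g i).1‖ ^ 2 =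
      R₂⁻¹ * ‖∑ i : Fin n, ∫ x, (hermiteFun b k (x + i * R₁ + 2 * Real.pi * m / R₂ / b) : ℂ) *
        partialFourier b (b * (i * R₁) + 2 * Real.pi * m / R₂) (φ i) x‖ ^ 2 := by
    intro m k
    simp_rw [hc]
    rw [← Finset.mul_sum, norm_mul, mul_pow, Complex.norm_real, Real.norm_eq_abs, sq_abs, inv_pow,
      Real.sq_sqrt hR₂.le]
  rw [Finset.sum_product]
  simp only [hcn, energy, norm_sq_eq_integral (h0 _), norm_sq_eq_integral (h1 _),
    norm_sq_eq_integral (h2 _), ← Finset.mul_sum, Finset.sum_add_distrib] at h ⊢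
  have h' := mul_le_mul_of_nonneg_left h (inv_nonneg.2 hR₂.le)
  have hR : R₂⁻¹ * R₂ = 1 := inv_mul_cancel₀ hR₂.ne'
  calc _ = R₂⁻¹ * R₂ * (t * ∑ i, ∫ p in rectangle R₁ R₂, ‖φ i p‖ ^ 2) := by rw [hR, one_mul]
    _ = R₂⁻¹ * (t * (R₂ * ∑ i, ∫ p in rectangle R₁ R₂, ‖φ i p‖ ^ 2)) := by ring
    _ ≤ _ := h'
    _ = R₂⁻¹ * R₂ * ((∑ i, ∫ p in rectangle R₁ R₂, ‖momentumX b (φ i) p‖ ^ 2) +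
        ∑ i, ∫ p in rectangle R₁ R₂, ‖momentumY b (φ i) p‖ ^ 2) + _ := by rw [mul_add]; congr 1; ring
    _ = _ := by rw [hR, one_mul]; ring

/-- Both sides are continuous for the graph norm, so the inequality passes from tuples of test
functions to the closure. -/
theorem tiled_form_inequality {b t R₁ R₂ : ℝ} (hb : 0 < b) (ht : 0 ≤ t) (hR₁ : 0 < R₁)
    (hR₂ : 0 < R₂) {M : ℕ} (hM : t ≤ (2 * (M : ℝ) + 1) * b) {n : ℕ} (A : Finset ℤ)
    (hA : ∀ m ∉ A, ∀ x ∈ Icc (-(R₁ / 2)) (n * R₁ - R₁ / 2),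
      t ≤ (b * x + 2 * Real.pi * m / R₂) ^ 2)
    (g : Fin n → L2 (rectangle R₁ R₂) × L2 (rectangle R₁ R₂) × L2 (rectangle R₁ R₂))
    (hg : ∀ i, g i ∈ formGraph b (rectangle R₁ R₂)) :
    t * ∑ i, ‖(g i).1‖ ^ 2 ≤ ∑ i, energy (g i) + t * ∑ j ∈ A ×ˢ Finset.range M,
      ‖∑ i : Fin n, inner ℂ (landauVec b R₁ R₂ j.2 (2 * Real.pi * j.1 / R₂) i) (g i).1‖ ^ 2 := by
  have hmem : g ∈ closure (pi univ fun _ : Fin n =>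
      (testGraph b (rectangle R₁ R₂) : Set _)) := by
    rw [closure_pi_set]
    exact fun i _ => hg i
  refine closure_minimal (t := {g : Fin n → L2 (rectangle R₁ R₂) × L2 (rectangle R₁ R₂) ×
    L2 (rectangle R₁ R₂) | t * ∑ i, ‖(g i).1‖ ^ 2 ≤ ∑ i, energy (g i) +
    t * ∑ j ∈ A ×ˢ Finset.range M, ‖∑ i : Fin n,
      inner ℂ (landauVec b R₁ R₂ j.2 (2 * Real.pi * j.1 / R₂) i) (g i).1‖ ^ 2})
    (fun g hg => tiled_test_inequality hb ht hR₁ hR₂ hM A hA g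
      fun i => (mem_univ_pi.1 hg i))
    (isClosed_le ?_ ?_) hmem
  · fun_prop
  · have := fun i : Fin n => continuous_energy.comp (continuous_apply
      (A := fun _ : Fin n => L2 (rectangle R₁ R₂) × L2 (rectangle R₁ R₂) × L2 (rectangle R₁ R₂)) i)
    refine (continuous_finsetSum _ fun i _ => this i).add ?_
    fun_prop

/-- A finite set of Fourier modes containing all those that are relevant below the energy `t`. -/
theorem exists_near_modes {b R₁ R₂ : ℝ} (hb : 0 < b) (hR₁ : 0 < R₁) (hR₂ : 0 < R₂) {t : ℝ}
    (n : ℕ) : ∃ A : Finset ℤ,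
      (∀ m ∉ A, ∀ x ∈ Icc (-(R₁ / 2)) (n * R₁ - R₁ / 2),
        t ≤ (b * x + 2 * Real.pi * m / R₂) ^ 2) ∧
      (A.card : ℝ) ≤ (2 * √t + b * (n * R₁)) * R₂ / (2 * Real.pi) + 1 := by
  have hπ := Real.pi_pos
  -- Outside `[l, u]` the quantity `b x + 2πm/R₂` keeps one sign on the whole strip and has absolute
  -- value at least `√t`. The length `u - l` is the main term of the mode count.
  set l := (-√t - b * (n * R₁ - R₁ / 2)) * R₂ / (2 * Real.pi) with hl
  set u := (√t + b * (R₁ / 2)) * R₂ / (2 * Real.pi) with hu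
  refine ⟨Finset.Icc ⌈l⌉ ⌊u⌋, fun m hm x hx => ?_, ?_⟩
  · rw [← sq_abs]
    refine (Real.sqrt_le_iff.1 ?_).2
    rw [Finset.mem_Icc, not_and_or, not_le, not_le, Int.lt_ceil, Int.floor_lt] at hm
    rcases hm with hm | hm
    · rw [hl, lt_div_iff₀ (by positivity)] at hm
      have h1 : 2 * Real.pi * m / R₂ < -√t - b * (n * R₁ - R₁ / 2) := by
        rw [div_lt_iff₀ hR₂]; linarith
      have h2 := mul_le_mul_of_nonneg_left hx.2 hb.le
      exact le_trans (by linarith) (neg_le_abs _)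
    · rw [hu, div_lt_iff₀ (by positivity)] at hm
      have h1 : √t + b * (R₁ / 2) < 2 * Real.pi * m / R₂ := by
        rw [lt_div_iff₀ hR₂]; linarith
      have h2 := mul_le_mul_of_nonneg_left hx.1 hb.le
      exact le_trans (by linarith) (le_abs_self _)
  · rw [Int.card_Icc]
    have h0 : u - l = (2 * √t + b * (n * R₁)) * R₂ / (2 * Real.pi) := by
      rw [hl, hu]; field_simp; ring
    have hpos : 0 ≤ u - l := by rw [h0]; positivity
    have h1 : ((⌊u⌋ + 1 - ⌈l⌉ : ℤ) : ℝ) ≤ u - l + 1 := by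
      push_cast
      linarith [Int.floor_le u, Int.le_ceil l]
    rw [← h0]
    rcases le_or_gt 0 (⌊u⌋ + 1 - ⌈l⌉) with h | h
    · have : (((⌊u⌋ + 1 - ⌈l⌉).toNat : ℤ) : ℝ) = ((⌊u⌋ + 1 - ⌈l⌉ : ℤ) : ℝ) := by
        rw [Int.toNat_of_nonneg h]
      rw [Int.cast_natCast] at this
      rw [this]; exact h1
    · rw [Int.toNat_of_nonpos h.le]; simp; linarith

/-- For a single tile, the tiled inequality is already the finite-rank estimate, so no embedding
theorem is required. -/
theorem formCompact_rectangle {b R₁ R₂ : ℝ} (hb : 0 < b) (hR₁ : 0 < R₁) (hR₂ : 0 < R₂) :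
    FormCompact (formGraph b (rectangle R₁ R₂)) := by
  intro T hT
  obtain ⟨A, hA, -⟩ := exists_near_modes hb hR₁ hR₂ (t := T) 1
  set M := landauCount b T
  let J := A ×ˢ Finset.range M
  refine ⟨Fintype.card J, fun j => landauVec b R₁ R₂ ((Fintype.equivFin J).symm j).1.2
    (2 * Real.pi * ((Fintype.equivFin J).symm j).1.1 / R₂) (0 : ℕ), fun g hg => ?_⟩
  have h := tiled_form_inequality hb hT.le hR₁ hR₂ (le_landauCount_level hb T) A hA
    (fun _ : Fin 1 => g) (fun _ => hg)
  simp only [Finset.univ_unique, Finset.sum_singleton] at h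
  refine h.trans (le_of_eq ?_)
  congr 2
  rw [Equiv.sum_comp (Fintype.equivFin J).symm (fun j : J => ‖inner ℂ (landauVec b R₁ R₂ j.1.2
    (2 * Real.pi * j.1.1 / R₂) (0 : ℕ)) g.1‖ ^ 2)]
  exact (Finset.sum_coe_sort J (fun j : ℤ × ℕ => ‖inner ℂ (landauVec b R₁ R₂ j.2
    (2 * Real.pi * j.1 / R₂) (0 : ℕ)) g.1‖ ^ 2)).symm

/-- Maps `n` low-energy vectors to their joint Landau coefficients. A nonzero tuple in the kernel
would have energy at least `t` times its squared norm by the tiled inequality, although low-energy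
vectors have strictly less. -/
theorem mul_finrank_lowSpace_le {b t R₁ R₂ : ℝ} (hb : 0 < b) (ht : 0 ≤ t) (hR₁ : 0 < R₁)
    (hR₂ : 0 < R₂) (n : ℕ) :
    (n : ℝ) * Module.finrank ℂ (lowSpace (formGraph b (rectangle R₁ R₂)) t) ≤
      ((2 * √t + b * (n * R₁)) * R₂ / (2 * Real.pi) + 1) * landauCount b t := by
  obtain ⟨A, hA, hcard⟩ := exists_near_modes hb hR₁ hR₂ (t := t) n
  set M := landauCount b t
  set V := lowSpace (formGraph b (rectangle R₁ R₂)) t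
  have hfd : FiniteDimensional ℂ V := (formCompact_rectangle hb hR₁ hR₂).finiteDimensional_lowSpace t
  let J := A ×ˢ Finset.range M
  let T : (Fin n → V) →ₗ[ℂ] (J → ℂ) := LinearMap.pi fun j => ∑ i : Fin n,
    (innerSL ℂ (landauVec b R₁ R₂ j.1.2 (2 * Real.pi * j.1.1 / R₂) i)).toLinearMap ∘ₗ V.subtype ∘ₗ
      LinearMap.proj i
  have hT : ∀ v j, T v j = ∑ i : Fin n,
      inner ℂ (landauVec b R₁ R₂ j.1.2 (2 * Real.pi * j.1.1 / R₂) i) (v i : L2 (rectangle R₁ R₂)) := by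
    intro v j
    simp [T]
  have hinj : Function.Injective T := by
    rw [← LinearMap.ker_eq_bot, LinearMap.ker_eq_bot']
    intro v hv
    by_contra hne
    -- Some entries of the tuple may vanish; these give only the weak inequality, and one nonzero
    -- entry makes the sum strict.
    have hlift : ∀ i, ∃ g ∈ formGraph b (rectangle R₁ R₂), g.1 = (v i : L2 (rectangle R₁ R₂)) ∧
        energy g ≤ t * ‖(v i : L2 (rectangle R₁ R₂))‖ ^ 2 ∧
        (v i ≠ 0 → energy g < t * ‖(v i : L2 (rectangle R₁ R₂))‖ ^ 2) := by
      intro i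
      by_cases h0 : v i = 0
      · exact ⟨0, zero_mem _, by simp [h0], by simp [h0, energy], fun h => absurd h0 h⟩
      · obtain ⟨g, hg, hgv, hlt⟩ := exists_energy_lt_of_mem_lowSpace (v i).2
          (fun h => h0 (Subtype.ext h))
        exact ⟨g, hg, hgv, hlt.le, fun _ => hlt⟩
    choose g hg hgv hle hlt using hlift
    have h := tiled_form_inequality hb ht hR₁ hR₂ (le_landauCount_level hb t) A hA g hg
    have hzero : ∑ j ∈ A ×ˢ Finset.range M, ‖∑ i : Fin n,
        inner ℂ (landauVec b R₁ R₂ j.2 (2 * Real.pi * j.1 / R₂) i) (g i).1‖ ^ 2 = 0 := by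
      refine Finset.sum_eq_zero fun j hj => ?_
      have := congrFun hv ⟨j, hj⟩
      rw [hT] at this
      simp only [hgv]
      rw [this]; simp
    rw [hzero, mul_zero, add_zero, Finset.mul_sum] at h
    obtain ⟨i, hi⟩ : ∃ i, v i ≠ 0 := Function.ne_iff.1 hne
    simp only [hgv] at h
    exact absurd h (not_le.2 (Finset.sum_lt_sum (fun i _ => hle i) ⟨i, Finset.mem_univ i, hlt i hi⟩))
  have hdim := LinearMap.finrank_le_finrank_of_injective hinj
  rw [Module.finrank_pi_fintype, Module.finrank_fintype_fun_eq_card, Finset.sum_const,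
    Finset.card_univ, Fintype.card_fin, smul_eq_mul, Fintype.card_coe, Finset.card_product,
    Finset.card_range] at hdim
  calc (n : ℝ) * Module.finrank ℂ V ≤ (A.card : ℝ) * M := by exact_mod_cast hdim
    _ ≤ _ := by gcongr

/-- The limit of many tiles: an overhead `d` independent of `n` disappears after division by `n`. -/
theorem le_of_forall_nat_mul_le {a c d : ℝ} (h : ∀ n : ℕ, n * a ≤ n * c + d) : a ≤ c := by
  by_contra! hlt
  obtain ⟨n, hn⟩ := exists_nat_gt (d / (a - c))
  rw [div_lt_iff₀ (by linarith)] at hn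
  linarith [h n]

/-- Upper bound for the number of eigenvalues below `t`. -/
theorem finrank_lowSpace_le {b t R₁ R₂ : ℝ} (hb : 0 < b) (ht : 0 ≤ t) (hR₁ : 0 < R₁)
    (hR₂ : 0 < R₂) :
    (Module.finrank ℂ (lowSpace (formGraph b (rectangle R₁ R₂)) t) : ℝ) ≤
      b * (R₁ * R₂) / (2 * Real.pi) * landauCount b t := by
  refine le_of_forall_nat_mul_le (d := (2 * √t * R₂ / (2 * Real.pi) + 1) * landauCount b t)
    fun n => (mul_finrank_lowSpace_le hb ht hR₁ hR₂ n).trans (le_of_eq ?_)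
  ring

theorem isOpen_rectangle (R₁ R₂ : ℝ) : IsOpen (rectangle R₁ R₂) := isOpen_Ioo.prod isOpen_Ioo

theorem volume_real_rectangle {R₁ R₂ : ℝ} (hR₁ : 0 < R₁) (hR₂ : 0 < R₂) :
    volume.real (rectangle R₁ R₂) = R₁ * R₂ := by
  rw [rectangle, Measure.volume_eq_prod, Measure.real, Measure.prod_prod, Real.volume_Ioo,
    Real.volume_Ioo, ENNReal.toReal_mul, ENNReal.toReal_ofReal (by linarith),
    ENNReal.toReal_ofReal (by linarith)]
  ring

theorem eigenvalueCount_rectangle {b t R₁ R₂ : ℝ} (hb : 0 < b) (hR₁ : 0 < R₁) (hR₂ : 0 < R₂) :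
    eigenvalueCount (dirichletOperator b (rectangle R₁ R₂)) t = ENNReal.ofReal
      (Module.finrank ℂ (lowSpace (formGraph b (rectangle R₁ R₂)) t) : ℝ) := by
  rw [eigenvalueCount_eq_finrank b (isOpen_rectangle R₁ R₂) t (formCompact_rectangle hb hR₁ hR₂),
    ENNReal.ofReal_natCast]

/-! ### Cutoff functions -/

theorem deriv_smoothTransition_of_nonpos {x : ℝ} (hx : x ≤ 0) :
    deriv Real.smoothTransition x = 0 := by
  refine IsLocalMin.deriv_eq_zero (Filter.Eventually.of_forall fun y => ?_)
  rw [Real.smoothTransition.zero_of_nonpos hx]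
  exact Real.smoothTransition.nonneg y

theorem deriv_smoothTransition_of_one_le {x : ℝ} (hx : 1 ≤ x) :
    deriv Real.smoothTransition x = 0 := by
  refine IsLocalMax.deriv_eq_zero (Filter.Eventually.of_forall fun y => ?_)
  rw [Real.smoothTransition.one_of_one_le hx]
  exact Real.smoothTransition.le_one y

theorem differentiable_smoothTransition : Differentiable ℝ Real.smoothTransition :=
  (Real.smoothTransition.contDiff (n := 1)).differentiable (by simp)

theorem exists_bound_deriv_smoothTransition :
    ∃ K : ℝ, 0 < K ∧ ∀ x, |deriv Real.smoothTransition x| ≤ K := by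
  have hc : Continuous (deriv Real.smoothTransition) :=
    (Real.smoothTransition.contDiff (n := 1)).continuous_deriv (by simp)
  obtain ⟨K, hK⟩ := (isCompact_Icc (a := (0 : ℝ)) (b := 1)).exists_bound_of_continuousOn
    hc.continuousOn
  refine ⟨max K 1, by positivity, fun x => ?_⟩
  rcases le_or_gt x 0 with h | h
  · rw [deriv_smoothTransition_of_nonpos h]; simp
  · rcases le_or_gt 1 x with h' | h'
    · rw [deriv_smoothTransition_of_one_le h']; simp
    · exact (hK x ⟨h.le, h'.le⟩).trans (le_max_left _ _)

/-- A cutoff `α` whose squared translates by multiples of `s` form a partition of unity: on one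
period only `α` and its translate by `s` are nonzero, and there they are the sine and the cosine
of the same angle. -/
structure IsCutoff (s δ K : ℝ) (α α' : ℝ → ℝ) : Prop where
  smooth : ContDiff ℝ ∞ α
  hasDeriv : ∀ y, HasDerivAt α (α' y) y
  continuous_deriv : Continuous α'
  zero : ∀ y, s / 2 + δ ≤ |y| → α y = 0 ∧ α' y = 0
  period : ∀ y ∈ Icc (-(s / 2) - δ) (s / 2 - δ), ∃ S C D : ℝ, S ^ 2 + C ^ 2 = 1 ∧
    α y = S ∧ α (y + s) = C ∧ α' y = D * C ∧ α' (y + s) = -(D * S) ∧ D ^ 2 ≤ K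

/-- Take `sin θ(y + s/2) cos θ(y - s/2)`, where the angle `θ` rises smoothly from `0` to `π/2`
across `[-δ, δ]`. Near the left edge the cosine factor is `1`, near the right edge the sine factor
is `1`, and translation by `s` brings the two edges to the same angle. The condition `2 δ ≤ s` keeps
the two transitions from overlapping. -/
theorem exists_isCutoff : ∃ K : ℝ, 0 < K ∧ ∀ s δ : ℝ, 0 < δ → 2 * δ ≤ s →
    ∃ α α' : ℝ → ℝ, IsCutoff s δ (K / δ ^ 2) α α' := by
  obtain ⟨K₀, hK₀, hK⟩ := exists_bound_deriv_smoothTransition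
  refine ⟨(Real.pi / 4 * K₀) ^ 2, by positivity, fun s δ hδ hs => ?_⟩
  set θ : ℝ → ℝ := fun z => Real.pi / 2 * Real.smoothTransition ((z + δ) / (2 * δ)) with hθ
  set θ' : ℝ → ℝ := fun z =>
    Real.pi / 2 * (deriv Real.smoothTransition ((z + δ) / (2 * δ)) / (2 * δ)) with hθ'
  have hθc : ContDiff ℝ ∞ θ :=
    contDiff_const.mul ((Real.smoothTransition.contDiff (n := ⊤)).comp (by fun_prop))
  have hθd : ∀ z, HasDerivAt θ (θ' z) z := by
    intro z
    have h1 : HasDerivAt (fun z : ℝ => (z + δ) / (2 * δ)) (1 / (2 * δ)) z :=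
      ((hasDerivAt_id z).add_const δ).div_const _
    have h2 := (differentiable_smoothTransition ((z + δ) / (2 * δ))).hasDerivAt.comp z h1
    refine (h2.const_mul (Real.pi / 2)).congr_deriv ?_
    simp only [hθ']; ring
  have hθ'c : Continuous θ' := by
    have hc : Continuous (deriv Real.smoothTransition) :=
      (Real.smoothTransition.contDiff (n := 1)).continuous_deriv (by simp)
    fun_prop
  have hlow : ∀ z, z ≤ -δ → θ z = 0 ∧ θ' z = 0 := by
    intro z hz
    have : (z + δ) / (2 * δ) ≤ 0 := div_nonpos_of_nonpos_of_nonneg (by linarith) (by linarith)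
    simp [hθ, hθ', Real.smoothTransition.zero_of_nonpos this,
      deriv_smoothTransition_of_nonpos this]
  have hhigh : ∀ z, δ ≤ z → θ z = Real.pi / 2 ∧ θ' z = 0 := by
    intro z hz
    have : 1 ≤ (z + δ) / (2 * δ) := by rw [le_div_iff₀ (by linarith)]; linarith
    simp [hθ, hθ', Real.smoothTransition.one_of_one_le this,
      deriv_smoothTransition_of_one_le this]
  have hbound : ∀ z, θ' z ^ 2 ≤ (Real.pi / 4 * K₀) ^ 2 / δ ^ 2 := by
    intro z
    rw [← div_pow, ← sq_abs]
    refine pow_le_pow_left₀ (abs_nonneg _) ?_ 2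
    simp only [hθ']
    rw [abs_mul, abs_of_pos (by positivity : 0 < Real.pi / 2), abs_div,
      abs_of_pos (by positivity : 0 < 2 * δ)]
    calc Real.pi / 2 * (|deriv Real.smoothTransition ((z + δ) / (2 * δ))| / (2 * δ))
        ≤ Real.pi / 2 * (K₀ / (2 * δ)) := by gcongr; exact hK _
      _ = Real.pi / 4 * K₀ / δ := by field_simp; ring
  refine ⟨fun y => Real.sin (θ (y + s / 2)) * Real.cos (θ (y - s / 2)),
    fun y => θ' (y + s / 2) * Real.cos (θ (y + s / 2)) * Real.cos (θ (y - s / 2)) -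
      θ' (y - s / 2) * Real.sin (θ (y + s / 2)) * Real.sin (θ (y - s / 2)), ?_, ?_, ?_, ?_, ?_⟩
  · exact (Real.contDiff_sin.comp (hθc.comp (by fun_prop))).mul
      (Real.contDiff_cos.comp (hθc.comp (by fun_prop)))
  · intro y
    have h1 : HasDerivAt (fun y => θ (y + s / 2)) (θ' (y + s / 2)) y :=
      (hθd (y + s / 2)).comp_add_const y (s / 2)
    have h2 : HasDerivAt (fun y => θ (y - s / 2)) (θ' (y - s / 2)) y :=
      (hθd (y - s / 2)).comp_sub_const y (s / 2)
    refine (h1.sin.fun_mul h2.cos).congr_deriv ?_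
    ring
  · have := hθc.continuous
    fun_prop
  · intro y hy
    rcases le_abs.1 hy with h | h
    · obtain ⟨h1, h2⟩ := hhigh (y - s / 2) (by linarith)
      simp [h1, h2]
    · obtain ⟨h1, h2⟩ := hlow (y + s / 2) (by linarith)
      simp [h1, h2]
  · intro y hy
    refine ⟨Real.sin (θ (y + s / 2)), Real.cos (θ (y + s / 2)), θ' (y + s / 2),
      Real.sin_sq_add_cos_sq _, ?_, ?_, ?_, ?_, hbound _⟩
    · obtain ⟨h1, h2⟩ := hlow (y - s / 2) (by linarith [hy.2])
      simp [h1]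
    · obtain ⟨h1, h2⟩ := hhigh (y + s + s / 2) (by linarith [hy.1])
      rw [h1, show y + s - s / 2 = y + s / 2 by ring]
      simp
    · obtain ⟨h1, h2⟩ := hlow (y - s / 2) (by linarith [hy.2])
      simp [h1, h2]
    · obtain ⟨h1, h2⟩ := hhigh (y + s + s / 2) (by linarith [hy.1])
      rw [h1, h2, show y + s - s / 2 = y + s / 2 by ring]
      simp

/-- The orthogonal matrix with rows `(S, C)` and `(C, -S)` is applied to the vector `(v, D u)`. This
is why the IMS formula has no cross terms. -/
theorem norm_sq_rotation {S C : ℝ} (h : S ^ 2 + C ^ 2 = 1) (D : ℝ) (u v : ℂ) :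
    ‖(S : ℂ) * v + ((D * C : ℝ) : ℂ) * u‖ ^ 2 + ‖(C : ℂ) * v + ((-(D * S) : ℝ) : ℂ) * u‖ ^ 2 =
      ‖v‖ ^ 2 + D ^ 2 * ‖u‖ ^ 2 := by
  simp only [← Complex.normSq_eq_norm_sq, Complex.normSq_apply, Complex.add_re, Complex.add_im,
    Complex.re_ofReal_mul, Complex.im_ofReal_mul]
  linear_combination (v.re ^ 2 + v.im ^ 2 + D ^ 2 * (u.re ^ 2 + u.im ^ 2)) * h

section Cutoff

variable {s δ K : ℝ} {α α' : ℝ → ℝ}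

theorem IsCutoff.exists_period (hs : 0 < s) (x : ℝ) :
    ∃ (y : ℝ) (j : ℤ), y ∈ Icc (-(s / 2) - δ) (s / 2 - δ) ∧ x = y + j * s := by
  set a := -(s / 2) - δ
  refine ⟨x - ⌊(x - a) / s⌋ * s, ⌊(x - a) / s⌋, ⟨?_, ?_⟩, by ring⟩
  · have := Int.floor_le ((x - a) / s)
    rw [le_div_iff₀ hs] at this
    linarith
  · have := (Int.lt_floor_add_one ((x - a) / s)).le
    rw [div_le_iff₀ hs] at this
    simp only [a] at *
    linarith

theorem IsCutoff.eq_zero_of_ne (hα : IsCutoff s δ K α α') (hδ : 0 < δ) (hs : 2 * δ ≤ s) {y : ℝ}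
    (hy : y ∈ Icc (-(s / 2) - δ) (s / 2 - δ)) {j : ℤ} (h0 : j ≠ 0) (h1 : j ≠ 1) :
    α (y + j * s) = 0 ∧ α' (y + j * s) = 0 := by
  refine hα.zero _ ?_
  have hs0 : 0 < s := by linarith
  rcases lt_or_gt_of_ne h0 with h | h
  · have : (j : ℝ) ≤ -1 := by exact_mod_cast (by omega : j ≤ -1)
    refine le_trans ?_ (neg_le_abs _)
    nlinarith [hy.2]
  · have : (2 : ℝ) ≤ j := by exact_mod_cast (by omega : 2 ≤ j)
    refine le_trans ?_ (le_abs_self _)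
    nlinarith [hy.1]

/-- The IMS localization formula, pointwise, as an inequality for finitely many tiles. -/
theorem IsCutoff.sum_le (hα : IsCutoff s δ K α α') (hδ : 0 < δ) (hs : 2 * δ ≤ s)
    (F : Finset ℤ) (x : ℝ) (u v : ℂ) :
    ∑ i ∈ F, ‖(α (x - i * s) : ℂ) * v + (α' (x - i * s) : ℂ) * u‖ ^ 2 ≤
      ‖v‖ ^ 2 + K * ‖u‖ ^ 2 := by
  classical
  obtain ⟨y, j, hy, rfl⟩ := IsCutoff.exists_period (δ := δ) (by linarith : 0 < s) x
  obtain ⟨S, C, D, hSC, e1, e2, e3, e4, hD⟩ := hα.period y hy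
  have hz : ∀ i : ℤ, i ≠ j → i ≠ j - 1 →
      ‖(α (y + j * s - i * s) : ℂ) * v + (α' (y + j * s - i * s) : ℂ) * u‖ ^ 2 = 0 := by
    intro i h1 h2
    have := hα.eq_zero_of_ne hδ hs hy (j := j - i) (by omega) (by omega)
    push_cast at this
    rw [show y + j * s - i * s = y + (j - i) * s by ring, this.1, this.2]
    simp
  -- At a given point only the tiles `j - 1` and `j` are active. They are adjoined to `F` so that
  -- the sum reduces to exactly these two.
  calc _ ≤ ∑ i ∈ F ∪ {j - 1, j},
        ‖(α (y + j * s - i * s) : ℂ) * v + (α' (y + j * s - i * s) : ℂ) * u‖ ^ 2 :=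
        Finset.sum_le_sum_of_subset_of_nonneg Finset.subset_union_left fun _ _ _ => by positivity
    _ = ∑ i ∈ {j - 1, j},
        ‖(α (y + j * s - i * s) : ℂ) * v + (α' (y + j * s - i * s) : ℂ) * u‖ ^ 2 := by
        refine (Finset.sum_subset Finset.subset_union_right fun i _ hi => hz i ?_ ?_).symm
        · rintro rfl; simp at hi
        · rintro rfl; simp at hi
    _ = ‖v‖ ^ 2 + D ^ 2 * ‖u‖ ^ 2 := by
        rw [Finset.sum_pair (by omega), ← norm_sq_rotation hSC D u v, add_comm,
          show y + j * s - j * s = y by ring,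
          show y + j * s - ((j - 1 : ℤ) : ℝ) * s = y + s by push_cast; ring, e1, e2, e3, e4]
    _ ≤ _ := by gcongr

theorem IsCutoff.sum_sq_le_one (hα : IsCutoff s δ K α α') (hδ : 0 < δ) (hs : 2 * δ ≤ s)
    (F : Finset ℤ) (x : ℝ) : ∑ i ∈ F, α (x - i * s) ^ 2 ≤ 1 := by
  have := hα.sum_le hδ hs F x 0 1
  simpa using this

/-- The margin of one period at each end ensures that both active indices lie in `[p, q]`. -/
theorem IsCutoff.sum_sq_eq_one (hα : IsCutoff s δ K α α') (hδ : 0 < δ) (hs : 2 * δ ≤ s)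
    {p q : ℤ} {x : ℝ} (hx : x ∈ Icc ((p + 1) * s) ((q - 1) * s)) :
    ∑ i ∈ Finset.Icc p q, α (x - i * s) ^ 2 = 1 := by
  have hs0 : 0 < s := by linarith
  obtain ⟨y, j, hy, rfl⟩ := IsCutoff.exists_period (δ := δ) hs0 x
  obtain ⟨S, C, D, hSC, e1, e2, -, -, -⟩ := hα.period y hy
  have hjp : p ≤ j - 1 := by
    have : (p : ℝ) < j := by
      by_contra! h
      nlinarith [hx.1, hy.2]
    have : p < j := by exact_mod_cast this
    omega
  have hjq : j ≤ q := by
    have : (j : ℝ) < q + 1 := by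
      by_contra! h
      nlinarith [hx.2, hy.1]
    have : j < q + 1 := by exact_mod_cast this
    omega
  have hz : ∀ i : ℤ, i ∉ ({j - 1, j} : Finset ℤ) → α (y + j * s - i * s) ^ 2 = 0 := by
    intro i hi
    simp only [Finset.mem_insert, Finset.mem_singleton, not_or] at hi
    have := hα.eq_zero_of_ne hδ hs hy (j := j - i) (by omega) (by omega)
    push_cast at this
    rw [show y + j * s - i * s = y + (j - i) * s by ring, this.1]
    simp
  rw [← Finset.sum_subset (s₁ := {j - 1, j}) (fun i hi => ?_) (fun i _ hi => hz i hi)]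
  · rw [Finset.sum_pair (by omega), show y + j * s - j * s = y by ring,
      show y + j * s - ((j - 1 : ℤ) : ℝ) * s = y + s by push_cast; ring, e1, e2]
    linarith
  · simp only [Finset.mem_insert, Finset.mem_singleton] at hi
    rw [Finset.mem_Icc]
    omega

/-- The support fits into two consecutive periods because `2 δ ≤ s`; the second is folded back onto
the first. -/
theorem IsCutoff.integral_eq (hα : IsCutoff s δ K α α') (hδ : 0 < δ) (hs : 2 * δ ≤ s)
    {g : ℝ → ℝ} (hg : Continuous g) (hg0 : ∀ y, α y = 0 → α' y = 0 → g y = 0) :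
    ∫ y, g y = ∫ y in (-(s / 2) - δ)..(s / 2 - δ), (g y + g (y + s)) := by
  have hii : ∀ a b : ℝ, IntervalIntegrable g volume a b := fun a b => hg.intervalIntegrable a b
  have h1 : ∫ y, g y = ∫ y in (-(s / 2) - δ)..(s / 2 - δ + s), g y := by
    rw [intervalIntegral.integral_of_le (by linarith)]
    refine (setIntegral_eq_integral_of_forall_compl_eq_zero fun y hy => ?_).symm
    have := hα.zero y (by
      by_contra! h
      rw [abs_lt] at h
      exact hy ⟨by linarith [h.1], by linarith [h.2]⟩)
    exact hg0 y this.1 this.2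
  have h2 : ∫ y in (-(s / 2) - δ)..(s / 2 - δ), g (y + s) =
      ∫ y in (s / 2 - δ)..(s / 2 - δ + s), g y := by
    rw [intervalIntegral.integral_comp_add_right]
    congr 1; ring
  have h3 : IntervalIntegrable (fun y => g (y + s)) volume (-(s / 2) - δ) (s / 2 - δ) :=
    Continuous.intervalIntegrable (by fun_prop) _ _
  rw [h1, intervalIntegral.integral_add (hii _ _) h3, h2,
    intervalIntegral.integral_add_adjacent_intervals (hii _ _) (hii _ _)]

end Cutoff

/-! ### Trigonometric polynomials -/

/-- The trigonometric polynomial with frequencies `2πm/s`, `m ∈ A`. -/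
def trigPoly (s : ℝ) (A : Finset ℤ) (a : ℤ → ℂ) (y : ℝ) : ℂ :=
  ∑ m ∈ A, a m * Complex.exp (((2 * Real.pi * m / s * y : ℝ) : ℂ) * Complex.I)

theorem continuous_trigPoly (s : ℝ) (A : Finset ℤ) (a : ℤ → ℂ) : Continuous (trigPoly s A a) := by
  unfold trigPoly; fun_prop

theorem trigPoly_add_period {s : ℝ} (hs : s ≠ 0) (A : Finset ℤ) (a : ℤ → ℂ) (y : ℝ) :
    trigPoly s A a (y + s) = trigPoly s A a y := by
  refine Finset.sum_congr rfl fun m _ => ?_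
  congr 1
  have : ((2 * Real.pi * m / s * (y + s) : ℝ) : ℂ) * Complex.I =
      ((2 * Real.pi * m / s * y : ℝ) : ℂ) * Complex.I + m * (2 * Real.pi * Complex.I) := by
    have hsc : (s : ℂ) ≠ 0 := by exact_mod_cast hs
    push_cast
    field_simp
  rw [this, Complex.exp_add, Complex.exp_int_mul_two_pi_mul_I, mul_one]

theorem integral_exp_period {s : ℝ} (hs : 0 < s) (a : ℝ) (m : ℤ) :
    ∫ y in a..(a + s), Complex.exp (((2 * Real.pi * m / s * y : ℝ) : ℂ) * Complex.I) =
      if m = 0 then (s : ℂ) else 0 := by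
  split_ifs with h
  · subst h; simp
  · have hsc : (s : ℂ) ≠ 0 := by exact_mod_cast hs.ne'
    have hm : (m : ℂ) ≠ 0 := by exact_mod_cast h
    have hc : (2 * Real.pi * m / s * Complex.I : ℂ) ≠ 0 := by
      have := Real.pi_ne_zero
      have : (Real.pi : ℂ) ≠ 0 := by exact_mod_cast this
      simp [hm, hsc, this]
    have h1 : ∀ y : ℝ, Complex.exp (((2 * Real.pi * m / s * y : ℝ) : ℂ) * Complex.I) =
        Complex.exp ((2 * Real.pi * m / s * Complex.I : ℂ) * y) := fun y => by
      congr 1; push_cast; ring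
    simp_rw [h1]
    rw [integral_exp_mul_complex hc]
    have h2 : (2 * Real.pi * m / s * Complex.I : ℂ) * ((a + s : ℝ) : ℂ) =
        (2 * Real.pi * m / s * Complex.I : ℂ) * (a : ℂ) + m * (2 * Real.pi * Complex.I) := by
      push_cast; field_simp
    rw [h2, Complex.exp_add, Complex.exp_int_mul_two_pi_mul_I, mul_one, sub_self, zero_div]

theorem integral_norm_sq_trigPoly {s : ℝ} (hs : 0 < s) (a₀ : ℝ) (A : Finset ℤ) (a : ℤ → ℂ) :
    ∫ y in a₀..(a₀ + s), ‖trigPoly s A a y‖ ^ 2 = s * ∑ m ∈ A, ‖a m‖ ^ 2 := by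
  rw [← Complex.ofReal_inj, ← intervalIntegral.integral_ofReal]
  have hpt : ∀ y : ℝ, ((‖trigPoly s A a y‖ ^ 2 : ℝ) : ℂ) = ∑ m ∈ A, ∑ l ∈ A,
      (starRingEnd ℂ) (a m) * a l *
        Complex.exp (((2 * Real.pi * ((l - m : ℤ) : ℝ) / s * y : ℝ) : ℂ) * Complex.I) := by
    intro y
    rw [← Complex.normSq_eq_norm_sq, Complex.normSq_eq_conj_mul_self, trigPoly, map_sum,
      Finset.sum_mul_sum]
    refine Finset.sum_congr rfl fun m _ => Finset.sum_congr rfl fun l _ => ?_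
    rw [map_mul, ← Complex.exp_conj, map_mul, Complex.conj_ofReal, Complex.conj_I]
    have : Complex.exp (((2 * Real.pi * ((l - m : ℤ) : ℝ) / s * y : ℝ) : ℂ) * Complex.I) =
        Complex.exp (((2 * Real.pi * m / s * y : ℝ) : ℂ) * -Complex.I) *
        Complex.exp (((2 * Real.pi * l / s * y : ℝ) : ℂ) * Complex.I) := by
      rw [← Complex.exp_add]; congr 1; push_cast; ring
    rw [this]; ring
  simp_rw [hpt]
  rw [intervalIntegral.integral_finsetSum fun m _ => Continuous.intervalIntegrable
    (by fun_prop) _ _]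
  push_cast
  rw [Finset.mul_sum]
  refine Finset.sum_congr rfl fun m hm => ?_
  rw [intervalIntegral.integral_finsetSum fun m _ => Continuous.intervalIntegrable
    (by fun_prop) _ _, Finset.sum_eq_single m]
  · have h := integral_exp_period hs a₀ (m - m)
    push_cast at h
    rw [intervalIntegral.integral_const_mul, h, if_pos (sub_self m),
      ← Complex.normSq_eq_conj_mul_self, Complex.normSq_eq_norm_sq]
    push_cast; ring
  · intro l _ hl
    have h := integral_exp_period hs a₀ (l - m)
    push_cast at h
    rw [intervalIntegral.integral_const_mul, h, if_neg (sub_ne_zero.2 hl), mul_zero]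
  · intro h; exact absurd hm h

section

variable {s δ K : ℝ} {β β' : ℝ → ℝ}

/-- Folding `β²` over a period gives `1`, so multiplying a periodic function by `β` preserves its
norm over one period. Distinct momenta thus stay orthogonal after the cutoff in `y`. -/
theorem IsCutoff.integral_sq_mul_trigPoly (hβ : IsCutoff s δ K β β') (hδ : 0 < δ)
    (hs : 2 * δ ≤ s) (A : Finset ℤ) (a : ℤ → ℂ) :
    ∫ y, ‖(β y : ℂ) * trigPoly s A a y‖ ^ 2 = s * ∑ m ∈ A, ‖a m‖ ^ 2 := by
  have hs0 : 0 < s := by linarith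
  have hc := continuous_trigPoly s A a
  have hb := hβ.smooth.continuous
  rw [hβ.integral_eq hδ hs (by fun_prop) (fun y h _ => by simp [h]),
    ← integral_norm_sq_trigPoly hs0 (-(s / 2) - δ) A a,
    show -(s / 2) - δ + s = s / 2 - δ by ring]
  refine intervalIntegral.integral_congr fun y hy => ?_
  rw [uIcc_of_le (by linarith)] at hy
  obtain ⟨S, C, D, hSC, e1, e2, -, -, -⟩ := hβ.period y hy
  simp only [trigPoly_add_period hs0.ne', e1, e2, norm_mul, mul_pow, Complex.norm_real,
    Real.norm_eq_abs, sq_abs]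
  rw [← add_mul, hSC, one_mul]

/-- The same folding with a derivative term: the rotation identity removes the cross term and the
derivative of the cutoff costs at most `K` times the mass. -/
theorem IsCutoff.integral_trigPoly_le (hβ : IsCutoff s δ K β β') (hδ : 0 < δ)
    (hs : 2 * δ ≤ s) (A : Finset ℤ) (v u : ℤ → ℂ) :
    ∫ y, ‖(β y : ℂ) * trigPoly s A v y + (β' y : ℂ) * trigPoly s A u y‖ ^ 2 ≤
      s * ∑ m ∈ A, (‖v m‖ ^ 2 + K * ‖u m‖ ^ 2) := by
  have hs0 : 0 < s := by linarith
  have hcv := continuous_trigPoly s A v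
  have hcu := continuous_trigPoly s A u
  have hb := hβ.smooth.continuous
  have hb' := hβ.continuous_deriv
  have hsh : Continuous fun y => y + s := by fun_prop
  rw [hβ.integral_eq hδ hs (by fun_prop) (fun y h h' => by simp [h, h']), Finset.sum_add_distrib,
    ← Finset.mul_sum, mul_add, ← integral_norm_sq_trigPoly hs0 (-(s / 2) - δ) A v, mul_left_comm,
    ← integral_norm_sq_trigPoly hs0 (-(s / 2) - δ) A u,
    show -(s / 2) - δ + s = s / 2 - δ by ring, ← intervalIntegral.integral_const_mul,
    ← intervalIntegral.integral_add (Continuous.intervalIntegrable (by fun_prop) _ _)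
      (Continuous.intervalIntegrable (by fun_prop) _ _)]
  refine intervalIntegral.integral_mono_on (by linarith)
    (Continuous.intervalIntegrable (by fun_prop) _ _)
    (Continuous.intervalIntegrable (by fun_prop) _ _) fun y hy => ?_
  obtain ⟨S, C, D, hSC, e1, e2, e3, e4, hD⟩ := hβ.period y hy
  simp only [trigPoly_add_period hs0.ne', e1, e2, e3, e4]
  rw [norm_sq_rotation hSC D]
  gcongr

end

/-! ### Lower bounds by trial spaces -/

/-- If the form, summed over the tiles `i ∈ F`, is less than `t` on a trial space of dimension
`J.card`, then the number of eigenvalues below `t` is at least `J.card / F.card`. -/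
theorem card_le_card_mul_finrank_lowSpace {H : Type*} [NormedAddCommGroup H]
    [InnerProductSpace ℂ H] [CompleteSpace H] {G : Submodule ℂ (H × H × H)} (hc : FormCompact G)
    (hG : IsClosed (G : Set (H × H × H))) {t : ℝ} {ι κ : Type*} (J : Finset ι) (F : Finset κ)
    (Ψ : κ → ι → H × H × H) (hΨ : ∀ i, ∀ j ∈ J, Ψ i j ∈ G)
    (hlt : ∀ c : ι → ℂ, (∃ j ∈ J, c j ≠ 0) → ∑ i ∈ F, energy (∑ j ∈ J, c j • Ψ i j) <
      t * ∑ i ∈ F, ‖(∑ j ∈ J, c j • Ψ i j).1‖ ^ 2) :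
    J.card ≤ F.card * Module.finrank ℂ (lowSpace G t) := by
  classical
  have hfd : FiniteDimensional ℂ (lowSpace G t) := hc.finiteDimensional_lowSpace t
  let e := Module.finBasis ℂ (lowSpace G t)
  let T : (J → ℂ) →ₗ[ℂ] (F × Fin (Module.finrank ℂ (lowSpace G t)) → ℂ) :=
    LinearMap.pi fun r => (innerSL ℂ (e r.2 : H)).toLinearMap ∘ₗ
      ∑ j : J, (LinearMap.proj (R := ℂ) (φ := fun _ : J => ℂ) j).smulRight (Ψ r.1 j).1
  have hT : ∀ c r, T c r = inner ℂ (e r.2 : H) (∑ j : J, c j • (Ψ r.1 j).1) := by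
    intro c r
    simp [T, inner_sum, inner_smul_right]
  by_contra! hcard
  -- There are more coefficients than pairs of a tile and a basis vector of `lowSpace`, so some
  -- nonzero combination has all of its tile pieces orthogonal to `lowSpace`.
  have hker : LinearMap.ker T ≠ ⊥ := by
    refine LinearMap.ker_ne_bot_of_finrank_lt ?_
    rw [Module.finrank_fintype_fun_eq_card, Module.finrank_fintype_fun_eq_card, Fintype.card_prod,
      Fintype.card_coe, Fintype.card_coe, Fintype.card_fin]
    exact hcard
  obtain ⟨c, hcT, hc0⟩ := (Submodule.ne_bot_iff _).1 hker
  obtain ⟨j₀, hj₀⟩ := Function.ne_iff.1 hc0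
  let d : ι → ℂ := fun j => if h : j ∈ J then c ⟨j, h⟩ else 0
  have hd : ∀ i, ∑ j ∈ J, d j • Ψ i j = ∑ j : J, c j • Ψ i j := by
    intro i
    rw [← Finset.sum_coe_sort J]
    refine Finset.sum_congr rfl fun j _ => ?_
    simp [d]
  refine absurd (hlt d ⟨j₀, j₀.2, by simpa [d] using hj₀⟩) (not_lt.2 ?_)
  rw [Finset.mul_sum]
  refine Finset.sum_le_sum fun i hi => ?_
  refine hc.le_energy_of_orthogonal hG
    (Submodule.sum_mem _ fun j hj => Submodule.smul_mem _ _ (hΨ i j hj)) fun v hv => ?_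
  have hz : ∀ k, inner ℂ (e k : H) (∑ j ∈ J, d j • Ψ i j).1 = 0 := by
    intro k
    have := congrFun (LinearMap.mem_ker.1 hcT) (⟨i, hi⟩, k)
    rw [hT] at this
    rw [hd, Prod.fst_sum]
    exact this
  have := e.sum_repr ⟨v, hv⟩
  have hv' : ((∑ k, e.repr ⟨v, hv⟩ k • e k : lowSpace G t) : H) = v := by rw [this]
  rw [← hv', Submodule.coe_sum, sum_inner]
  refine Finset.sum_eq_zero fun k _ => ?_
  rw [Submodule.coe_smul, inner_smul_left, hz, mul_zero]

/-! ### Finite sums of Hermite functions -/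

/-- A linear combination of the first `M` Hermite functions. -/
def hermiteSum (b : ℝ) (M : ℕ) (c : ℕ → ℂ) (x : ℝ) : ℂ :=
  ∑ k ∈ Finset.range M, c k * (hermiteFun b k x : ℂ)

/-- The derivative of `hermiteSum`. -/
def hermiteSumDeriv (b : ℝ) (M : ℕ) (c : ℕ → ℂ) (x : ℝ) : ℂ :=
  ∑ k ∈ Finset.range M, c k * (hermiteFunDeriv b k x : ℂ)

@[fun_prop]
theorem continuous_hermiteSum (b : ℝ) (M : ℕ) (c : ℕ → ℂ) : Continuous (hermiteSum b M c) :=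
  continuous_finsetSum _ fun k _ => by have := continuous_hermiteFun b k; fun_prop

@[fun_prop]
theorem continuous_hermiteSumDeriv (b : ℝ) (M : ℕ) (c : ℕ → ℂ) :
    Continuous (hermiteSumDeriv b M c) :=
  continuous_finsetSum _ fun k _ => by have := continuous_hermiteFunDeriv b k; fun_prop

theorem norm_sq_sum_mul_ofReal {ι : Type*} (s : Finset ι) (c : ι → ℂ) (a : ι → ℝ) :
    ‖∑ k ∈ s, c k * (a k : ℂ)‖ ^ 2 =
      ∑ k ∈ s, ∑ l ∈ s, (inner ℝ (c k) (c l) : ℝ) * (a k * a l) := by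
  rw [← real_inner_self_eq_norm_sq, sum_inner]
  refine Finset.sum_congr rfl fun k _ => ?_
  rw [inner_sum]
  refine Finset.sum_congr rfl fun l _ => ?_
  rw [mul_comm (c k), mul_comm (c l), ← Complex.real_smul, ← Complex.real_smul,
    real_inner_smul_left, real_inner_smul_right]
  ring

theorem integrable_norm_sq_hermiteSum {b : ℝ} (hb : 0 < b) (M : ℕ) (c : ℕ → ℂ) :
    Integrable fun x => ‖hermiteSum b M c x‖ ^ 2 := by
  simp only [hermiteSum, norm_sq_sum_mul_ofReal]
  exact integrable_finsetSum _ fun k _ => integrable_finsetSum _ fun l _ =>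
    (integrable_hermiteFun_mul hb k l).const_mul _

theorem integral_norm_sq_hermiteSum {b : ℝ} (hb : 0 < b) (M : ℕ) (c : ℕ → ℂ) :
    ∫ x, ‖hermiteSum b M c x‖ ^ 2 = ∑ k ∈ Finset.range M, ‖c k‖ ^ 2 := by
  simp only [hermiteSum, norm_sq_sum_mul_ofReal]
  rw [integral_finsetSum _ fun k _ => integrable_finsetSum _ fun l _ =>
    (integrable_hermiteFun_mul hb k l).const_mul _]
  refine Finset.sum_congr rfl fun k hk => ?_
  rw [integral_finsetSum _ fun l _ => (integrable_hermiteFun_mul hb k l).const_mul _]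
  simp_rw [integral_const_mul, integral_hermiteFun_mul hb, mul_ite, mul_one, mul_zero]
  rw [Finset.sum_ite_eq, if_pos hk, real_inner_self_eq_norm_sq]

theorem hermiteSum_energy_eq (b : ℝ) (M : ℕ) (c : ℕ → ℂ) (x : ℝ) :
    ‖hermiteSumDeriv b M c x‖ ^ 2 + (b * x) ^ 2 * ‖hermiteSum b M c x‖ ^ 2 =
      ∑ k ∈ Finset.range M, ∑ l ∈ Finset.range M, (inner ℝ (c k) (c l) : ℝ) *
        (hermiteFunDeriv b k x * hermiteFunDeriv b l x +
          (b * x) ^ 2 * (hermiteFun b k x * hermiteFun b l x)) := by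
  simp only [hermiteSum, hermiteSumDeriv, norm_sq_sum_mul_ofReal, Finset.mul_sum,
    ← Finset.sum_add_distrib]
  refine Finset.sum_congr rfl fun k _ => Finset.sum_congr rfl fun l _ => ?_
  ring

theorem integrable_hermiteSum_energy {b : ℝ} (hb : 0 < b) (M : ℕ) (c : ℕ → ℂ) :
    Integrable fun x =>
      ‖hermiteSumDeriv b M c x‖ ^ 2 + (b * x) ^ 2 * ‖hermiteSum b M c x‖ ^ 2 := by
  simp only [hermiteSum_energy_eq]
  exact integrable_finsetSum _ fun k _ => integrable_finsetSum _ fun l _ =>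
    (integrable_hermite_energy hb k l).const_mul _

theorem integral_hermiteSum_energy {b : ℝ} (hb : 0 < b) (M : ℕ) (c : ℕ → ℂ) :
    ∫ x, (‖hermiteSumDeriv b M c x‖ ^ 2 + (b * x) ^ 2 * ‖hermiteSum b M c x‖ ^ 2) =
      ∑ k ∈ Finset.range M, (2 * (k : ℝ) + 1) * b * ‖c k‖ ^ 2 := by
  simp only [hermiteSum_energy_eq]
  rw [integral_finsetSum _ fun k _ => integrable_finsetSum _ fun l _ =>
    (integrable_hermite_energy hb k l).const_mul _]
  refine Finset.sum_congr rfl fun k hk => ?_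
  rw [integral_finsetSum _ fun l _ => (integrable_hermite_energy hb k l).const_mul _]
  simp_rw [integral_const_mul, integral_hermite_energy hb, mul_ite, mul_zero]
  rw [Finset.sum_ite_eq, if_pos hk, real_inner_self_eq_norm_sq, mul_comm]

/-- Combinations of the first `M` Hermite functions concentrate uniformly on bounded intervals. -/
theorem exists_hermiteSum_concentration {b : ℝ} (hb : 0 < b) (M : ℕ) {τ : ℝ} (hτ : 0 < τ) :
    ∃ d : ℝ, 0 ≤ d ∧ ∀ c : ℕ → ℂ, (1 - τ) * ∑ k ∈ Finset.range M, ‖c k‖ ^ 2 ≤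
      ∫ x in Icc (-d) d, ‖hermiteSum b M c x‖ ^ 2 := by
  -- By Cauchy–Schwarz, `W` times the squared length of `c` dominates every combination pointwise,
  -- so one interval on which `W` leaves a tail below `τ` works for all `c`.
  set W : ℝ → ℝ := fun x => ∑ k ∈ Finset.range M, hermiteFun b k x ^ 2 with hW
  have hWi : Integrable W := integrable_finsetSum _ fun k _ => by
    simpa only [sq] using integrable_hermiteFun_mul hb k k
  have hlim := intervalIntegral_tendsto_integral hWi
    (Filter.tendsto_neg_atTop_atBot (G := ℝ)) Filter.tendsto_id
  obtain ⟨d, hd0, hd⟩ := ((Filter.eventually_ge_atTop 0).and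
    (hlim.eventually (lt_mem_nhds (sub_lt_self (∫ x, W x) hτ)))).exists
  refine ⟨d, hd0, fun c => ?_⟩
  rw [id, intervalIntegral.integral_of_le (by linarith), ← integral_Icc_eq_integral_Ioc] at hd
  have h1 := integral_add_compl (measurableSet_Icc (a := -d) (b := d)) hWi
  have h2 := integral_add_compl (measurableSet_Icc (a := -d) (b := d))
    (integrable_norm_sq_hermiteSum hb M c)
  rw [integral_norm_sq_hermiteSum hb] at h2
  have h3 : ∫ x in (Icc (-d) d)ᶜ, ‖hermiteSum b M c x‖ ^ 2 ≤
      (∑ k ∈ Finset.range M, ‖c k‖ ^ 2) * ∫ x in (Icc (-d) d)ᶜ, W x := by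
    rw [← integral_const_mul]
    refine integral_mono (integrable_norm_sq_hermiteSum hb M c).integrableOn
      (hWi.const_mul _).integrableOn fun x => ?_
    calc ‖hermiteSum b M c x‖ ^ 2 ≤ (∑ k ∈ Finset.range M, ‖c k‖ * |hermiteFun b k x|) ^ 2 := by
          gcongr
          refine (norm_sum_le _ _).trans_eq (Finset.sum_congr rfl fun k _ => ?_)
          rw [norm_mul, Complex.norm_real, Real.norm_eq_abs]
      _ ≤ _ := by
          refine (Finset.sum_mul_sq_le_sq_mul_sq _ _ _).trans_eq ?_
          simp [hW]
  have h4 : (0 : ℝ) ≤ ∑ k ∈ Finset.range M, ‖c k‖ ^ 2 := by positivity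
  nlinarith

/-! ### Trial functions on a tile -/

theorem isTestFunction_rectangle {R₁ R₂ a₁ a₂ : ℝ} (h₁ : a₁ < R₁ / 2) (h₂ : a₂ < R₂ / 2)
    {φ : ℝ × ℝ → ℂ} (hφ : ContDiff ℝ ∞ φ) (h0₁ : ∀ x y, a₁ ≤ |x| → φ (x, y) = 0)
    (h0₂ : ∀ x y, a₂ ≤ |y| → φ (x, y) = 0) : IsTestFunction (rectangle R₁ R₂) φ := by
  have hsub : tsupport φ ⊆ Icc (-a₁) a₁ ×ˢ Icc (-a₂) a₂ := by
    refine closure_minimal (fun p hp => ?_) (isClosed_Icc.prod isClosed_Icc)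
    refine ⟨abs_le.1 ?_, abs_le.1 ?_⟩ <;> by_contra! h
    · exact hp (h0₁ p.1 p.2 h.le)
    · exact hp (h0₂ p.1 p.2 h.le)
  exact ⟨hφ, (isCompact_Icc.prod isCompact_Icc).of_isClosed_subset (isClosed_tsupport φ) hsub,
    hsub.trans (prod_mono (fun x hx => ⟨by linarith [hx.1], by linarith [hx.2]⟩)
      (fun x hx => ⟨by linarith [hx.1], by linarith [hx.2]⟩))⟩

/-- The product function `e^{iΘ(x,y)} f(x) β(y)`. -/
def phaseProduct (Θ : ℝ × ℝ → ℝ) (f β : ℝ → ℝ) (p : ℝ × ℝ) : ℂ :=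
  Complex.exp ((Θ p : ℂ) * Complex.I) * ((f p.1 : ℂ) * (β p.2 : ℂ))

section

variable {Θ : ℝ × ℝ → ℝ} {f β : ℝ → ℝ}

theorem contDiff_phaseProduct (hΘ : ContDiff ℝ ∞ Θ) (hf : ContDiff ℝ ∞ f)
    (hβ : ContDiff ℝ ∞ β) : ContDiff ℝ ∞ (phaseProduct Θ f β) := by
  have h : ∀ g : ℝ × ℝ → ℝ, ContDiff ℝ ∞ g → ContDiff ℝ ∞ fun p => (g p : ℂ) := fun g hg =>
    Complex.ofRealCLM.contDiff.comp hg
  exact ContDiff.mul (ContDiff.cexp (ContDiff.mul (h _ hΘ) contDiff_const))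
    ((h _ (hf.comp contDiff_fst)).mul (h _ (hβ.comp contDiff_snd)))

theorem momentumX_phaseProduct (hΘ : ContDiff ℝ ∞ Θ) (hf : ContDiff ℝ ∞ f) (hβ : ContDiff ℝ ∞ β)
    {x y f' Θ' : ℝ} (hf' : HasDerivAt f f' x) (hΘ' : HasDerivAt (fun s => Θ (s, y)) Θ' x) (b : ℝ) :
    momentumX b (phaseProduct Θ f β) (x, y) = Complex.exp ((Θ (x, y) : ℂ) * Complex.I) *
      ((1 / Complex.I) * ((f' : ℂ) * (β y : ℂ)) +
        ((Θ' - b * y / 2 : ℝ) : ℂ) * ((f x : ℂ) * (β y : ℂ))) := by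
  have hd := ((contDiff_phaseProduct hΘ hf hβ).differentiable (by simp)) (x, y)
  have h1 : HasDerivAt (fun s => phaseProduct Θ f β (s, y))
      (fderiv ℝ (phaseProduct Θ f β) (x, y) (1, 0)) x :=
    HasFDerivAt.comp_hasDerivAt (f := fun s : ℝ => (s, y)) x hd.hasFDerivAt
      ((hasDerivAt_id x).prodMk (hasDerivAt_const x y))
  have h2 : HasDerivAt (fun s => phaseProduct Θ f β (s, y)) _ x :=
    (hΘ'.ofReal_comp.mul_const Complex.I).cexp.fun_mul (hf'.ofReal_comp.mul_const (β y : ℂ))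
  simp only [momentumX, h1.unique h2, phaseProduct]
  rw [one_div, Complex.inv_I]
  push_cast
  linear_combination (-Complex.exp ((Θ (x, y) : ℂ) * Complex.I) * Θ' * f x * β y) * Complex.I_sq

theorem momentumY_phaseProduct (hΘ : ContDiff ℝ ∞ Θ) (hf : ContDiff ℝ ∞ f) (hβ : ContDiff ℝ ∞ β)
    {x y β' Θ' : ℝ} (hβ' : HasDerivAt β β' y) (hΘ' : HasDerivAt (fun s => Θ (x, s)) Θ' y) (b : ℝ) :
    momentumY b (phaseProduct Θ f β) (x, y) = Complex.exp ((Θ (x, y) : ℂ) * Complex.I) *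
      ((1 / Complex.I) * ((f x : ℂ) * (β' : ℂ)) +
        ((Θ' + b * x / 2 : ℝ) : ℂ) * ((f x : ℂ) * (β y : ℂ))) := by
  have hd := ((contDiff_phaseProduct hΘ hf hβ).differentiable (by simp)) (x, y)
  have h1 : HasDerivAt (fun s => phaseProduct Θ f β (x, s))
      (fderiv ℝ (phaseProduct Θ f β) (x, y) (0, 1)) y :=
    HasFDerivAt.comp_hasDerivAt (f := fun s : ℝ => (x, s)) y hd.hasFDerivAt
      ((hasDerivAt_const y x).prodMk (hasDerivAt_id y))
  have h2 : HasDerivAt (fun s => phaseProduct Θ f β (x, s)) _ y :=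
    (hΘ'.ofReal_comp.mul_const Complex.I).cexp.fun_mul (hβ'.ofReal_comp.const_mul (f x : ℂ))
  simp only [momentumY, h1.unique h2, phaseProduct]
  rw [one_div, Complex.inv_I]
  push_cast
  linear_combination (-Complex.exp ((Θ (x, y) : ℂ) * Complex.I) * Θ' * f x * β y) * Complex.I_sq

end

/-- The phase `e^{i(bx/2+η)y}`. -/
def gaugePhase (b η : ℝ) (p : ℝ × ℝ) : ℂ :=
  Complex.exp ((((b * p.1 / 2 + η) * p.2 : ℝ) : ℂ) * Complex.I)

theorem norm_gaugePhase (b η : ℝ) (p : ℝ × ℝ) : ‖gaugePhase b η p‖ = 1 :=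
  Complex.norm_exp_ofReal_mul_I _

/-- A product function in the Landau gauge. -/
def gaugeProduct (b η : ℝ) (f β : ℝ → ℝ) (p : ℝ × ℝ) : ℂ :=
  gaugePhase b η p * ((f p.1 : ℂ) * (β p.2 : ℂ))

theorem gaugeProduct_eq (b η : ℝ) (f β : ℝ → ℝ) :
    gaugeProduct b η f β = phaseProduct (fun p => (b * p.1 / 2 + η) * p.2) f β := rfl

theorem contDiff_gaugeProduct (b η : ℝ) {f β : ℝ → ℝ} (hf : ContDiff ℝ ∞ f)
    (hβ : ContDiff ℝ ∞ β) : ContDiff ℝ ∞ (gaugeProduct b η f β) :=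
  contDiff_phaseProduct (by fun_prop) hf hβ

section

variable {b η : ℝ} {f f' β β' : ℝ → ℝ}

theorem momentumX_gaugeProduct (hf : ContDiff ℝ ∞ f) (hβ : ContDiff ℝ ∞ β)
    (hf' : ∀ x, HasDerivAt f (f' x) x) (p : ℝ × ℝ) :
    momentumX b (gaugeProduct b η f β) p =
      gaugePhase b η p * ((1 / Complex.I) * ((f' p.1 : ℂ) * (β p.2 : ℂ))) := by
  have h : HasDerivAt (fun s : ℝ => (b * s / 2 + η) * p.2) (b * p.2 / 2) p.1 := by
    refine (((((hasDerivAt_id p.1).const_mul b).div_const 2).add_const η).mul_const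
      p.2).congr_deriv ?_
    ring
  rw [gaugeProduct_eq, momentumX_phaseProduct (by fun_prop) hf hβ (hf' p.1) h]
  simp [gaugePhase]

theorem momentumY_gaugeProduct (hf : ContDiff ℝ ∞ f) (hβ : ContDiff ℝ ∞ β)
    (hβ' : ∀ y, HasDerivAt β (β' y) y) (p : ℝ × ℝ) :
    momentumY b (gaugeProduct b η f β) p = gaugePhase b η p *
      ((f p.1 : ℂ) * (((b * p.1 + η : ℝ) : ℂ) * (β p.2 : ℂ) - Complex.I * (β' p.2 : ℂ))) := by
  have h : HasDerivAt (fun s : ℝ => (b * p.1 / 2 + η) * s) (b * p.1 / 2 + η) p.2 := by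
    refine ((hasDerivAt_id p.2).const_mul (b * p.1 / 2 + η)).congr_deriv ?_
    ring
  rw [gaugeProduct_eq, momentumY_phaseProduct (by fun_prop) hf hβ (hβ' p.2) h, gaugePhase,
    one_div, Complex.inv_I]
  push_cast
  ring

end

theorem norm_sq_eq_iterated_integral {R₁ R₂ : ℝ} {u : L2 (rectangle R₁ R₂)} {w : ℝ × ℝ → ℂ}
    (hw : Continuous w) (hw0 : ∀ p ∉ rectangle R₁ R₂, w p = 0)
    (h : u =ᵐ[volume.restrict (rectangle R₁ R₂)] w) :
    ‖u‖ ^ 2 = ∫ x, ∫ y, ‖w (x, y)‖ ^ 2 := by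
  rw [norm_sq_eq_integral h, setIntegral_eq_integral_of_forall_compl_eq_zero
    (fun p hp => by rw [hw0 p hp]; simp)]
  refine integral_prod (fun p => ‖w p‖ ^ 2)
    (Continuous.integrable_of_hasCompactSupport (by fun_prop) ?_)
  exact (hasCompactSupport_of_eq_zero_off_rectangle hw0).norm.comp_left
    (g := fun r : ℝ => r ^ 2) (by simp)

theorem coeFn_sum_smul {Ω : Set (ℝ × ℝ)} {ι : Type*} (J : Finset ι) (c : ι → ℂ) {u : ι → L2 Ω}
    {f : ι → ℝ × ℝ → ℂ} (h : ∀ j ∈ J, u j =ᵐ[volume.restrict Ω] f j) :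
    ((∑ j ∈ J, c j • u j : L2 Ω) : ℝ × ℝ → ℂ) =ᵐ[volume.restrict Ω]
      fun p => ∑ j ∈ J, c j * f j p := by
  classical
  induction J using Finset.induction_on with
  | empty =>
    simp only [Finset.sum_empty]
    exact Lp.coeFn_zero _ _ _
  | insert i J hi ih =>
    rw [Finset.sum_insert hi]
    filter_upwards [Lp.coeFn_add (c i • u i) (∑ j ∈ J, c j • u j), Lp.coeFn_smul (c i) (u i),
      ih fun j hj => h j (Finset.mem_insert_of_mem hj), h i (Finset.mem_insert_self i J)]
      with p h1 h2 h3 h4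
    rw [h1, Pi.add_apply, h2, Pi.smul_apply, h3, h4, Finset.sum_insert hi, smul_eq_mul]

theorem norm_sq_sum_smul_eq {R₁ R₂ : ℝ} {ι : Type*} (J : Finset ι) (c : ι → ℂ)
    {u : ι → L2 (rectangle R₁ R₂)} {f : ι → ℝ × ℝ → ℂ} (hf : ∀ j, Continuous (f j))
    (hf0 : ∀ j, ∀ p ∉ rectangle R₁ R₂, f j p = 0)
    (h : ∀ j, u j =ᵐ[volume.restrict (rectangle R₁ R₂)] f j) :
    ‖∑ j ∈ J, c j • u j‖ ^ 2 = ∫ x, ∫ y, ‖∑ j ∈ J, c j * f j (x, y)‖ ^ 2 :=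
  norm_sq_eq_iterated_integral (w := fun p => ∑ j ∈ J, c j * f j p)
    (continuous_finsetSum _ fun j _ => continuous_const.mul (hf j))
    (fun p hp => Finset.sum_eq_zero fun j _ => by rw [hf0 j p hp, mul_zero])
    (coeFn_sum_smul _ c fun j _ => h j)

/-! ### Trial functions: Landau states cut off to a tile -/

/-- The Landau state of level `j.2` and momentum `2πj.1/s₂`, translated by `σ` in the first
variable and cut off by `α` and `β`. -/
def tileFun (b s₂ σ : ℝ) (α β : ℝ → ℝ) (j : ℤ × ℕ) : ℝ × ℝ → ℂ :=
  gaugeProduct b (b * σ + 2 * Real.pi * j.1 / s₂)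
    (fun x => α x * hermiteFun b j.2 (x + σ + 2 * Real.pi * j.1 / s₂ / b)) β

/-- The component of momentum `2πm/s₂` of a combination of Landau states. -/
def tileMode (b s₂ : ℝ) (M : ℕ) (c : ℤ × ℕ → ℂ) (m : ℤ) (x : ℝ) : ℂ :=
  hermiteSum b M (fun k => c (m, k)) (x + 2 * Real.pi * m / s₂ / b)

/-- The derivative of `tileMode`. -/
def tileModeDeriv (b s₂ : ℝ) (M : ℕ) (c : ℤ × ℕ → ℂ) (m : ℤ) (x : ℝ) : ℂ :=
  hermiteSumDeriv b M (fun k => c (m, k)) (x + 2 * Real.pi * m / s₂ / b)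

@[fun_prop]
theorem continuous_tileMode (b s₂ : ℝ) (M : ℕ) (c : ℤ × ℕ → ℂ) (m : ℤ) :
    Continuous (tileMode b s₂ M c m) := by
  unfold tileMode; fun_prop

@[fun_prop]
theorem continuous_tileModeDeriv (b s₂ : ℝ) (M : ℕ) (c : ℤ × ℕ → ℂ) (m : ℤ) :
    Continuous (tileModeDeriv b s₂ M c m) := by
  unfold tileModeDeriv; fun_prop

theorem integral_norm_sq_tileMode {b : ℝ} (hb : 0 < b) (s₂ : ℝ) (M : ℕ) (c : ℤ × ℕ → ℂ) (m : ℤ) :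
    ∫ x, ‖tileMode b s₂ M c m x‖ ^ 2 = ∑ k ∈ Finset.range M, ‖c (m, k)‖ ^ 2 := by
  rw [← integral_norm_sq_hermiteSum hb]
  exact integral_add_right_eq_self (fun x => ‖hermiteSum b M (fun k => c (m, k)) x‖ ^ 2) _

theorem integrable_norm_sq_tileMode {b : ℝ} (hb : 0 < b) (s₂ : ℝ) (M : ℕ) (c : ℤ × ℕ → ℂ)
    (m : ℤ) : Integrable fun x => ‖tileMode b s₂ M c m x‖ ^ 2 :=
  (integrable_norm_sq_hermiteSum hb M _).comp_add_right _

theorem tileMode_energy_eq {b : ℝ} (hb : 0 < b) (s₂ : ℝ) (m : ℤ) (x : ℝ) :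
    b * x + 2 * Real.pi * m / s₂ = b * (x + 2 * Real.pi * m / s₂ / b) := by
  field_simp

theorem integrable_tileMode_energy {b : ℝ} (hb : 0 < b) (s₂ : ℝ) (M : ℕ) (c : ℤ × ℕ → ℂ) (m : ℤ) :
    Integrable fun x => ‖tileModeDeriv b s₂ M c m x‖ ^ 2 +
      (b * x + 2 * Real.pi * m / s₂) ^ 2 * ‖tileMode b s₂ M c m x‖ ^ 2 := by
  simp only [tileMode_energy_eq hb]
  exact (integrable_hermiteSum_energy hb M fun k => c (m, k)).comp_add_right _

theorem integral_tileMode_energy {b : ℝ} (hb : 0 < b) (s₂ : ℝ) (M : ℕ) (c : ℤ × ℕ → ℂ) (m : ℤ) :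
    ∫ x, (‖tileModeDeriv b s₂ M c m x‖ ^ 2 +
      (b * x + 2 * Real.pi * m / s₂) ^ 2 * ‖tileMode b s₂ M c m x‖ ^ 2) =
      ∑ k ∈ Finset.range M, (2 * (k : ℝ) + 1) * b * ‖c (m, k)‖ ^ 2 := by
  rw [← integral_hermiteSum_energy hb]
  simp only [tileMode_energy_eq hb]
  exact integral_add_right_eq_self (fun x => ‖hermiteSumDeriv b M (fun k => c (m, k)) x‖ ^ 2 +
    (b * x) ^ 2 * ‖hermiteSum b M (fun k => c (m, k)) x‖ ^ 2) _

theorem gaugePhase_add (b η κ : ℝ) (p : ℝ × ℝ) :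
    gaugePhase b (η + κ) p = gaugePhase b η p * Complex.exp (((κ * p.2 : ℝ) : ℂ) * Complex.I) := by
  rw [gaugePhase, gaugePhase, ← Complex.exp_add]
  congr 1
  push_cast; ring

section Tile

variable {b s₁ s₂ δ₁ δ₂ K₁ K₂ R₁ R₂ σ : ℝ} {α α' β β' : ℝ → ℝ}

theorem contDiff_tile_factor (hα : IsCutoff s₁ δ₁ K₁ α α') (b σ κ : ℝ) (k : ℕ) :
    ContDiff ℝ ∞ fun x => α x * hermiteFun b k (x + σ + κ / b) :=
  hα.smooth.mul ((contDiff_hermiteFun b k).comp (by fun_prop))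

theorem hasDerivAt_tile_factor (hα : IsCutoff s₁ δ₁ K₁ α α') (b σ κ : ℝ) (k : ℕ) (x : ℝ) :
    HasDerivAt (fun x => α x * hermiteFun b k (x + σ + κ / b))
      (α' x * hermiteFun b k (x + σ + κ / b) + α x * hermiteFunDeriv b k (x + σ + κ / b)) x := by
  have h : HasDerivAt (fun x => hermiteFun b k (x + σ + κ / b))
      (hermiteFunDeriv b k (x + σ + κ / b)) x := by
    simp only [add_assoc]
    exact (hasDerivAt_hermiteFun b k _).comp_add_const x _
  exact (hα.hasDeriv x).fun_mul h

theorem isTestFunction_tileFun (hα : IsCutoff s₁ δ₁ K₁ α α') (hβ : IsCutoff s₂ δ₂ K₂ β β')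
    (h₁ : s₁ / 2 + δ₁ < R₁ / 2) (h₂ : s₂ / 2 + δ₂ < R₂ / 2) (b σ : ℝ) (j : ℤ × ℕ) :
    IsTestFunction (rectangle R₁ R₂) (tileFun b s₂ σ α β j) := by
  refine isTestFunction_rectangle h₁ h₂
    (contDiff_gaugeProduct _ _ (contDiff_tile_factor hα b σ _ j.2) hβ.smooth) (fun x y hx => ?_)
    (fun x y hy => ?_)
  · simp [tileFun, gaugeProduct, (hα.zero x hx).1]
  · simp [tileFun, gaugeProduct, (hβ.zero y hy).1]

/-- At fixed `x`, apart from a gauge phase common to all modes, a combination of tile functions is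
`β` times a trigonometric polynomial in `y`; this is the form to which the folding identities apply.
-/
theorem sum_tileFun (A : Finset ℤ) (M : ℕ) (c : ℤ × ℕ → ℂ) (x y : ℝ) :
    ∑ j ∈ A ×ˢ Finset.range M, c j * tileFun b s₂ σ α β j (x, y) =
      gaugePhase b (b * σ) (x, y) * ((β y : ℂ) *
        trigPoly s₂ A (fun m => (α x : ℂ) * tileMode b s₂ M c m (x + σ)) y) := by
  rw [Finset.sum_product]
  simp only [trigPoly, tileMode, hermiteSum, Finset.mul_sum, Finset.sum_mul, tileFun, gaugeProduct,
    gaugePhase_add]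
  refine Finset.sum_congr rfl fun m _ => Finset.sum_congr rfl fun k _ => ?_
  push_cast
  ring

theorem sum_momentumX_tileFun (hα : IsCutoff s₁ δ₁ K₁ α α') (hβ : IsCutoff s₂ δ₂ K₂ β β')
    (A : Finset ℤ) (M : ℕ) (c : ℤ × ℕ → ℂ) (x y : ℝ) :
    ∑ j ∈ A ×ˢ Finset.range M, c j * momentumX b (tileFun b s₂ σ α β j) (x, y) =
      gaugePhase b (b * σ) (x, y) * ((1 / Complex.I) * ((β y : ℂ) *
        trigPoly s₂ A (fun m => (α x : ℂ) * tileModeDeriv b s₂ M c m (x + σ) +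
          (α' x : ℂ) * tileMode b s₂ M c m (x + σ)) y)) := by
  rw [Finset.sum_product]
  simp only [tileFun, momentumX_gaugeProduct (contDiff_tile_factor hα b σ _ _) hβ.smooth
    (hasDerivAt_tile_factor hα b σ _ _)]
  simp only [trigPoly, tileMode, tileModeDeriv, hermiteSum, hermiteSumDeriv, Finset.mul_sum,
    Finset.sum_mul, ← Finset.sum_add_distrib, gaugePhase_add]
  refine Finset.sum_congr rfl fun m _ => Finset.sum_congr rfl fun k _ => ?_
  push_cast
  ring

theorem sum_momentumY_tileFun (hα : IsCutoff s₁ δ₁ K₁ α α') (hβ : IsCutoff s₂ δ₂ K₂ β β')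
    (A : Finset ℤ) (M : ℕ) (c : ℤ × ℕ → ℂ) (x y : ℝ) :
    ∑ j ∈ A ×ˢ Finset.range M, c j * momentumY b (tileFun b s₂ σ α β j) (x, y) =
      gaugePhase b (b * σ) (x, y) * ((β y : ℂ) * trigPoly s₂ A (fun m =>
          ((b * (x + σ) + 2 * Real.pi * m / s₂ : ℝ) : ℂ) *
            ((α x : ℂ) * tileMode b s₂ M c m (x + σ))) y +
        (β' y : ℂ) * trigPoly s₂ A (fun m =>
          -Complex.I * ((α x : ℂ) * tileMode b s₂ M c m (x + σ))) y) := by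
  rw [Finset.sum_product]
  simp only [tileFun, momentumY_gaugeProduct (contDiff_tile_factor hα b σ _ _) hβ.smooth
    hβ.hasDeriv]
  simp only [trigPoly, tileMode, hermiteSum, Finset.mul_sum,
    Finset.sum_mul, ← Finset.sum_add_distrib, gaugePhase_add]
  refine Finset.sum_congr rfl fun m _ => Finset.sum_congr rfl fun k _ => ?_
  push_cast
  ring

/-- The tile functions as elements of the form graph. -/
theorem exists_tileGraph (hα : IsCutoff s₁ δ₁ K₁ α α') (hβ : IsCutoff s₂ δ₂ K₂ β β')
    (h₁ : s₁ / 2 + δ₁ < R₁ / 2) (h₂ : s₂ / 2 + δ₂ < R₂ / 2) (b σ : ℝ) (j : ℤ × ℕ) :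
    ∃ w ∈ formGraph b (rectangle R₁ R₂),
      w.1 =ᵐ[volume.restrict (rectangle R₁ R₂)] tileFun b s₂ σ α β j ∧
      w.2.1 =ᵐ[volume.restrict (rectangle R₁ R₂)] momentumX b (tileFun b s₂ σ α β j) ∧
      w.2.2 =ᵐ[volume.restrict (rectangle R₁ R₂)] momentumY b (tileFun b s₂ σ α β j) := by
  have hφ := isTestFunction_tileFun hα hβ h₁ h₂ b σ j
  have h0 : MemLp (tileFun b s₂ σ α β j) 2 (volume.restrict (rectangle R₁ R₂)) :=
    memLp_rectangle_of_continuous hφ.smooth.continuous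
  have hx : MemLp (momentumX b (tileFun b s₂ σ α β j)) 2 (volume.restrict (rectangle R₁ R₂)) :=
    memLp_rectangle_of_continuous (hφ.continuous_momentumX b)
  have hy : MemLp (momentumY b (tileFun b s₂ σ α β j)) 2 (volume.restrict (rectangle R₁ R₂)) :=
    memLp_rectangle_of_continuous (hφ.continuous_momentumY b)
  exact ⟨(h0.toLp, hx.toLp, hy.toLp), (testGraph b _).le_topologicalClosure
    ⟨_, hφ, h0.coeFn_toLp, hx.coeFn_toLp, hy.coeFn_toLp⟩,
    h0.coeFn_toLp, hx.coeFn_toLp, hy.coeFn_toLp⟩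

theorem norm_sq_tile (hα : IsCutoff s₁ δ₁ K₁ α α') (hβ : IsCutoff s₂ δ₂ K₂ β β')
    (h₁ : s₁ / 2 + δ₁ < R₁ / 2) (h₂ : s₂ / 2 + δ₂ < R₂ / 2) (hδ₂ : 0 < δ₂) (hs₂ : 2 * δ₂ ≤ s₂)
    (A : Finset ℤ) (M : ℕ) (c : ℤ × ℕ → ℂ) {u : ℤ × ℕ → L2 (rectangle R₁ R₂)}
    (hu : ∀ j, u j =ᵐ[volume.restrict (rectangle R₁ R₂)] tileFun b s₂ σ α β j) :
    ‖∑ j ∈ A ×ˢ Finset.range M, c j • u j‖ ^ 2 =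
      ∫ x, s₂ * ∑ m ∈ A, ‖(α x : ℂ) * tileMode b s₂ M c m (x + σ)‖ ^ 2 := by
  have hφ := isTestFunction_tileFun hα hβ h₁ h₂ b σ
  rw [norm_sq_sum_smul_eq _ c (fun j => (hφ j).smooth.continuous) (fun j p => (hφ j).eq_zero) hu]
  congr 1; funext x
  rw [← hβ.integral_sq_mul_trigPoly hδ₂ hs₂]
  simp only [sum_tileFun, norm_mul, norm_gaugePhase, one_mul]

theorem norm_sq_tileX (hα : IsCutoff s₁ δ₁ K₁ α α') (hβ : IsCutoff s₂ δ₂ K₂ β β')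
    (h₁ : s₁ / 2 + δ₁ < R₁ / 2) (h₂ : s₂ / 2 + δ₂ < R₂ / 2) (hδ₂ : 0 < δ₂) (hs₂ : 2 * δ₂ ≤ s₂)
    (A : Finset ℤ) (M : ℕ) (c : ℤ × ℕ → ℂ) {u : ℤ × ℕ → L2 (rectangle R₁ R₂)}
    (hu : ∀ j, u j =ᵐ[volume.restrict (rectangle R₁ R₂)] momentumX b (tileFun b s₂ σ α β j)) :
    ‖∑ j ∈ A ×ˢ Finset.range M, c j • u j‖ ^ 2 =
      ∫ x, s₂ * ∑ m ∈ A, ‖(α x : ℂ) * tileModeDeriv b s₂ M c m (x + σ) +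
        (α' x : ℂ) * tileMode b s₂ M c m (x + σ)‖ ^ 2 := by
  have hφ := isTestFunction_tileFun hα hβ h₁ h₂ b σ
  rw [norm_sq_sum_smul_eq _ c (fun j => (hφ j).continuous_momentumX b)
    (fun j p => (hφ j).momentumX_eq_zero b) hu]
  congr 1; funext x
  rw [← hβ.integral_sq_mul_trigPoly hδ₂ hs₂]
  simp only [sum_momentumX_tileFun hα hβ, norm_mul, norm_gaugePhase, one_mul, norm_div, norm_one,
    Complex.norm_I, div_one]

theorem integrable_tile (hα : IsCutoff s₁ δ₁ K₁ α α') {g : ℝ → ℝ} (hg : Continuous g)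
    (h0 : ∀ x, α x = 0 → α' x = 0 → g x = 0) : Integrable g := by
  refine hg.integrable_of_hasCompactSupport (HasCompactSupport.intro
    (isCompact_Icc (a := -(s₁ / 2 + δ₁)) (b := s₁ / 2 + δ₁)) fun x hx => ?_)
  have := hα.zero x (by
    by_contra! h
    exact hx ⟨(abs_lt.1 h).1.le, (abs_lt.1 h).2.le⟩)
  exact h0 x this.1 this.2

/-- Unlike the other two components, this one differentiates `β`, and the bound on that derivative
makes it an inequality with the extra `K₂`. -/
theorem norm_sq_tileY_le (hα : IsCutoff s₁ δ₁ K₁ α α') (hβ : IsCutoff s₂ δ₂ K₂ β β')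
    (h₁ : s₁ / 2 + δ₁ < R₁ / 2) (h₂ : s₂ / 2 + δ₂ < R₂ / 2) (hδ₂ : 0 < δ₂) (hs₂ : 2 * δ₂ ≤ s₂)
    (A : Finset ℤ) (M : ℕ) (c : ℤ × ℕ → ℂ) {u : ℤ × ℕ → L2 (rectangle R₁ R₂)}
    (hu : ∀ j, u j =ᵐ[volume.restrict (rectangle R₁ R₂)] momentumY b (tileFun b s₂ σ α β j)) :
    ‖∑ j ∈ A ×ˢ Finset.range M, c j • u j‖ ^ 2 ≤
      ∫ x, s₂ * ∑ m ∈ A, α x ^ 2 * (((b * (x + σ) + 2 * Real.pi * m / s₂) ^ 2 + K₂) *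
        ‖tileMode b s₂ M c m (x + σ)‖ ^ 2) := by
  have hφ := isTestFunction_tileFun hα hβ h₁ h₂ b σ
  have hαc := hα.smooth.continuous
  rw [norm_sq_sum_smul_eq _ c (fun j => (hφ j).continuous_momentumY b)
    (fun j p => (hφ j).momentumY_eq_zero b) hu]
  refine integral_mono_of_nonneg
    (Filter.Eventually.of_forall fun x => integral_nonneg fun y => by positivity)
    (integrable_tile hα (by fun_prop) fun x h _ => by simp [h])
    (Filter.Eventually.of_forall fun x => ?_)
  simp only [sum_momentumY_tileFun hα hβ, norm_mul, norm_gaugePhase, one_mul]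
  refine (hβ.integral_trigPoly_le hδ₂ hs₂ A _ _).trans_eq ?_
  congr 1
  refine Finset.sum_congr rfl fun m _ => ?_
  simp only [norm_mul, norm_neg, Complex.norm_I, Complex.norm_real, Real.norm_eq_abs, mul_pow,
    sq_abs]
  ring

end Tile

/-! ### Summation over the tiles -/

theorem sum_integral_tiles (s : ℝ) (F : Finset ℤ) {P : ℤ → ℝ → ℝ} (hP : ∀ i, Integrable (P i)) :
    ∑ i ∈ F, ∫ x, P i x = ∫ x, ∑ i ∈ F, P i (x - i * s) := by
  rw [integral_finsetSum _ fun i _ => (hP i).comp_sub_right _]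
  exact Finset.sum_congr rfl fun i _ => (integral_sub_right_eq_self (P i) _).symm

section Tiles

variable {b s₁ s₂ δ₁ δ₂ K₁ K₂ R₁ R₂ : ℝ} {α α' β β' : ℝ → ℝ}

/-- Every mode of `A` is centred at distance at least `d` inside the region where the squared
cutoffs sum to one, and a fraction `1 - τ` of its mass lies within `d` of the centre. -/
theorem sum_tiles_norm_sq_ge (hb : 0 < b) (hα : IsCutoff s₁ δ₁ K₁ α α') (hδ₁ : 0 < δ₁)
    (hs₁ : 2 * δ₁ ≤ s₁) (hs₂ : 0 ≤ s₂) (A : Finset ℤ) (M : ℕ) {τ d : ℝ}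
    (hd : ∀ c : ℕ → ℂ, (1 - τ) * ∑ k ∈ Finset.range M, ‖c k‖ ^ 2 ≤
      ∫ x in Icc (-d) d, ‖hermiteSum b M c x‖ ^ 2)
    {p q : ℤ} (hA : ∀ m ∈ A, (p + 1) * s₁ + d ≤ -(2 * Real.pi * m / s₂ / b) ∧
      -(2 * Real.pi * m / s₂ / b) + d ≤ (q - 1) * s₁) (c : ℤ × ℕ → ℂ) :
    s₂ * ((1 - τ) * ∑ j ∈ A ×ˢ Finset.range M, ‖c j‖ ^ 2) ≤ ∑ i ∈ Finset.Icc p q,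
      ∫ x, s₂ * ∑ m ∈ A, ‖(α x : ℂ) * tileMode b s₂ M c m (x + i * s₁)‖ ^ 2 := by
  have hαc := hα.smooth.continuous
  rw [sum_integral_tiles s₁ _ fun i => integrable_tile hα (by fun_prop) fun x h _ => by simp [h]]
  simp only [sub_add_cancel, norm_mul, Complex.norm_real, Real.norm_eq_abs, mul_pow, sq_abs]
  have hsum : ∀ x, ∑ i ∈ Finset.Icc p q, s₂ * ∑ m ∈ A, α (x - i * s₁) ^ 2 *
      ‖tileMode b s₂ M c m x‖ ^ 2 = s₂ * ∑ m ∈ A,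
        (∑ i ∈ Finset.Icc p q, α (x - i * s₁) ^ 2) * ‖tileMode b s₂ M c m x‖ ^ 2 := by
    intro x
    rw [← Finset.mul_sum, Finset.sum_comm]
    simp only [Finset.sum_mul]
  have hinteg : ∀ m, Integrable fun x => (∑ i ∈ Finset.Icc p q, α (x - i * s₁) ^ 2) *
      ‖tileMode b s₂ M c m x‖ ^ 2 := by
    intro m
    refine (integrable_norm_sq_tileMode hb s₂ M c m).mono' (by fun_prop)
      (Filter.Eventually.of_forall fun x => ?_)
    rw [Real.norm_of_nonneg (by positivity)]
    exact mul_le_of_le_one_left (by positivity) (hα.sum_sq_le_one hδ₁ hs₁ _ x)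
  simp_rw [hsum]
  rw [integral_const_mul, integral_finsetSum _ fun m _ => hinteg m, Finset.sum_product,
    Finset.mul_sum]
  refine mul_le_mul_of_nonneg_left (Finset.sum_le_sum fun m hm => ?_) hs₂
  set κ := 2 * Real.pi * m / s₂ / b with hκ
  have hset : ∫ x in Icc (-d) d, ‖hermiteSum b M (fun k => c (m, k)) x‖ ^ 2 =
      ∫ x in Icc (-κ - d) (-κ + d), ‖tileMode b s₂ M c m x‖ ^ 2 := by
    rw [← integral_indicator measurableSet_Icc, ← integral_indicator measurableSet_Icc,
      ← integral_add_right_eq_self _ κ]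
    congr 1; funext x
    have : x + κ ∈ Icc (-d) d ↔ x ∈ Icc (-κ - d) (-κ + d) := by
      simp only [mem_Icc]
      constructor <;> rintro ⟨h1, h2⟩ <;> constructor <;> linarith
    by_cases hx : x ∈ Icc (-κ - d) (-κ + d)
    · rw [indicator_of_mem hx, indicator_of_mem (this.2 hx)]
      rfl
    · rw [indicator_of_notMem hx, indicator_of_notMem (fun h => hx (this.1 h))]
  refine (hd fun k => c (m, k)).trans ?_
  rw [hset]
  calc ∫ x in Icc (-κ - d) (-κ + d), ‖tileMode b s₂ M c m x‖ ^ 2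
      = ∫ x in Icc (-κ - d) (-κ + d), (∑ i ∈ Finset.Icc p q, α (x - i * s₁) ^ 2) *
          ‖tileMode b s₂ M c m x‖ ^ 2 := by
        refine setIntegral_congr_fun measurableSet_Icc fun x hx => ?_
        have := hA m hm
        rw [hα.sum_sq_eq_one hδ₁ hs₁ ⟨by linarith [hx.1], by linarith [hx.2]⟩, one_mul]
    _ ≤ _ := setIntegral_le_integral (hinteg m) (Filter.Eventually.of_forall fun x => by positivity)

/-- IMS localization: summed over tiles the cut energy is at most the full oscillator energy plus
`K₁ + K₂` times the mass. Hermite functions diagonalize the oscillator energy, which leaves the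
Landau levels. -/
theorem sum_tiles_energy_le (hb : 0 < b) (hα : IsCutoff s₁ δ₁ K₁ α α') (hδ₁ : 0 < δ₁)
    (hs₁ : 2 * δ₁ ≤ s₁) (hs₂ : 0 ≤ s₂) (hK₂ : 0 ≤ K₂) (A F : Finset ℤ) (M : ℕ) (c : ℤ × ℕ → ℂ) :
    (∑ i ∈ F, ∫ x, s₂ * ∑ m ∈ A, ‖(α x : ℂ) * tileModeDeriv b s₂ M c m (x + i * s₁) +
        (α' x : ℂ) * tileMode b s₂ M c m (x + i * s₁)‖ ^ 2) +
      (∑ i ∈ F, ∫ x, s₂ * ∑ m ∈ A, α x ^ 2 *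
        (((b * (x + i * s₁) + 2 * Real.pi * m / s₂) ^ 2 + K₂) *
          ‖tileMode b s₂ M c m (x + i * s₁)‖ ^ 2)) ≤
      s₂ * ∑ j ∈ A ×ˢ Finset.range M, ((2 * (j.2 : ℝ) + 1) * b + K₁ + K₂) * ‖c j‖ ^ 2 := by
  have hαc := hα.smooth.continuous
  have hαc' := hα.continuous_deriv
  have hi₁ : ∀ i : ℤ, Integrable fun x => s₂ * ∑ m ∈ A,
      ‖(α x : ℂ) * tileModeDeriv b s₂ M c m (x + i * s₁) +
        (α' x : ℂ) * tileMode b s₂ M c m (x + i * s₁)‖ ^ 2 := fun i =>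
    integrable_tile hα (by fun_prop) fun x h h' => by simp [h, h']
  have hi₂ : ∀ i : ℤ, Integrable fun x => s₂ * ∑ m ∈ A, α x ^ 2 *
      (((b * (x + i * s₁) + 2 * Real.pi * m / s₂) ^ 2 + K₂) *
        ‖tileMode b s₂ M c m (x + i * s₁)‖ ^ 2) := fun i =>
    integrable_tile hα (by fun_prop) fun x h _ => by simp [h]
  rw [sum_integral_tiles s₁ F hi₁, sum_integral_tiles s₁ F hi₂, ← integral_add
    (integrable_finsetSum _ fun i _ => (hi₁ i).comp_sub_right _)
    (integrable_finsetSum _ fun i _ => (hi₂ i).comp_sub_right _)]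
  have hB : ∀ m, Integrable fun x => (‖tileModeDeriv b s₂ M c m x‖ ^ 2 +
      (b * x + 2 * Real.pi * m / s₂) ^ 2 * ‖tileMode b s₂ M c m x‖ ^ 2) +
      (K₁ + K₂) * ‖tileMode b s₂ M c m x‖ ^ 2 := fun m =>
    (integrable_tileMode_energy hb s₂ M c m).add
      ((integrable_norm_sq_tileMode hb s₂ M c m).const_mul _)
  calc _ ≤ ∫ x, s₂ * ∑ m ∈ A, ((‖tileModeDeriv b s₂ M c m x‖ ^ 2 +
      (b * x + 2 * Real.pi * m / s₂) ^ 2 * ‖tileMode b s₂ M c m x‖ ^ 2) +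
      (K₁ + K₂) * ‖tileMode b s₂ M c m x‖ ^ 2) := by
        refine integral_mono_of_nonneg (Filter.Eventually.of_forall fun x => ?_)
          ((integrable_finsetSum _ fun m _ => hB m).const_mul s₂)
          (Filter.Eventually.of_forall fun x => ?_)
        · simp only [Pi.zero_apply]; positivity
        simp only [sub_add_cancel]
        rw [← Finset.mul_sum, ← Finset.mul_sum, ← mul_add, Finset.sum_comm, Finset.sum_comm
          (s := F), ← Finset.sum_add_distrib]
        refine mul_le_mul_of_nonneg_left (Finset.sum_le_sum fun m _ => ?_) hs₂
        rw [← Finset.sum_mul]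
        have h1 := hα.sum_le hδ₁ hs₁ F x (tileMode b s₂ M c m x) (tileModeDeriv b s₂ M c m x)
        have h2 := mul_le_mul_of_nonneg_right (hα.sum_sq_le_one hδ₁ hs₁ F x)
          (by positivity : 0 ≤ ((b * x + 2 * Real.pi * m / s₂) ^ 2 + K₂) *
            ‖tileMode b s₂ M c m x‖ ^ 2)
        linarith
    _ = _ := by
        rw [integral_const_mul, integral_finsetSum _ fun m _ => hB m, Finset.sum_product]
        congr 1
        refine Finset.sum_congr rfl fun m _ => ?_
        rw [integral_add (integrable_tileMode_energy hb s₂ M c m)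
          ((integrable_norm_sq_tileMode hb s₂ M c m).const_mul _), integral_const_mul,
          integral_tileMode_energy hb, integral_norm_sq_tileMode hb, Finset.mul_sum,
          ← Finset.sum_add_distrib]
        refine Finset.sum_congr rfl fun k _ => ?_
        ring

/-- The integers from `-⌊n s₁ B⌋` to `0` have centres `-m/B` in `[0, n s₁]`. `D` further tiles on
each side make room for the distance `d`, and one more on each side for the margin in
`IsCutoff.sum_sq_eq_one`. -/
theorem exists_centred_modes {B : ℝ} (hB : 0 < B) (hs₁ : 0 < s₁) (n D : ℕ) {d : ℝ}
    (hD : d ≤ D * s₁) : ∃ A : Finset ℤ, (n : ℝ) * (s₁ * B) ≤ A.card ∧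
      ∀ m ∈ A, ((-(D : ℤ) - 1 : ℤ) + 1) * s₁ + d ≤ -(m / B) ∧
        -(m / B) + d ≤ (((n : ℤ) + D + 1 : ℤ) - 1) * s₁ := by
  refine ⟨Finset.Icc (-(⌊n * s₁ * B⌋₊ : ℤ)) 0, ?_, fun m hm => ?_⟩
  · rw [Int.card_Icc]
    have h := (Nat.lt_floor_add_one ((n : ℝ) * s₁ * B)).le
    rw [show (0 + 1 - -(⌊n * s₁ * B⌋₊ : ℤ)).toNat = ⌊n * s₁ * B⌋₊ + 1 by omega]
    push_cast
    linarith
  · obtain ⟨h1, h2⟩ := Finset.mem_Icc.1 hm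
    have h1' : -(m : ℝ) ≤ n * s₁ * B := by
      refine le_trans ?_ (Nat.floor_le (by positivity))
      have : -m ≤ (⌊n * s₁ * B⌋₊ : ℤ) := by linarith
      exact_mod_cast this
    have h2' : (m : ℝ) ≤ 0 := by exact_mod_cast h2
    have h3 : -(m / B) ≤ n * s₁ := by rw [← neg_div, div_le_iff₀ hB]; exact h1'
    have h4 : 0 ≤ -(m / B) := by
      rw [← neg_div]; exact div_nonneg (by linarith) hB.le
    push_cast
    constructor <;> nlinarith

/-- Lower bound for the number of eigenvalues below `t` by cut off Landau states. -/
theorem landau_le_finrank_lowSpace (hb : 0 < b) (hR₁ : 0 < R₁) (hR₂ : 0 < R₂)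
    (hα : IsCutoff s₁ δ₁ K₁ α α') (hβ : IsCutoff s₂ δ₂ K₂ β β') (hδ₁ : 0 < δ₁) (hδ₂ : 0 < δ₂)
    (hs₁ : 2 * δ₁ ≤ s₁) (hs₂ : 2 * δ₂ ≤ s₂) (h₁ : s₁ / 2 + δ₁ < R₁ / 2)
    (h₂ : s₂ / 2 + δ₂ < R₂ / 2) (hK₂ : 0 ≤ K₂) {t : ℝ} (ht : 0 < t) {M : ℕ}
    (hM : (2 * (M : ℝ) - 1) * b + K₁ + K₂ < t) :
    b * (s₁ * s₂) / (2 * Real.pi) * M ≤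
      Module.finrank ℂ (lowSpace (formGraph b (rectangle R₁ R₂)) t) := by
  have hs₁' : 0 < s₁ := by linarith
  have hs₂' : 0 < s₂ := by linarith
  have hπ := Real.pi_pos
  -- `ρ` is the highest Landau level used plus the localization errors. The tail `τ` is chosen so
  -- that `t (1 - τ)` is the midpoint of `ρ` and `t`, still strictly above `ρ`.
  set ρ := (2 * (M : ℝ) - 1) * b + K₁ + K₂ with hρ
  obtain ⟨d, hd0, hd⟩ := exists_hermiteSum_concentration hb M
    (τ := (t - ρ) / (2 * t)) (div_pos (by linarith) (by linarith))
  have hτ : t * (1 - (t - ρ) / (2 * t)) = (t + ρ) / 2 := by field_simp; ring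
  obtain ⟨D, hD⟩ := exists_nat_ge (d / s₁)
  rw [div_le_iff₀ hs₁'] at hD
  -- The strip uses `n + 2 D + 3` tiles; the `2 D + 3` additional ones do not depend on `n`.
  refine le_of_forall_nat_mul_le (d := (2 * D + 3) *
    (Module.finrank ℂ (lowSpace (formGraph b (rectangle R₁ R₂)) t) : ℝ)) fun n => ?_
  set B := s₂ * b / (2 * Real.pi) with hB
  have hB0 : 0 < B := by positivity
  obtain ⟨A, hAcard, hA⟩ := exists_centred_modes hB0 hs₁' n D hD
  have hmB : ∀ m : ℤ, 2 * Real.pi * m / s₂ / b = m / B := fun m => by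
    rw [hB]; field_simp
  simp only [← hmB] at hA
  choose Ψ hΨ hΨ0 hΨX hΨY using fun (i : ℤ) (j : ℤ × ℕ) =>
    exists_tileGraph hα hβ h₁ h₂ b (i * s₁) j
  have hcard := card_le_card_mul_finrank_lowSpace (t := t) (formCompact_rectangle hb hR₁ hR₂)
    (Submodule.isClosed_topologicalClosure _) (A ×ˢ Finset.range M)
    (Finset.Icc (-(D : ℤ) - 1) ((n : ℤ) + D + 1)) Ψ (fun i j _ => hΨ i j) (fun c hc => ?_)
  · rw [Finset.card_product, Finset.card_range, Int.card_Icc,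
      show ((n : ℤ) + D + 1 + 1 - (-(D : ℤ) - 1)).toNat = n + 2 * D + 3 by omega] at hcard
    have hcard' : (A.card : ℝ) * M ≤ (n + 2 * D + 3) *
      (Module.finrank ℂ (lowSpace (formGraph b (rectangle R₁ R₂)) t) : ℝ) := by exact_mod_cast hcard
    calc (n : ℝ) * (b * (s₁ * s₂) / (2 * Real.pi) * M) = (n * (s₁ * B)) * M := by rw [hB]; ring
      _ ≤ A.card * M := by gcongr
      _ ≤ _ := hcard'.trans_eq (by ring)
  · obtain ⟨j₀, hj₀, hcj₀⟩ := hc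
    have hpos : 0 < ∑ j ∈ A ×ˢ Finset.range M, ‖c j‖ ^ 2 :=
      Finset.sum_pos' (fun j _ => by positivity) ⟨j₀, hj₀, by positivity⟩
    have hnorm := sum_tiles_norm_sq_ge hb hα hδ₁ hs₁ hs₂'.le A M hd hA c
    have hen := sum_tiles_energy_le hb hα hδ₁ hs₁ hs₂'.le hK₂ A
      (Finset.Icc (-(D : ℤ) - 1) ((n : ℤ) + D + 1)) M c
    have hlev : ∑ j ∈ A ×ˢ Finset.range M, ((2 * (j.2 : ℝ) + 1) * b + K₁ + K₂) * ‖c j‖ ^ 2 ≤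
        ρ * ∑ j ∈ A ×ˢ Finset.range M, ‖c j‖ ^ 2 := by
      rw [Finset.mul_sum]
      refine Finset.sum_le_sum fun j hj => mul_le_mul_of_nonneg_right ?_ (by positivity)
      have : j.2 + 1 ≤ M := Finset.mem_range.1 (Finset.mem_product.1 hj).2
      have : (j.2 : ℝ) + 1 ≤ M := by exact_mod_cast this
      rw [hρ]
      nlinarith
    have e0 : ∀ i : ℤ, ‖(∑ j ∈ A ×ˢ Finset.range M, c j • Ψ i j).1‖ ^ 2 =
        ∫ x, s₂ * ∑ m ∈ A, ‖(α x : ℂ) * tileMode b s₂ M c m (x + i * s₁)‖ ^ 2 := by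
      intro i
      rw [← norm_sq_tile hα hβ h₁ h₂ hδ₂ hs₂ A M c (hΨ0 i), Prod.fst_sum]
      rfl
    have e1 : ∀ i : ℤ, energy (∑ j ∈ A ×ˢ Finset.range M, c j • Ψ i j) ≤
        (∫ x, s₂ * ∑ m ∈ A, ‖(α x : ℂ) * tileModeDeriv b s₂ M c m (x + i * s₁) +
          (α' x : ℂ) * tileMode b s₂ M c m (x + i * s₁)‖ ^ 2) +
        ∫ x, s₂ * ∑ m ∈ A, α x ^ 2 *
          (((b * (x + i * s₁) + 2 * Real.pi * m / s₂) ^ 2 + K₂) *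
            ‖tileMode b s₂ M c m (x + i * s₁)‖ ^ 2) := by
      intro i
      rw [← norm_sq_tileX hα hβ h₁ h₂ hδ₂ hs₂ A M c (hΨX i)]
      refine le_trans (le_of_eq ?_) (add_le_add le_rfl
        (norm_sq_tileY_le hα hβ h₁ h₂ hδ₂ hs₂ A M c (hΨY i)))
      rw [energy, Prod.snd_sum, Prod.fst_sum, Prod.snd_sum]
      rfl
    have e2 := Finset.sum_le_sum fun i (_ : i ∈ Finset.Icc (-(D : ℤ) - 1) ((n : ℤ) + D + 1)) => e1 i
    rw [Finset.sum_add_distrib] at e2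
    simp only [e0]
    calc _ ≤ s₂ * (ρ * ∑ j ∈ A ×ˢ Finset.range M, ‖c j‖ ^ 2) :=
          e2.trans (hen.trans (mul_le_mul_of_nonneg_left hlev hs₂'.le))
      _ < s₂ * ((t + ρ) / 2 * ∑ j ∈ A ×ˢ Finset.range M, ‖c j‖ ^ 2) := by
          gcongr; linarith
      _ = t * (s₂ * ((1 - (t - ρ) / (2 * t)) * ∑ j ∈ A ×ˢ Finset.range M, ‖c j‖ ^ 2)) := by
          rw [← hτ]; ring
      _ ≤ _ := mul_le_mul_of_nonneg_left hnorm ht.le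

end Tiles

/-- The lower bound by Landau states for a cutoff width proportional to `ε`. -/
theorem exists_landau_lower_bound : ∃ C₀ : ℝ, 0 < C₀ ∧
    ∀ b R₁ R₂ t : ℝ, 0 < b → 0 < t → 0 < R₁ → 0 < R₂ → ∀ ε : ℝ, 0 < ε → ε ≤ 1 →
      (1 - ε) ^ 2 * (b * (R₁ * R₂) / (2 * Real.pi)) *
          (landauCount b (t - C₀ / (ε * min R₁ R₂) ^ 2) : ℝ) ≤
        Module.finrank ℂ (lowSpace (formGraph b (rectangle R₁ R₂)) t) := by
  obtain ⟨K, hK, hcut⟩ := exists_isCutoff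
  -- Each of the two cutoffs has width `ε' R / 4` with `ε ≤ 2 ε'`, and so costs at most `64 K / (ε
  -- min)²`.
  refine ⟨128 * K, by positivity, fun b R₁ R₂ t hb ht hR₁ hR₂ ε hε hε1 => ?_⟩
  have hπ := Real.pi_pos
  set N := Module.finrank ℂ (lowSpace (formGraph b (rectangle R₁ R₂)) t)
  set M := landauCount b (t - 128 * K / (ε * min R₁ R₂) ^ 2) with hMdef
  -- Only for positive `M` is `(2 M - 1) b` an actual level below the threshold; otherwise the claim
  -- is trivial.
  rcases Nat.eq_zero_or_pos M with hM0 | hM0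
  · rw [hM0]; simp
  have hmin : 0 < min R₁ R₂ := lt_min hR₁ hR₂
  -- Capping at `1/2` keeps the tile length `(1 - ε') R` at least twice the cutoff width. The factor
  -- `(1 - ε)²` only improves when `ε` is lowered.
  set ε' := min ε (1 / 2) with hε'
  have hε'0 : 0 < ε' := lt_min hε (by norm_num)
  have hε'1 : ε' ≤ 1 / 2 := min_le_right _ _
  have hε'2 : ε ≤ 2 * ε' := by
    rw [hε']
    rcases min_choice ε (1 / 2) with h | h <;> rw [h] <;> linarith
  have hM : (2 * (M : ℝ) - 1) * b < t - 128 * K / (ε * min R₁ R₂) ^ 2 := by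
    have h := hMdef
    rw [landauCount_eq_ceil hb] at h
    have h' : M - 1 < ⌈((t - 128 * K / (ε * min R₁ R₂) ^ 2) / b - 1) / 2⌉₊ := by omega
    rw [Nat.lt_ceil, Nat.cast_sub hM0, lt_div_iff₀ (by norm_num), lt_sub_iff_add_lt,
      lt_div_iff₀ hb] at h'
    push_cast at h'
    linarith
  obtain ⟨α, α', hα⟩ := hcut ((1 - ε') * R₁) (ε' * R₁ / 4) (by positivity) (by nlinarith)
  obtain ⟨β, β', hβ⟩ := hcut ((1 - ε') * R₂) (ε' * R₂ / 4) (by positivity) (by nlinarith)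
  have hKle : ∀ R, min R₁ R₂ ≤ R → K / (ε' * R / 4) ^ 2 ≤ 64 * K / (ε * min R₁ R₂) ^ 2 := by
    intro R hR
    rw [show 64 * K / (ε * min R₁ R₂) ^ 2 = K / (ε * min R₁ R₂ / 8) ^ 2 by
      rw [div_pow]; field_simp; norm_num]
    refine div_le_div_of_nonneg_left hK.le (by positivity) (pow_le_pow_left₀ (by positivity) ?_ 2)
    calc ε * min R₁ R₂ / 8 ≤ (2 * ε') * R / 8 := by gcongr
      _ = _ := by ring
  have h := landau_le_finrank_lowSpace hb hR₁ hR₂ hα hβ (by positivity) (by positivity)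
    (by nlinarith) (by nlinarith) (by nlinarith) (by nlinarith) (by positivity) ht (M := M) (by
      have h1 := hKle R₁ (min_le_left _ _)
      have h2 := hKle R₂ (min_le_right _ _)
      have h3 : 128 * K / (ε * min R₁ R₂) ^ 2 = 64 * K / (ε * min R₁ R₂) ^ 2 +
        64 * K / (ε * min R₁ R₂) ^ 2 := by ring
      linarith)
  calc _ ≤ (1 - ε') ^ 2 * (b * (R₁ * R₂) / (2 * Real.pi)) * M := by
        gcongr
        exact min_le_left _ _
    _ = b * ((1 - ε') * R₁ * ((1 - ε') * R₂)) / (2 * Real.pi) * M := by ring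
    _ ≤ N := h

/-! ### Piecewise smooth elements of the form domain -/

theorem volume_rectangle_lt_top (R₁ R₂ : ℝ) : volume (rectangle R₁ R₂) < ⊤ := by
  rw [rectangle, Measure.volume_eq_prod, Measure.prod_prod, Real.volume_Ioo, Real.volume_Ioo]
  exact ENNReal.mul_lt_top ENNReal.ofReal_lt_top ENNReal.ofReal_lt_top

theorem exists_L2_limit {R₁ R₂ C : ℝ} {f : ℕ → ℝ × ℝ → ℂ} {g : ℝ × ℝ → ℂ}
    (hf : ∀ k, Continuous (f k))
    (hlim : ∀ p, Filter.Tendsto (fun k => f k p) Filter.atTop (nhds (g p)))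
    (hC : ∀ k, ∀ p ∈ rectangle R₁ R₂, ‖f k p‖ ≤ C) {u : ℕ → L2 (rectangle R₁ R₂)}
    (hu : ∀ k, u k =ᵐ[volume.restrict (rectangle R₁ R₂)] f k) :
    ∃ v : L2 (rectangle R₁ R₂), v =ᵐ[volume.restrict (rectangle R₁ R₂)] g ∧
      Filter.Tendsto u Filter.atTop (nhds v) := by
  have hΩ : MeasurableSet (rectangle R₁ R₂) := (isOpen_rectangle R₁ R₂).measurableSet
  have : IsFiniteMeasure (volume.restrict (rectangle R₁ R₂) : Measure (ℝ × ℝ)) :=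
    ⟨by simpa using volume_rectangle_lt_top R₁ R₂⟩
  have hgm : Measurable g :=
    measurable_of_tendsto_metrizable (fun k => (hf k).measurable) (tendsto_pi_nhds.2 hlim)
  have hgC : ∀ p ∈ rectangle R₁ R₂, ‖g p‖ ≤ C := fun p hp =>
    le_of_tendsto (hlim p).norm (Filter.Eventually.of_forall fun k => hC k p hp)
  have hg : MemLp g 2 (volume.restrict (rectangle R₁ R₂)) :=
    MemLp.of_bound hgm.aestronglyMeasurable C (ae_restrict_of_forall_mem hΩ hgC)
  refine ⟨hg.toLp, hg.coeFn_toLp, ?_⟩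
  have hn : ∀ k, ‖u k - hg.toLp‖ ^ 2 = ∫ p in rectangle R₁ R₂, ‖f k p - g p‖ ^ 2 := fun k =>
    norm_sq_eq_integral (f := fun p => f k p - g p) (by
      filter_upwards [Lp.coeFn_sub (u k) hg.toLp, hu k, hg.coeFn_toLp] with p h1 h2 h3
      rw [h1, Pi.sub_apply, h2, h3])
  have hsq : Filter.Tendsto (fun k => ‖u k - hg.toLp‖ ^ 2) Filter.atTop (nhds 0) := by
    simp_rw [hn]
    have h := tendsto_integral_of_dominated_convergence (μ := volume.restrict (rectangle R₁ R₂))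
      (F := fun k p => ‖f k p - g p‖ ^ 2) (f := fun _ => 0) (fun _ => (2 * C) ^ 2)
      (fun k => (((hf k).measurable.sub hgm).norm.pow_const 2).aestronglyMeasurable)
      (integrable_const _)
      (fun k => ae_restrict_of_forall_mem hΩ fun p hp => by
        rw [Real.norm_of_nonneg (by positivity)]
        refine pow_le_pow_left₀ (norm_nonneg _) ((norm_sub_le _ _).trans ?_) 2
        linarith [hC k p hp, hgC p hp])
      (Filter.Eventually.of_forall fun p => by
        simpa using ((hlim p).sub_const (g p)).norm.pow 2)
    simpa using h
  rw [tendsto_iff_norm_sub_tendsto_zero]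
  have h := hsq.sqrt
  simpa only [Real.sqrt_sq (norm_nonneg _), Real.sqrt_zero] using h

/-- `S` is a limit of test functions on `]-R/2, R/2[`, boundedly and pointwise together with the
first derivatives, which tend to `dS`. -/
def IsDirichletProfile (R : ℝ) (S dS : ℝ → ℝ) : Prop :=
  ∃ (u u' : ℕ → ℝ → ℝ) (C : ℝ), (∀ k, ContDiff ℝ ∞ (u k)) ∧
    (∀ k x, HasDerivAt (u k) (u' k x) x) ∧
    (∀ k, ∃ ρ < R / 2, ∀ x, ρ ≤ |x| → u k x = 0) ∧
    (∀ k x, |u k x| ≤ C ∧ |u' k x| ≤ C) ∧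
    ∀ x, Filter.Tendsto (fun k => u k x) Filter.atTop (nhds (S x)) ∧
      Filter.Tendsto (fun k => u' k x) Filter.atTop (nhds (dS x))

/-- The phase which centres the vector potential at `(x₀, y₀)`. -/
def centrePhase (b x₀ y₀ : ℝ) (p : ℝ × ℝ) : ℝ := b * (y₀ * p.1 - x₀ * p.2) / 2

/-- The form graph is closed, so bounded pointwise limits of test functions and of their magnetic
derivatives belong to it. This admits sine functions extended by zero, which are not smooth at the
cell boundary. -/
theorem IsDirichletProfile.exists_mem_formGraph {R₁ R₂ : ℝ} {S S' T T' : ℝ → ℝ}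
    (hS : IsDirichletProfile R₁ S S') (hT : IsDirichletProfile R₂ T T') (b x₀ y₀ : ℝ) :
    ∃ w ∈ formGraph b (rectangle R₁ R₂),
      (w.1 =ᵐ[volume.restrict (rectangle R₁ R₂)] fun p =>
        Complex.exp ((centrePhase b x₀ y₀ p : ℂ) * Complex.I) * ((S p.1 : ℂ) * (T p.2 : ℂ))) ∧
      (w.2.1 =ᵐ[volume.restrict (rectangle R₁ R₂)] fun p =>
        Complex.exp ((centrePhase b x₀ y₀ p : ℂ) * Complex.I) *
          ((1 / Complex.I) * ((S' p.1 : ℂ) * (T p.2 : ℂ)) +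
            ((b * y₀ / 2 - b * p.2 / 2 : ℝ) : ℂ) * ((S p.1 : ℂ) * (T p.2 : ℂ)))) ∧
      (w.2.2 =ᵐ[volume.restrict (rectangle R₁ R₂)] fun p =>
        Complex.exp ((centrePhase b x₀ y₀ p : ℂ) * Complex.I) *
          ((1 / Complex.I) * ((S p.1 : ℂ) * (T' p.2 : ℂ)) +
            ((-(b * x₀ / 2) + b * p.1 / 2 : ℝ) : ℂ) * ((S p.1 : ℂ) * (T p.2 : ℂ)))) := by
  obtain ⟨u, u', C, hu, hud, hu0, huC, hulim⟩ := hS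
  obtain ⟨v, v', C', hv, hvd, hv0, hvC, hvlim⟩ := hT
  set Θ := centrePhase b x₀ y₀ with hΘdef
  have hΘ : ContDiff ℝ ∞ Θ := by
    rw [hΘdef]; unfold centrePhase; fun_prop
  have hΘx : ∀ x y, HasDerivAt (fun s => Θ (s, y)) (b * y₀ / 2) x := fun x y => by
    refine (((((hasDerivAt_id x).const_mul y₀).sub_const (x₀ * y)).const_mul b).div_const
      2).congr_deriv ?_
    ring
  have hΘy : ∀ x y, HasDerivAt (fun s => Θ (x, s)) (-(b * x₀ / 2)) y := fun x y => by
    refine (((((hasDerivAt_id y).const_mul x₀).const_sub (y₀ * x)).const_mul b).div_const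
      2).congr_deriv ?_
    ring
  have hφ : ∀ k, IsTestFunction (rectangle R₁ R₂) (phaseProduct Θ (u k) (v k)) := by
    intro k
    obtain ⟨ρ₁, hρ₁, h₁⟩ := hu0 k
    obtain ⟨ρ₂, hρ₂, h₂⟩ := hv0 k
    refine isTestFunction_rectangle hρ₁ hρ₂ (contDiff_phaseProduct hΘ (hu k) (hv k))
      (fun x y hx => ?_) (fun x y hy => ?_)
    · simp [phaseProduct, h₁ x hx]
    · simp [phaseProduct, h₂ y hy]
  have h0 : ∀ k, MemLp (phaseProduct Θ (u k) (v k)) 2 (volume.restrict (rectangle R₁ R₂)) :=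
    fun k => memLp_rectangle_of_continuous (hφ k).smooth.continuous
  have hX : ∀ k, MemLp (momentumX b (phaseProduct Θ (u k) (v k))) 2
      (volume.restrict (rectangle R₁ R₂)) :=
    fun k => memLp_rectangle_of_continuous ((hφ k).continuous_momentumX b)
  have hY : ∀ k, MemLp (momentumY b (phaseProduct Θ (u k) (v k))) 2
      (volume.restrict (rectangle R₁ R₂)) :=
    fun k => memLp_rectangle_of_continuous ((hφ k).continuous_momentumY b)
  have hXeq : ∀ k p, momentumX b (phaseProduct Θ (u k) (v k)) p =
      Complex.exp ((Θ p : ℂ) * Complex.I) * ((1 / Complex.I) * ((u' k p.1 : ℂ) * (v k p.2 : ℂ)) +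
        ((b * y₀ / 2 - b * p.2 / 2 : ℝ) : ℂ) * ((u k p.1 : ℂ) * (v k p.2 : ℂ))) := fun k p =>
    momentumX_phaseProduct hΘ (hu k) (hv k) (hud k p.1) (hΘx p.1 p.2) b
  have hYeq : ∀ k p, momentumY b (phaseProduct Θ (u k) (v k)) p =
      Complex.exp ((Θ p : ℂ) * Complex.I) * ((1 / Complex.I) * ((u k p.1 : ℂ) * (v' k p.2 : ℂ)) +
        ((-(b * x₀ / 2) + b * p.1 / 2 : ℝ) : ℂ) * ((u k p.1 : ℂ) * (v k p.2 : ℂ))) := fun k p =>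
    momentumY_phaseProduct hΘ (hu k) (hv k) (hvd k p.2) (hΘy p.1 p.2) b
  have hC0 : 0 ≤ C := (abs_nonneg _).trans (huC 0 0).1
  have hprod : ∀ a c : ℝ, |a| ≤ C → |c| ≤ C' → ‖(a : ℂ) * (c : ℂ)‖ ≤ C * C' := by
    intro a c ha hc
    rw [norm_mul, Complex.norm_real, Complex.norm_real, Real.norm_eq_abs, Real.norm_eq_abs]
    exact mul_le_mul ha hc (abs_nonneg _) hC0
  have hlim : ∀ {a c : ℕ → ℝ} {A D : ℝ}, Filter.Tendsto a Filter.atTop (nhds A) →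
      Filter.Tendsto c Filter.atTop (nhds D) →
      Filter.Tendsto (fun k => (a k : ℂ) * (c k : ℂ)) Filter.atTop (nhds ((A : ℂ) * (D : ℂ))) :=
    fun ha hc => ((Complex.continuous_ofReal.tendsto _).comp ha).mul
      ((Complex.continuous_ofReal.tendsto _).comp hc)
  have hbd : ∀ (θ r B : ℝ) (z w : ℂ), |r| ≤ B → ‖z‖ ≤ C * C' → ‖w‖ ≤ C * C' →
      ‖Complex.exp ((θ : ℂ) * Complex.I) * ((1 / Complex.I) * z + (r : ℂ) * w)‖ ≤
        (1 + B) * (C * C') := by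
    intro θ r B z w hr hz hw
    rw [norm_mul, Complex.norm_exp_ofReal_mul_I, one_mul]
    refine (norm_add_le _ _).trans ?_
    rw [norm_mul, norm_mul, norm_div, norm_one, Complex.norm_I, div_one, one_mul,
      Complex.norm_real, Real.norm_eq_abs, add_mul, one_mul]
    exact add_le_add hz (mul_le_mul hr hw (norm_nonneg _) ((abs_nonneg _).trans hr))
  obtain ⟨w₀, hw₀, hl₀⟩ := exists_L2_limit (fun k => (hφ k).smooth.continuous)
    (fun p => (hlim (hulim p.1).1 (hvlim p.2).1).const_mul (Complex.exp ((Θ p : ℂ) * Complex.I)))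
    (C := C * C') (fun k p _ => by
      rw [phaseProduct, norm_mul, Complex.norm_exp_ofReal_mul_I, one_mul]
      exact hprod _ _ (huC k p.1).1 (hvC k p.2).1) (fun k => (h0 k).coeFn_toLp)
  obtain ⟨w₁, hw₁, hl₁⟩ := exists_L2_limit (fun k => (hφ k).continuous_momentumX b)
    (fun p => by
      simp only [hXeq]
      exact (((hlim (hulim p.1).2 (hvlim p.2).1).const_mul (1 / Complex.I)).add
        ((hlim (hulim p.1).1 (hvlim p.2).1).const_mul _)).const_mul
        (Complex.exp ((Θ p : ℂ) * Complex.I)))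
    (C := (1 + (|b * y₀ / 2| + |b| * |R₂|)) * (C * C')) (fun k p hp => by
      rw [hXeq]
      refine hbd _ _ _ _ _ ((abs_sub _ _).trans ?_) (hprod _ _ (huC k p.1).2 (hvC k p.2).1)
        (hprod _ _ (huC k p.1).1 (hvC k p.2).1)
      have h1 : |p.2| ≤ R₂ / 2 := abs_le.2 ⟨hp.2.1.le, hp.2.2.le⟩
      rw [mul_div_assoc b p.2, abs_mul b (p.2 / 2)]
      refine add_le_add le_rfl (mul_le_mul_of_nonneg_left ?_ (abs_nonneg b))
      rw [abs_div, abs_two]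
      linarith [le_abs_self R₂, abs_nonneg p.2])
    (fun k => (hX k).coeFn_toLp)
  obtain ⟨w₂, hw₂, hl₂⟩ := exists_L2_limit (fun k => (hφ k).continuous_momentumY b)
    (fun p => by
      simp only [hYeq]
      exact (((hlim (hulim p.1).1 (hvlim p.2).2).const_mul (1 / Complex.I)).add
        ((hlim (hulim p.1).1 (hvlim p.2).1).const_mul _)).const_mul
        (Complex.exp ((Θ p : ℂ) * Complex.I)))
    (C := (1 + (|b * x₀ / 2| + |b| * |R₁|)) * (C * C')) (fun k p hp => by
      rw [hYeq]
      refine hbd _ _ _ _ _ ((abs_add_le _ _).trans ?_) (hprod _ _ (huC k p.1).1 (hvC k p.2).2)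
        (hprod _ _ (huC k p.1).1 (hvC k p.2).1)
      have h1 : |p.1| ≤ R₁ / 2 := abs_le.2 ⟨hp.1.1.le, hp.1.2.le⟩
      rw [abs_neg, mul_div_assoc b p.1, abs_mul b (p.1 / 2)]
      refine add_le_add le_rfl (mul_le_mul_of_nonneg_left ?_ (abs_nonneg b))
      rw [abs_div, abs_two]
      linarith [le_abs_self R₁, abs_nonneg p.1])
    (fun k => (hY k).coeFn_toLp)
  refine ⟨(w₀, w₁, w₂), ?_, hw₀, hw₁, hw₂⟩
  refine mem_closure_of_tendsto (hl₀.prodMk_nhds (hl₁.prodMk_nhds hl₂))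
    (Filter.Eventually.of_forall fun k => ?_)
  exact ⟨_, hφ k, (h0 k).coeFn_toLp, (hX k).coeFn_toLp, (hY k).coeFn_toLp⟩

/-! ### Dirichlet sine functions of an interval -/

/-- The sine function with `m + 1` half waves on `]a, a + r[`, extended by zero. -/
def cellSin (a r : ℝ) (m : ℕ) (x : ℝ) : ℝ :=
  (Ioo a (a + r)).indicator (fun x => Real.sin (((m : ℝ) + 1) * Real.pi / r * (x - a))) x

/-- The derivative of `cellSin`. -/
def cellCos (a r : ℝ) (m : ℕ) (x : ℝ) : ℝ :=
  (Ioo a (a + r)).indicator (fun x => ((m : ℝ) + 1) * Real.pi / r *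
    Real.cos (((m : ℝ) + 1) * Real.pi / r * (x - a))) x

/-- The sine is cut off in a layer of width of order `1/(k+1)` at each endpoint. There the
derivative of the cutoff is of order `k + 1` while the sine, vanishing at the endpoint, is of order
`1/(k+1)`; so the derivatives of the approximants stay bounded. -/
theorem isDirichletProfile_cellSin {R a r : ℝ} (hr : 0 < r) (ha : -(R / 2) ≤ a)
    (har : a + r ≤ R / 2) (m : ℕ) : IsDirichletProfile R (cellSin a r m) (cellCos a r m) := by
  obtain ⟨K, hK, hKb⟩ := exists_bound_deriv_smoothTransition
  set ν := ((m : ℝ) + 1) * Real.pi / r with hν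
  have hν0 : 0 < ν := by positivity
  set σ := Real.smoothTransition
  set σ' := deriv Real.smoothTransition
  have hσ : ∀ x, HasDerivAt σ (σ' x) x := fun x => (differentiable_smoothTransition x).hasDerivAt
  have hσ1 : ∀ x, |σ x| ≤ 1 := fun x =>
    abs_le.2 ⟨by linarith [Real.smoothTransition.nonneg x], Real.smoothTransition.le_one x⟩
  let l : ℕ → ℝ → ℝ := fun k x => ((k : ℝ) + 1) * (x - a) - 1
  let h : ℕ → ℝ → ℝ := fun k x => ((k : ℝ) + 1) * (a + r - x) - 1
  have hsin₁ : ∀ x, |Real.sin (ν * (x - a))| ≤ ν * |x - a| := fun x => by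
    refine (Real.abs_sin_le_abs).trans_eq ?_
    rw [abs_mul, abs_of_pos hν0]
  have hsin₂ : ∀ x, |Real.sin (ν * (x - a))| ≤ ν * |a + r - x| := fun x => by
    have : Real.sin (ν * (x - a)) = -((-1) ^ (m + 1) * Real.sin (ν * (a + r - x))) := by
      rw [show ν * (x - a) = ((m + 1 : ℕ) : ℝ) * Real.pi - ν * (a + r - x) by
        rw [hν]; push_cast; field_simp; ring, Real.sin_nat_mul_pi_sub]
    rw [this, abs_neg, abs_mul, abs_pow, abs_neg, abs_one, one_pow, one_mul]
    refine (Real.abs_sin_le_abs).trans_eq ?_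
    rw [abs_mul, abs_of_pos hν0]
  refine ⟨fun k x => σ (l k x) * σ (h k x) * Real.sin (ν * (x - a)),
    fun k x => (((k : ℝ) + 1) * σ' (l k x) * σ (h k x) - ((k : ℝ) + 1) * σ (l k x) * σ' (h k x)) *
      Real.sin (ν * (x - a)) + σ (l k x) * σ (h k x) * (ν * Real.cos (ν * (x - a))),
    1 + ν * (1 + 4 * K), fun k => ?_, fun k x => ?_, fun k => ?_, fun k x => ?_, fun x => ?_⟩
  · have hσc : ContDiff ℝ ∞ σ := Real.smoothTransition.contDiff (n := ⊤)
    exact ((hσc.comp (by fun_prop)).mul (hσc.comp (by fun_prop))).mul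
      (Real.contDiff_sin.comp (by fun_prop))
  · have h1 : HasDerivAt (l k) ((k : ℝ) + 1) x := by
      refine ((((hasDerivAt_id x).sub_const a).const_mul ((k : ℝ) + 1)).sub_const 1).congr_deriv ?_
      ring
    have h2 : HasDerivAt (h k) (-((k : ℝ) + 1)) x := by
      refine ((((hasDerivAt_id x).const_sub (a + r)).const_mul ((k : ℝ) + 1)).sub_const
        1).congr_deriv ?_
      ring
    have h3 : HasDerivAt (fun x => ν * (x - a)) ν x := by
      refine (((hasDerivAt_id x).sub_const a).const_mul ν).congr_deriv ?_
      ring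
    have h4 : HasDerivAt (fun x => σ (l k x)) _ x := (hσ (l k x)).comp x h1
    have h5 : HasDerivAt (fun x => σ (h k x)) _ x := (hσ (h k x)).comp x h2
    refine ((h4.fun_mul h5).fun_mul h3.sin).congr_deriv ?_
    ring
  · have hk : (0 : ℝ) < (k : ℝ) + 1 := by positivity
    refine ⟨R / 2 - 1 / ((k : ℝ) + 1), by linarith [one_div_pos.2 hk], fun x hx => ?_⟩
    rcases le_abs.1 hx with h' | h'
    · have : h k x ≤ 0 := by
        have : a + r - x ≤ 1 / ((k : ℝ) + 1) := by linarith
        rw [le_div_iff₀ hk] at this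
        simp only [h]; linarith
      simp [σ, Real.smoothTransition.zero_of_nonpos this]
    · have : l k x ≤ 0 := by
        have : x - a ≤ 1 / ((k : ℝ) + 1) := by linarith
        rw [le_div_iff₀ hk] at this
        simp only [l]; linarith
      simp [σ, Real.smoothTransition.zero_of_nonpos this]
  · have hk : (0 : ℝ) < (k : ℝ) + 1 := by positivity
    -- The transition has nonzero derivative only for `0 < w < 1`, where `(k + 1) z < 2`; this
    -- cancels the factor `k + 1`.
    have key : ∀ z w : ℝ, w = ((k : ℝ) + 1) * z - 1 → |Real.sin (ν * (x - a))| ≤ ν * |z| →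
        |((k : ℝ) + 1) * σ' w * Real.sin (ν * (x - a))| ≤ 2 * K * ν := by
      intro z w hw hz
      rcases le_or_gt w 0 with h0 | h0
      · rw [show σ' w = 0 from deriv_smoothTransition_of_nonpos h0]; simp; positivity
      rcases le_or_gt 1 w with h1 | h1
      · rw [show σ' w = 0 from deriv_smoothTransition_of_one_le h1]; simp; positivity
      have hz0 : 0 < z := by
        by_contra! hn
        nlinarith
      rw [abs_of_pos hz0] at hz
      rw [abs_mul, abs_mul, abs_of_pos hk]
      calc ((k : ℝ) + 1) * |σ' w| * |Real.sin (ν * (x - a))|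
          ≤ ((k : ℝ) + 1) * K * (ν * z) := by gcongr; exact hKb w
        _ = (((k : ℝ) + 1) * z) * (K * ν) := by ring
        _ ≤ 2 * (K * ν) := by gcongr; linarith
        _ = 2 * K * ν := by ring
    have k1 := key (x - a) (l k x) rfl (hsin₁ x)
    have k2 := key (a + r - x) (h k x) rfl (hsin₂ x)
    have hσσ : |σ (l k x) * σ (h k x)| ≤ 1 := by
      rw [abs_mul]; exact mul_le_one₀ (hσ1 _) (abs_nonneg _) (hσ1 _)
    refine ⟨?_, ?_⟩
    · rw [abs_mul]
      refine (mul_le_one₀ hσσ (abs_nonneg _) (Real.abs_sin_le_one _)).trans ?_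
      have : 0 ≤ ν * (1 + 4 * K) := by positivity
      linarith
    · have e : (((k : ℝ) + 1) * σ' (l k x) * σ (h k x) - ((k : ℝ) + 1) * σ (l k x) * σ' (h k x)) *
          Real.sin (ν * (x - a)) + σ (l k x) * σ (h k x) * (ν * Real.cos (ν * (x - a))) =
          σ (h k x) * (((k : ℝ) + 1) * σ' (l k x) * Real.sin (ν * (x - a))) -
          σ (l k x) * (((k : ℝ) + 1) * σ' (h k x) * Real.sin (ν * (x - a))) +
          (σ (l k x) * σ (h k x)) * (ν * Real.cos (ν * (x - a))) := by ring
      have b1 : |σ (h k x) * (((k : ℝ) + 1) * σ' (l k x) * Real.sin (ν * (x - a)))| ≤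
          2 * K * ν := by
        rw [abs_mul]
        exact (mul_le_of_le_one_left (abs_nonneg _) (hσ1 _)).trans k1
      have b2 : |σ (l k x) * (((k : ℝ) + 1) * σ' (h k x) * Real.sin (ν * (x - a)))| ≤
          2 * K * ν := by
        rw [abs_mul]
        exact (mul_le_of_le_one_left (abs_nonneg _) (hσ1 _)).trans k2
      have b3 : |(σ (l k x) * σ (h k x)) * (ν * Real.cos (ν * (x - a)))| ≤ ν := by
        rw [abs_mul, abs_mul ν, abs_of_pos hν0]
        refine (mul_le_of_le_one_left (by positivity) hσσ).trans ?_
        exact mul_le_of_le_one_right hν0.le (Real.abs_cos_le_one _)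
      beta_reduce
      rw [e]
      refine (abs_add_le _ _).trans ((add_le_add (abs_sub _ _) le_rfl).trans ?_)
      linarith
  · by_cases hx : x ∈ Ioo a (a + r)
    · have hlarge : ∀ z : ℝ, 0 < z → ∀ᶠ k : ℕ in Filter.atTop, 1 ≤ ((k : ℝ) + 1) * z - 1 := by
        intro z hz
        obtain ⟨n, hn⟩ := exists_nat_ge (2 / z)
        filter_upwards [Filter.eventually_ge_atTop n] with k hk
        have : (n : ℝ) ≤ k := by exact_mod_cast hk
        rw [div_le_iff₀ hz] at hn
        nlinarith
      have hev := (hlarge (x - a) (by linarith [hx.1])).and (hlarge (a + r - x) (by linarith [hx.2]))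
      constructor
      · refine tendsto_const_nhds.congr' ?_
        filter_upwards [hev] with k hk
        simp only [cellSin, indicator_of_mem hx]
        rw [show σ (l k x) = 1 from Real.smoothTransition.one_of_one_le hk.1,
          show σ (h k x) = 1 from Real.smoothTransition.one_of_one_le hk.2, one_mul, one_mul]
      · refine tendsto_const_nhds.congr' ?_
        filter_upwards [hev] with k hk
        simp only [cellCos, indicator_of_mem hx]
        rw [show σ (l k x) = 1 from Real.smoothTransition.one_of_one_le hk.1,
          show σ (h k x) = 1 from Real.smoothTransition.one_of_one_le hk.2,
          show σ' (l k x) = 0 from deriv_smoothTransition_of_one_le hk.1,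
          show σ' (h k x) = 0 from deriv_smoothTransition_of_one_le hk.2]
        ring
    · have hz : ∀ k, (σ (l k x) = 0 ∧ σ' (l k x) = 0) ∨ (σ (h k x) = 0 ∧ σ' (h k x) = 0) := by
        intro k
        have hk : (0 : ℝ) < (k : ℝ) + 1 := by positivity
        rcases not_and_or.1 hx with h' | h'
        · have : l k x ≤ 0 := by
            simp only [l]; nlinarith
          exact Or.inl ⟨Real.smoothTransition.zero_of_nonpos this,
            deriv_smoothTransition_of_nonpos this⟩
        · have : h k x ≤ 0 := by
            simp only [h]; nlinarith
          exact Or.inr ⟨Real.smoothTransition.zero_of_nonpos this,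
            deriv_smoothTransition_of_nonpos this⟩
      constructor
      · refine tendsto_const_nhds.congr fun k => ?_
        simp only [cellSin, indicator_of_notMem hx]
        rcases hz k with ⟨e1, e2⟩ | ⟨e1, e2⟩ <;> simp [e1]
      · refine tendsto_const_nhds.congr fun k => ?_
        simp only [cellCos, indicator_of_notMem hx]
        rcases hz k with ⟨e1, e2⟩ | ⟨e1, e2⟩ <;> simp [e1, e2]

/-! ### Orthogonality of the sine functions -/

theorem integral_cos_int_mul_pi {r : ℝ} (hr : 0 < r) (k : ℤ) :
    ∫ z in (0 : ℝ)..r, Real.cos (k * Real.pi / r * z) = if k = 0 then r else 0 := by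
  split_ifs with h
  · simp [h]
  · have hk : (k : ℝ) * Real.pi / r ≠ 0 := by
      have : (k : ℝ) ≠ 0 := by exact_mod_cast h
      positivity
    rw [intervalIntegral.integral_comp_mul_left (fun z => Real.cos z) hk, integral_cos,
      div_mul_cancel₀ _ hr.ne', Real.sin_int_mul_pi]
    simp

theorem integral_sin_mul_sin {r : ℝ} (hr : 0 < r) (m n : ℕ) :
    ∫ z in (0 : ℝ)..r, Real.sin (((m : ℝ) + 1) * Real.pi / r * z) *
      Real.sin (((n : ℝ) + 1) * Real.pi / r * z) = if m = n then r / 2 else 0 := by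
  have h : ∀ z : ℝ, Real.sin (((m : ℝ) + 1) * Real.pi / r * z) *
      Real.sin (((n : ℝ) + 1) * Real.pi / r * z) =
      (Real.cos (((m - n : ℤ) : ℝ) * Real.pi / r * z) -
        Real.cos (((m + n + 2 : ℤ) : ℝ) * Real.pi / r * z)) / 2 := by
    intro z
    rw [show ((m - n : ℤ) : ℝ) * Real.pi / r * z = ((m : ℝ) + 1) * Real.pi / r * z -
      ((n : ℝ) + 1) * Real.pi / r * z by push_cast; ring,
      show ((m + n + 2 : ℤ) : ℝ) * Real.pi / r * z = ((m : ℝ) + 1) * Real.pi / r * z +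
      ((n : ℝ) + 1) * Real.pi / r * z by push_cast; ring, Real.cos_sub, Real.cos_add]
    ring
  simp_rw [h]
  rw [intervalIntegral.integral_div, intervalIntegral.integral_sub
    (Continuous.intervalIntegrable (by fun_prop) _ _)
    (Continuous.intervalIntegrable (by fun_prop) _ _), integral_cos_int_mul_pi hr,
    integral_cos_int_mul_pi hr, if_neg (by omega : (m + n + 2 : ℤ) ≠ 0)]
  by_cases hmn : m = n
  · simp [hmn]
  · rw [if_neg hmn, if_neg (by omega)]; simp

theorem integral_cos_mul_cos {r : ℝ} (hr : 0 < r) (m n : ℕ) :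
    ∫ z in (0 : ℝ)..r, (((m : ℝ) + 1) * Real.pi / r * Real.cos (((m : ℝ) + 1) * Real.pi / r * z)) *
      (((n : ℝ) + 1) * Real.pi / r * Real.cos (((n : ℝ) + 1) * Real.pi / r * z)) =
      if m = n then (((m : ℝ) + 1) * Real.pi / r) ^ 2 * (r / 2) else 0 := by
  have h : ∀ z : ℝ, (((m : ℝ) + 1) * Real.pi / r * Real.cos (((m : ℝ) + 1) * Real.pi / r * z)) *
      (((n : ℝ) + 1) * Real.pi / r * Real.cos (((n : ℝ) + 1) * Real.pi / r * z)) =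
      (((m : ℝ) + 1) * Real.pi / r) * (((n : ℝ) + 1) * Real.pi / r) / 2 *
      (Real.cos (((m - n : ℤ) : ℝ) * Real.pi / r * z) +
        Real.cos (((m + n + 2 : ℤ) : ℝ) * Real.pi / r * z)) := by
    intro z
    rw [show ((m - n : ℤ) : ℝ) * Real.pi / r * z = ((m : ℝ) + 1) * Real.pi / r * z -
      ((n : ℝ) + 1) * Real.pi / r * z by push_cast; ring,
      show ((m + n + 2 : ℤ) : ℝ) * Real.pi / r * z = ((m : ℝ) + 1) * Real.pi / r * z +
      ((n : ℝ) + 1) * Real.pi / r * z by push_cast; ring, Real.cos_sub, Real.cos_add]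
    ring
  simp_rw [h]
  rw [intervalIntegral.integral_const_mul, intervalIntegral.integral_add
    (Continuous.intervalIntegrable (by fun_prop) _ _)
    (Continuous.intervalIntegrable (by fun_prop) _ _), integral_cos_int_mul_pi hr,
    integral_cos_int_mul_pi hr, if_neg (by omega : (m + n + 2 : ℤ) ≠ 0)]
  by_cases hmn : m = n
  · simp only [hmn, sub_self, if_true]; ring
  · rw [if_neg hmn, if_neg (by omega)]; simp

/-- The functions `F m`, `m ∈ ℕ`, on `]0, r[`, translated to the `i`-th cell of `]-R/2, R/2[`. -/
def cellFamily (R r : ℝ) (F : ℕ → ℝ → ℝ) (q : ℕ × ℕ) (x : ℝ) : ℝ :=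
  (Ioo (-(R / 2) + q.1 * r) (-(R / 2) + q.1 * r + r)).indicator
    (fun x => F q.2 (x - (-(R / 2) + q.1 * r))) x

section

variable {R r : ℝ} {F : ℕ → ℝ → ℝ}

theorem cellFamily_mul_of_ne (hr : 0 < r) {q q' : ℕ × ℕ} (h : q.1 ≠ q'.1) (x : ℝ) :
    cellFamily R r F q x * cellFamily R r F q' x = 0 := by
  by_contra! hne
  have h1 := mem_of_indicator_ne_zero (left_ne_zero_of_mul hne)
  have h2 := mem_of_indicator_ne_zero (right_ne_zero_of_mul hne)
  rcases lt_or_gt_of_ne h with hlt | hlt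
  · have : (q.1 : ℝ) + 1 ≤ q'.1 := by exact_mod_cast hlt
    nlinarith [h1.2, h2.1]
  · have : (q'.1 : ℝ) + 1 ≤ q.1 := by exact_mod_cast hlt
    nlinarith [h1.1, h2.2]

theorem cellFamily_mul_same (i m n : ℕ) (x : ℝ) :
    cellFamily R r F (i, m) x * cellFamily R r F (i, n) x =
      (Ioo (-(R / 2) + i * r) (-(R / 2) + i * r + r)).indicator
        (fun x => F m (x - (-(R / 2) + i * r)) * F n (x - (-(R / 2) + i * r))) x :=
  (congrFun (indicator_mul _ _ _) x).symm

theorem integrable_cellFamily_mul (hr : 0 < r) (hF : ∀ m, Continuous (F m)) (q q' : ℕ × ℕ) :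
    Integrable fun x => cellFamily R r F q x * cellFamily R r F q' x := by
  by_cases h : q.1 = q'.1
  · obtain ⟨i, m⟩ := q
    obtain ⟨i', n⟩ := q'
    obtain rfl : i = i' := h
    simp only [cellFamily_mul_same]
    rw [integrable_indicator_iff measurableSet_Ioo]
    have hm := hF m
    have hn := hF n
    refine IntegrableOn.mono_set ?_ Ioo_subset_Icc_self
    exact Continuous.integrableOn_Icc (by fun_prop)
  · simp only [cellFamily_mul_of_ne hr h]
    exact integrable_zero _ _ _

theorem integral_cellFamily_mul (hr : 0 < r) {e : ℕ → ℝ}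
    (he : ∀ m n, ∫ z in (0 : ℝ)..r, F m z * F n z = if m = n then e m else 0) (q q' : ℕ × ℕ) :
    ∫ x, cellFamily R r F q x * cellFamily R r F q' x = if q = q' then e q.2 else 0 := by
  by_cases h : q.1 = q'.1
  · obtain ⟨i, m⟩ := q
    obtain ⟨i', n⟩ := q'
    obtain rfl : i = i' := h
    simp only [cellFamily_mul_same, Prod.mk.injEq, true_and]
    rw [integral_indicator measurableSet_Ioo, ← integral_Ioc_eq_integral_Ioo,
      ← intervalIntegral.integral_of_le (by linarith), ← he]
    have := intervalIntegral.integral_comp_sub_right (a := -(R / 2) + i * r)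
      (b := -(R / 2) + i * r + r) (fun z => F m z * F n z) (-(R / 2) + i * r)
    rw [this]
    congr 1 <;> ring
  · simp only [cellFamily_mul_of_ne hr h, integral_zero]
    rw [if_neg fun hq => h (congrArg Prod.fst hq)]

end

/-! ### Products of orthogonal families in two variables -/

theorem integrable_norm_sq_product_sum {ι₁ ι₂ : Type*} (J : Finset (ι₁ × ι₂)) (c : ι₁ × ι₂ → ℂ)
    {A : ι₁ → ℝ → ℝ} {E : ι₂ → ℝ → ℝ} (hA : ∀ i i', Integrable fun x => A i x * A i' x)
    (hE : ∀ i i', Integrable fun x => E i x * E i' x) :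
    Integrable fun p : ℝ × ℝ => ‖∑ j ∈ J, c j * ((A j.1 p.1 * E j.2 p.2 : ℝ) : ℂ)‖ ^ 2 := by
  simp only [norm_sq_sum_mul_ofReal]
  refine integrable_finsetSum _ fun j _ => integrable_finsetSum _ fun l _ =>
    (((hA j.1 l.1).mul_prod (hE j.2 l.2)).congr (Filter.Eventually.of_forall fun p => ?_)).const_mul _
  simp only
  ring

theorem integral_norm_sq_product_sum {ι₁ ι₂ : Type*} [DecidableEq ι₁] [DecidableEq ι₂]
    (J : Finset (ι₁ × ι₂)) (c : ι₁ × ι₂ → ℂ) {A : ι₁ → ℝ → ℝ} {E : ι₂ → ℝ → ℝ}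
    (hA : ∀ i i', Integrable fun x => A i x * A i' x)
    (hE : ∀ i i', Integrable fun x => E i x * E i' x) {a : ι₁ → ℝ} {e : ι₂ → ℝ}
    (ha : ∀ i i', ∫ x, A i x * A i' x = if i = i' then a i else 0)
    (he : ∀ i i', ∫ x, E i x * E i' x = if i = i' then e i else 0) :
    ∫ p : ℝ × ℝ, ‖∑ j ∈ J, c j * ((A j.1 p.1 * E j.2 p.2 : ℝ) : ℂ)‖ ^ 2 =
      ∑ j ∈ J, ‖c j‖ ^ 2 * (a j.1 * e j.2) := by
  have hprod : ∀ j l : ι₁ × ι₂, Integrable fun p : ℝ × ℝ =>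
      (A j.1 p.1 * E j.2 p.2) * (A l.1 p.1 * E l.2 p.2) := fun j l =>
    ((hA j.1 l.1).mul_prod (hE j.2 l.2)).congr (Filter.Eventually.of_forall fun p => by
      simp only; ring)
  have hval : ∀ j l : ι₁ × ι₂, ∫ p : ℝ × ℝ, (A j.1 p.1 * E j.2 p.2) * (A l.1 p.1 * E l.2 p.2) =
      if j = l then a j.1 * e j.2 else 0 := by
    intro j l
    have : ∀ p : ℝ × ℝ, (A j.1 p.1 * E j.2 p.2) * (A l.1 p.1 * E l.2 p.2) =
        (A j.1 p.1 * A l.1 p.1) * (E j.2 p.2 * E l.2 p.2) := fun p => by ring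
    simp_rw [this]
    rw [Measure.volume_eq_prod, integral_prod_mul (fun x => A j.1 x * A l.1 x)
      (fun y => E j.2 y * E l.2 y), ha, he]
    by_cases h1 : j.1 = l.1 <;> by_cases h2 : j.2 = l.2 <;> simp [h1, h2, Prod.ext_iff]
  simp only [norm_sq_sum_mul_ofReal]
  rw [integral_finsetSum _ fun j _ => integrable_finsetSum _ fun l _ => (hprod j l).const_mul _]
  refine Finset.sum_congr rfl fun j hj => ?_
  rw [integral_finsetSum _ fun l _ => (hprod j l).const_mul _]
  simp_rw [integral_const_mul, hval, mul_ite, mul_zero]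
  rw [Finset.sum_ite_eq, if_pos hj, real_inner_self_eq_norm_sq]

theorem norm_add_sq_le_weighted {δ : ℝ} (hδ : 0 < δ) (z w : ℂ) :
    ‖z + w‖ ^ 2 ≤ (1 + δ) * ‖z‖ ^ 2 + (1 + 1 / δ) * ‖w‖ ^ 2 := by
  have h1 : ‖z + w‖ ^ 2 ≤ (‖z‖ + ‖w‖) ^ 2 := by gcongr; exact norm_add_le z w
  have h2 : (1 + δ) * ‖z‖ ^ 2 + (1 + 1 / δ) * ‖w‖ ^ 2 - (‖z‖ + ‖w‖) ^ 2 =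
      (δ * ‖z‖ - ‖w‖) ^ 2 / δ := by field_simp; ring
  have h3 : 0 ≤ (δ * ‖z‖ - ‖w‖) ^ 2 / δ := by positivity
  linarith

/-! ### Lattice points in a quarter of an ellipse -/

theorem integral_sqrt_one_sub_sq_zero_one : ∫ z in (0 : ℝ)..1, √(1 - z ^ 2) = Real.pi / 4 := by
  have hc : Continuous fun z : ℝ => √(1 - z ^ 2) := by fun_prop
  have h1 := integral_sqrt_one_sub_sq
  rw [← intervalIntegral.integral_add_adjacent_intervals (b := 0)
    (hc.intervalIntegrable _ _) (hc.intervalIntegrable _ _)] at h1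
  have h2 := intervalIntegral.integral_comp_neg (a := 0) (b := 1) fun z : ℝ => √(1 - z ^ 2)
  simp only [neg_sq, neg_zero] at h2
  linarith

/-- Columns of lattice points under the decreasing arc `f` are compared with the area of the quarter
ellipse. The column at abscissa `0` is discarded and costs `r₂ √E`; rounding costs at most one point
in each of fewer than `r₁ √E` columns. -/
theorem exists_lattice_points {r₁ r₂ E : ℝ} (hr₁ : 0 < r₁) (hr₂ : 0 < r₂) (hE : 0 < E) :
    ∃ L : Finset (ℕ × ℕ),
      (∀ q ∈ L, ((q.1 : ℝ) + 1) ^ 2 / r₁ ^ 2 + ((q.2 : ℝ) + 1) ^ 2 / r₂ ^ 2 < E) ∧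
      Real.pi / 4 * (r₁ * r₂ * E) - (r₁ + r₂) * √E ≤ L.card := by
  set f : ℝ → ℝ := fun x => r₂ * √(E - x ^ 2 / r₁ ^ 2) with hf
  set ρ := r₁ * √E with hρ
  have hsE : 0 < √E := Real.sqrt_pos.2 hE
  have hρ0 : 0 < ρ := by positivity
  set Q := ⌈ρ⌉₊ with hQ
  have hQ0 : 0 < Q := Nat.ceil_pos.2 hρ0
  obtain ⟨P, hP⟩ : ∃ P, Q = P + 1 := ⟨Q - 1, by omega⟩
  have hPρ : (P : ℝ) < ρ := Nat.lt_ceil.1 (by omega)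
  -- The ceiling minus one counts the positive integers strictly below `f (m + 1)`, as the strict
  -- inequality demands; likewise `P` counts those strictly below `ρ`.
  refine ⟨((Finset.range P).sigma fun m => Finset.range (⌈f (m + 1)⌉₊ - 1)).map
    (Equiv.sigmaEquivProd ℕ ℕ).toEmbedding, fun q hq => ?_, ?_⟩
  · obtain ⟨s, hs, rfl⟩ := Finset.mem_map.1 hq
    obtain ⟨-, hs2⟩ := Finset.mem_sigma.1 hs
    have hlt : ((s.2 + 1 : ℕ) : ℝ) < f (s.1 + 1) := by
      refine Nat.lt_ceil.1 ?_
      have := Finset.mem_range.1 hs2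
      omega
    push_cast at hlt
    simp only [Equiv.coe_toEmbedding, Equiv.sigmaEquivProd_apply]
    have h1 : ((s.2 : ℝ) + 1) / r₂ < √(E - ((s.1 : ℝ) + 1) ^ 2 / r₁ ^ 2) := by
      rw [div_lt_iff₀ hr₂]; rw [hf] at hlt; linarith
    rw [Real.lt_sqrt (by positivity), div_pow] at h1
    linarith
  · rw [Finset.card_map, Finset.card_sigma]
    simp only [Finset.card_range]
    have hanti : AntitoneOn f (Icc (0 : ℝ) (0 + (Q : ℕ))) := by
      intro x hx y _ hxy
      simp only [hf]
      have := hx.1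
      gcongr
    have h1 := hanti.integral_le_sum
    have hfc : Continuous f := by fun_prop
    have h2 : ∫ x in (0 : ℝ)..ρ, f x = Real.pi / 4 * (r₁ * r₂ * E) := by
      have e : ∀ z : ℝ, f (ρ * z) = r₂ * √E * √(1 - z ^ 2) := by
        intro z
        simp only [hf, hρ]
        rw [mul_assoc r₂, ← Real.sqrt_mul hE.le]
        congr 2
        rw [mul_pow, mul_pow, Real.sq_sqrt hE.le]
        field_simp
      have h := intervalIntegral.mul_integral_comp_mul_left (a := 0) (b := 1) (f := f) ρ
      rw [mul_zero, mul_one] at h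
      rw [← h]
      simp_rw [e]
      rw [intervalIntegral.integral_const_mul, integral_sqrt_one_sub_sq_zero_one, hρ]
      have := Real.mul_self_sqrt hE.le
      linear_combination (Real.pi / 4 * r₁ * r₂) * this
    have h3 : ∫ x in (0 : ℝ)..ρ, f x ≤ ∫ x in (0 : ℝ)..(0 + (Q : ℕ)), f x := by
      refine intervalIntegral.integral_mono_interval le_rfl hρ0.le ?_
        (Filter.Eventually.of_forall fun x => by simp only [hf, Pi.zero_apply]; positivity)
        (hfc.intervalIntegrable _ _)
      rw [zero_add]; exact Nat.le_ceil ρ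
    rw [hP, Finset.sum_range_succ'] at h1
    have h4 : f (0 + ((0 : ℕ) : ℝ)) = r₂ * √E := by simp [hf]
    have h5 : ∑ m ∈ Finset.range P, f (0 + ((m + 1 : ℕ) : ℝ)) - P ≤
        ((∑ m ∈ Finset.range P, (⌈f (m + 1)⌉₊ - 1) : ℕ) : ℝ) := by
      push_cast
      rw [show (P : ℝ) = ∑ m ∈ Finset.range P, (1 : ℝ) by simp, ← Finset.sum_sub_distrib]
      refine Finset.sum_le_sum fun m _ => ?_
      rw [zero_add]
      have h6 := Nat.le_ceil (f (m + 1))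
      have h7 : (⌈f (m + 1)⌉₊ : ℝ) ≤ ((⌈f (m + 1)⌉₊ - 1 : ℕ) : ℝ) + 1 := by
        exact_mod_cast (by omega : ⌈f (m + 1)⌉₊ ≤ ⌈f (m + 1)⌉₊ - 1 + 1)
      linarith
    rw [h4] at h1
    rw [hP] at h3
    have h8 : (r₁ + r₂) * √E = ρ + r₂ * √E := by rw [hρ]; ring
    linarith

/-! ### Lower bound by sine functions on small cells -/

/-- The centre of the cell of length `r` of the subdivision of `]-R/2, R/2[` that contains `x`. -/
def cellCentre (R r x : ℝ) : ℝ := -(R / 2) + (⌊(x + R / 2) / r⌋ + 1 / 2) * r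

theorem cellCentre_of_mem {R r x : ℝ} (hr : 0 < r) {i : ℕ}
    (hx : x ∈ Ioo (-(R / 2) + i * r) (-(R / 2) + i * r + r)) :
    cellCentre R r x = -(R / 2) + (i + 1 / 2) * r := by
  have : ⌊(x + R / 2) / r⌋ = (i : ℤ) := by
    rw [Int.floor_eq_iff, le_div_iff₀ hr, div_lt_iff₀ hr]
    push_cast
    constructor <;> linarith [hx.1, hx.2]
  rw [cellCentre, this]
  push_cast
  ring

theorem abs_cellCentre_sub_le {R r : ℝ} (hr : 0 < r) (x : ℝ) : |cellCentre R r x - x| ≤ r / 2 := by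
  have h1 := Int.floor_le ((x + R / 2) / r)
  have h2 := (Int.lt_floor_add_one ((x + R / 2) / r)).le
  rw [le_div_iff₀ hr] at h1
  rw [div_le_iff₀ hr] at h2
  rw [cellCentre, abs_le]
  constructor <;> nlinarith

/-- The Dirichlet sine functions of the cells of length `r` of `]-R/2, R/2[`. -/
def sineFamily (R r : ℝ) : ℕ × ℕ → ℝ → ℝ :=
  cellFamily R r fun m z => Real.sin (((m : ℝ) + 1) * Real.pi / r * z)

/-- The derivatives of the functions of `sineFamily`. -/
def cosineFamily (R r : ℝ) : ℕ × ℕ → ℝ → ℝ :=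
  cellFamily R r fun m z => ((m : ℝ) + 1) * Real.pi / r * Real.cos (((m : ℝ) + 1) * Real.pi / r * z)

section

variable {R r : ℝ}

theorem integrable_sineFamily_mul (hr : 0 < r) (q q' : ℕ × ℕ) :
    Integrable fun x => sineFamily R r q x * sineFamily R r q' x :=
  integrable_cellFamily_mul hr (fun m => by fun_prop) q q'

theorem integrable_cosineFamily_mul (hr : 0 < r) (q q' : ℕ × ℕ) :
    Integrable fun x => cosineFamily R r q x * cosineFamily R r q' x :=
  integrable_cellFamily_mul hr (fun m => by fun_prop) q q'

theorem integral_sineFamily_mul (hr : 0 < r) (q q' : ℕ × ℕ) :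
    ∫ x, sineFamily R r q x * sineFamily R r q' x = if q = q' then r / 2 else 0 :=
  integral_cellFamily_mul hr (integral_sin_mul_sin hr) q q'

theorem integral_cosineFamily_mul (hr : 0 < r) (q q' : ℕ × ℕ) :
    ∫ x, cosineFamily R r q x * cosineFamily R r q' x =
      if q = q' then (((q.2 : ℝ) + 1) * Real.pi / r) ^ 2 * (r / 2) else 0 :=
  integral_cellFamily_mul hr (e := fun m => (((m : ℝ) + 1) * Real.pi / r) ^ 2 * (r / 2))
    (integral_cos_mul_cos hr) q q'

theorem cell_subset {p : ℕ} (hp : p * r = R) (hr : 0 < r) {i : ℕ} (hi : i < p) :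
    -(R / 2) ≤ -(R / 2) + i * r ∧ -(R / 2) + i * r + r ≤ R / 2 := by
  have : (i : ℝ) + 1 ≤ p := by exact_mod_cast hi
  constructor <;> nlinarith [(Nat.cast_nonneg i : (0 : ℝ) ≤ i)]

theorem cellFamily_eq_zero {F : ℕ → ℝ → ℝ} {p : ℕ} (hp : p * r = R) (hr : 0 < r) {q : ℕ × ℕ}
    (hq : q.1 < p) {x : ℝ} (hx : x ∉ Ioo (-(R / 2)) (R / 2)) : cellFamily R r F q x = 0 := by
  refine indicator_of_notMem (fun h => hx ?_) _
  have := cell_subset hp hr hq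
  exact ⟨by linarith [h.1], by linarith [h.2]⟩

end

/-- If the Dirichlet eigenvalues `π²((m+1)²/r₁² + (n+1)²/r₂²)` of small cells, corrected for the
field, are below `t`, they contribute to the number of eigenvalues below `t`. -/
theorem card_le_finrank_lowSpace_of_sines {b R₁ R₂ r₁ r₂ δ t : ℝ} {p₁ p₂ : ℕ} (hb : 0 < b)
    (hR₁ : 0 < R₁) (hR₂ : 0 < R₂) (hr₁ : 0 < r₁) (hr₂ : 0 < r₂) (hp₁ : p₁ * r₁ = R₁)
    (hp₂ : p₂ * r₂ = R₂) (hδ : 0 < δ) (J : Finset ((ℕ × ℕ) × (ℕ × ℕ)))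
    (hJ₁ : ∀ j ∈ J, j.1.1 < p₁) (hJ₂ : ∀ j ∈ J, j.2.1 < p₂)
    (hJt : ∀ j ∈ J, (1 + δ) * ((((j.1.2 : ℝ) + 1) * Real.pi / r₁) ^ 2 +
      (((j.2.2 : ℝ) + 1) * Real.pi / r₂) ^ 2) +
      (1 + 1 / δ) * ((b * r₁ / 4) ^ 2 + (b * r₂ / 4) ^ 2) < t) :
    J.card ≤ Module.finrank ℂ (lowSpace (formGraph b (rectangle R₁ R₂)) t) := by
  set Ω := rectangle R₁ R₂ with hΩ
  -- One unimodular function with the gauge centred separately in every cell. It jumps across cell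
  -- edges, but it only multiplies functions that vanish there, and it drops out of all norms.
  let P : ℝ × ℝ → ℂ := fun p =>
    Complex.exp ((centrePhase b (cellCentre R₁ r₁ p.1) (cellCentre R₂ r₂ p.2) p : ℂ) * Complex.I)
  have hP : ∀ p, ‖P p‖ = 1 := fun p => Complex.norm_exp_ofReal_mul_I _
  let V : ℝ × ℝ → ℝ := fun p => b * cellCentre R₂ r₂ p.2 / 2 - b * p.2 / 2
  let W : ℝ × ℝ → ℝ := fun p => -(b * cellCentre R₁ r₁ p.1 / 2) + b * p.1 / 2
  let S := sineFamily R₁ r₁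
  let S' := cosineFamily R₁ r₁
  let T := sineFamily R₂ r₂
  let T' := cosineFamily R₂ r₂
  have hV : ∀ p, |V p| ≤ b * r₂ / 4 := fun p => by
    have e : V p = b / 2 * (cellCentre R₂ r₂ p.2 - p.2) := by simp only [V]; ring
    rw [e, abs_mul, abs_of_pos (by positivity)]
    have := mul_le_mul_of_nonneg_left (abs_cellCentre_sub_le (R := R₂) hr₂ p.2)
      (by positivity : 0 ≤ b / 2)
    linarith
  have hW : ∀ p, |W p| ≤ b * r₁ / 4 := fun p => by
    have e : W p = -(b / 2 * (cellCentre R₁ r₁ p.1 - p.1)) := by simp only [W]; ring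
    rw [e, abs_neg, abs_mul, abs_of_pos (by positivity)]
    have := mul_le_mul_of_nonneg_left (abs_cellCentre_sub_le (R := R₁) hr₁ p.1)
      (by positivity : 0 ≤ b / 2)
    linarith
  have hex : ∀ j : (ℕ × ℕ) × (ℕ × ℕ), ∃ w : L2 Ω × L2 Ω × L2 Ω, j ∈ J → w ∈ formGraph b Ω ∧
      (w.1 =ᵐ[volume.restrict Ω] fun p => P p * ((S j.1 p.1 * T j.2 p.2 : ℝ) : ℂ)) ∧
      (w.2.1 =ᵐ[volume.restrict Ω] fun p => P p *
        ((1 / Complex.I) * ((S' j.1 p.1 * T j.2 p.2 : ℝ) : ℂ) +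
          (V p : ℂ) * ((S j.1 p.1 * T j.2 p.2 : ℝ) : ℂ))) ∧
      (w.2.2 =ᵐ[volume.restrict Ω] fun p => P p *
        ((1 / Complex.I) * ((S j.1 p.1 * T' j.2 p.2 : ℝ) : ℂ) +
          (W p : ℂ) * ((S j.1 p.1 * T j.2 p.2 : ℝ) : ℂ))) := by
    intro j
    by_cases hj : j ∈ J
    swap
    · exact ⟨0, fun h => absurd h hj⟩
    obtain ⟨a₁, b₁⟩ := cell_subset hp₁ hr₁ (hJ₁ j hj)
    obtain ⟨a₂, b₂⟩ := cell_subset hp₂ hr₂ (hJ₂ j hj)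
    obtain ⟨w, hw, h0, hX, hY⟩ := (isDirichletProfile_cellSin hr₁ a₁ b₁ j.1.2).exists_mem_formGraph
      (isDirichletProfile_cellSin hr₂ a₂ b₂ j.2.2) b (-(R₁ / 2) + (j.1.1 + 1 / 2) * r₁)
      (-(R₂ / 2) + (j.2.1 + 1 / 2) * r₂)
    -- Either the point lies in the cell of `j`, where the cellwise centre is the right one, or the
    -- trial function and its derivatives vanish and the phase is irrelevant.
    have hcase : ∀ p : ℝ × ℝ, (cellCentre R₁ r₁ p.1 = -(R₁ / 2) + (j.1.1 + 1 / 2) * r₁ ∧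
        cellCentre R₂ r₂ p.2 = -(R₂ / 2) + (j.2.1 + 1 / 2) * r₂) ∨
        (cellSin (-(R₁ / 2) + j.1.1 * r₁) r₁ j.1.2 p.1 = 0 ∧
          cellCos (-(R₁ / 2) + j.1.1 * r₁) r₁ j.1.2 p.1 = 0) ∨
        (cellSin (-(R₂ / 2) + j.2.1 * r₂) r₂ j.2.2 p.2 = 0 ∧
          cellCos (-(R₂ / 2) + j.2.1 * r₂) r₂ j.2.2 p.2 = 0) := by
      intro p
      by_cases h1 : p.1 ∈ Ioo (-(R₁ / 2) + j.1.1 * r₁) (-(R₁ / 2) + j.1.1 * r₁ + r₁)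
      · by_cases h2 : p.2 ∈ Ioo (-(R₂ / 2) + j.2.1 * r₂) (-(R₂ / 2) + j.2.1 * r₂ + r₂)
        · exact Or.inl ⟨cellCentre_of_mem hr₁ h1, cellCentre_of_mem hr₂ h2⟩
        · exact Or.inr (Or.inr ⟨indicator_of_notMem h2 _, indicator_of_notMem h2 _⟩)
      · exact Or.inr (Or.inl ⟨indicator_of_notMem h1 _, indicator_of_notMem h1 _⟩)
    have eS : ∀ x, S j.1 x = cellSin (-(R₁ / 2) + j.1.1 * r₁) r₁ j.1.2 x := fun _ => rfl
    have eT : ∀ x, T j.2 x = cellSin (-(R₂ / 2) + j.2.1 * r₂) r₂ j.2.2 x := fun _ => rfl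
    have eS' : ∀ x, S' j.1 x = cellCos (-(R₁ / 2) + j.1.1 * r₁) r₁ j.1.2 x := fun _ => rfl
    have eT' : ∀ x, T' j.2 x = cellCos (-(R₂ / 2) + j.2.1 * r₂) r₂ j.2.2 x := fun _ => rfl
    refine ⟨w, fun _ => ⟨hw, h0.trans (Filter.EventuallyEq.of_eq ?_),
      hX.trans (Filter.EventuallyEq.of_eq ?_), hY.trans (Filter.EventuallyEq.of_eq ?_)⟩⟩ <;>
    · funext p
      simp only [eS, eT, eS', eT', P, V, W]
      rcases hcase p with ⟨e1, e2⟩ | ⟨e1, e2⟩ | ⟨e1, e2⟩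
      · rw [e1, e2]; push_cast; ring
      · simp [e1, e2]
      · simp [e1, e2]
  choose w hw using hex
  have hcard := card_le_card_mul_finrank_lowSpace (t := t) (formCompact_rectangle hb hR₁ hR₂)
    (Submodule.isClosed_topologicalClosure _) J ({()} : Finset Unit) (fun _ j => w j)
    (fun _ j hj => (hw j hj).1) (fun c hc => ?_)
  · simpa using hcard
  obtain ⟨j₀, hj₀, hcj₀⟩ := hc
  rw [Finset.sum_singleton, Finset.sum_singleton]
  have hzero : ∀ p : ℝ × ℝ, p ∉ Ω → ‖∑ j ∈ J, c j *
      ((sineFamily R₁ r₁ j.1 p.1 * sineFamily R₂ r₂ j.2 p.2 : ℝ) : ℂ)‖ ^ 2 = 0 := by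
    intro p hp
    rw [Finset.sum_eq_zero fun j hj => ?_]
    · simp
    · by_cases h1 : p.1 ∈ Ioo (-(R₁ / 2)) (R₁ / 2)
      · have : sineFamily R₂ r₂ j.2 p.2 = 0 :=
          cellFamily_eq_zero hp₂ hr₂ (hJ₂ j hj) fun h2 => hp ⟨h1, h2⟩
        simp [this]
      · have : sineFamily R₁ r₁ j.1 p.1 = 0 := cellFamily_eq_zero hp₁ hr₁ (hJ₁ j hj) h1
        simp [this]
  have hint0 := integrable_norm_sq_product_sum J c (integrable_sineFamily_mul (R := R₁) hr₁)
    (integrable_sineFamily_mul (R := R₂) hr₂)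
  have hintX := integrable_norm_sq_product_sum J c (integrable_cosineFamily_mul (R := R₁) hr₁)
    (integrable_sineFamily_mul (R := R₂) hr₂)
  have hintY := integrable_norm_sq_product_sum J c (integrable_sineFamily_mul (R := R₁) hr₁)
    (integrable_cosineFamily_mul (R := R₂) hr₂)
  have n0 : ‖(∑ j ∈ J, c j • w j).1‖ ^ 2 = ∑ j ∈ J, ‖c j‖ ^ 2 * (r₁ / 2 * (r₂ / 2)) := by
    rw [← integral_norm_sq_product_sum J c (integrable_sineFamily_mul (R := R₁) hr₁)
      (integrable_sineFamily_mul (R := R₂) hr₂) (integral_sineFamily_mul hr₁)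
      (integral_sineFamily_mul hr₂),
      ← setIntegral_eq_integral_of_forall_compl_eq_zero (s := Ω) (fun p hp => hzero p hp),
      Prod.fst_sum]
    refine (norm_sq_eq_integral (coeFn_sum_smul J c fun j hj => (hw j hj).2.1)).trans ?_
    congr 1; funext p
    simp only [mul_left_comm (c _) (P p), ← Finset.mul_sum]
    rw [norm_mul, hP, one_mul]
  -- The derivative part stays orthogonal over `J` and is weighted by `1 + δ`. The centred
  -- potential, which mixes the modes, is bounded crudely by its maximum and weighted by `1 + 1/δ`.
  have hmomentum : ∀ {u : L2 Ω} {B : ℝ} {U : ℝ × ℝ → ℝ} {F₁ F₂ : ℕ → ℝ → ℝ},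
      0 ≤ B → (∀ p, |U p| ≤ B) →
      Integrable (fun p : ℝ × ℝ => ‖∑ j ∈ J, c j *
        ((cellFamily R₁ r₁ F₁ j.1 p.1 * cellFamily R₂ r₂ F₂ j.2 p.2 : ℝ) : ℂ)‖ ^ 2) →
      (u =ᵐ[volume.restrict Ω] fun p => ∑ j ∈ J, c j * (P p * ((1 / Complex.I) *
        ((cellFamily R₁ r₁ F₁ j.1 p.1 * cellFamily R₂ r₂ F₂ j.2 p.2 : ℝ) : ℂ) +
          (U p : ℂ) * ((S j.1 p.1 * T j.2 p.2 : ℝ) : ℂ)))) →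
      ‖u‖ ^ 2 ≤ (1 + δ) * (∫ p : ℝ × ℝ, ‖∑ j ∈ J, c j *
        ((cellFamily R₁ r₁ F₁ j.1 p.1 * cellFamily R₂ r₂ F₂ j.2 p.2 : ℝ) : ℂ)‖ ^ 2) +
        (1 + 1 / δ) * B ^ 2 * ∑ j ∈ J, ‖c j‖ ^ 2 * (r₁ / 2 * (r₂ / 2)) := by
    intro u B U F₁ F₂ hB hU hinteg hu
    rw [← integral_norm_sq_product_sum J c (integrable_sineFamily_mul (R := R₁) hr₁)
      (integrable_sineFamily_mul (R := R₂) hr₂) (integral_sineFamily_mul hr₁)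
      (integral_sineFamily_mul hr₂), norm_sq_eq_integral hu, ← integral_const_mul,
      ← integral_const_mul, ← integral_add (hinteg.const_mul _) (hint0.const_mul _)]
    refine le_trans ?_ (setIntegral_le_integral (s := Ω)
      ((hinteg.const_mul (1 + δ)).add (hint0.const_mul ((1 + 1 / δ) * B ^ 2)))
      (Filter.Eventually.of_forall fun p => by simp only [Pi.zero_apply]; positivity))
    refine integral_mono_of_nonneg (Filter.Eventually.of_forall fun p => by
        simp only [Pi.zero_apply]; positivity)
      ((hinteg.const_mul (1 + δ)).add (hint0.const_mul ((1 + 1 / δ) * B ^ 2))).integrableOn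
      (Filter.Eventually.of_forall fun p => ?_)
    have e : ∑ j ∈ J, c j * (P p * ((1 / Complex.I) *
        ((cellFamily R₁ r₁ F₁ j.1 p.1 * cellFamily R₂ r₂ F₂ j.2 p.2 : ℝ) : ℂ) +
          (U p : ℂ) * ((S j.1 p.1 * T j.2 p.2 : ℝ) : ℂ))) = P p * ((1 / Complex.I) *
        (∑ j ∈ J, c j *
          ((cellFamily R₁ r₁ F₁ j.1 p.1 * cellFamily R₂ r₂ F₂ j.2 p.2 : ℝ) : ℂ)) +
        (U p : ℂ) * ∑ j ∈ J, c j * ((S j.1 p.1 * T j.2 p.2 : ℝ) : ℂ)) := by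
      simp only [Finset.mul_sum, ← Finset.sum_add_distrib]
      exact Finset.sum_congr rfl fun j _ => by ring
    beta_reduce
    rw [e, norm_mul, hP, one_mul]
    refine (norm_add_sq_le_weighted hδ _ _).trans ?_
    rw [norm_mul, norm_mul, norm_div, norm_one, Complex.norm_I, div_one, one_mul,
      Complex.norm_real, Real.norm_eq_abs, mul_pow |U p|, mul_assoc _ (B ^ 2)]
    gcongr
    exact hU p
  have nX := hmomentum (by positivity) hV hintX
    (coeFn_sum_smul J c fun j hj => (hw j hj).2.2.1)
  have nY := hmomentum (by positivity) hW hintY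
    (coeFn_sum_smul J c fun j hj => (hw j hj).2.2.2)
  have iX := integral_norm_sq_product_sum J c (integrable_cosineFamily_mul (R := R₁) hr₁)
    (integrable_sineFamily_mul (R := R₂) hr₂) (integral_cosineFamily_mul hr₁)
    (integral_sineFamily_mul hr₂)
  have iY := integral_norm_sq_product_sum J c (integrable_sineFamily_mul (R := R₁) hr₁)
    (integrable_cosineFamily_mul (R := R₂) hr₂) (integral_sineFamily_mul hr₁)
    (integral_cosineFamily_mul hr₂)
  unfold cosineFamily sineFamily at iX iY
  rw [iX] at nX
  rw [iY] at nY
  have hen : energy (∑ j ∈ J, c j • w j) ≤ ∑ j ∈ J, ((1 + δ) *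
      ((((j.1.2 : ℝ) + 1) * Real.pi / r₁) ^ 2 + (((j.2.2 : ℝ) + 1) * Real.pi / r₂) ^ 2) +
      (1 + 1 / δ) * ((b * r₁ / 4) ^ 2 + (b * r₂ / 4) ^ 2)) *
      (‖c j‖ ^ 2 * (r₁ / 2 * (r₂ / 2))) := by
    rw [energy, Prod.snd_sum, Prod.fst_sum, Prod.snd_sum]
    refine (add_le_add nX nY).trans_eq ?_
    simp only [Finset.mul_sum, ← Finset.sum_add_distrib]
    exact Finset.sum_congr rfl fun j _ => by ring
  refine hen.trans_lt ?_
  rw [n0, Finset.mul_sum]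
  refine Finset.sum_lt_sum (fun j hj => mul_le_mul_of_nonneg_right (hJt j hj).le (by positivity))
    ⟨j₀, hj₀, mul_lt_mul_of_pos_right (hJt j₀ hj₀) (by positivity)⟩

/-! ### Weyl bounds -/

/-- The lower bound in Weyl's law, with a remainder uniform in the field. -/
theorem weyl_lower_bound {c₀ b R₁ R₂ t : ℝ} (hc₀ : 0 < c₀) (hb : 0 < b) (hbt : b ≤ t)
    (hR₁ : 0 < R₁) (hR₂ : 0 < R₂) (h₁ : 1 ≤ c₀ * √b * R₁) (h₂ : 1 ≤ c₀ * √b * R₂) :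
    R₁ * R₂ / (4 * Real.pi) * t * (1 - (2 + 8 * (1 + c₀)) * (√b / √t)) ≤
      Module.finrank ℂ (lowSpace (formGraph b (rectangle R₁ R₂)) t) := by
  have hπ := Real.pi_pos
  have ht : 0 < t := hb.trans_le hbt
  have hsb : 0 < √b := Real.sqrt_pos.2 hb
  have hst : 0 < √t := Real.sqrt_pos.2 ht
  have hsb2 := Real.sq_sqrt hb.le
  have hst2 := Real.sq_sqrt ht.le
  set δ := √b / √t with hδdef
  have hδ : 0 < δ := by positivity
  have hbδ : √b = δ * √t := by rw [hδdef]; field_simp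
  have hb2 : b = δ ^ 2 * t := by rw [← hsb2, hbδ, mul_pow, hst2]
  set C := 2 + 8 * (1 + c₀) with hC
  -- When the bracket is not positive there is nothing to prove; otherwise `C ≥ 2` forces `δ ≤ 1/2`.
  rcases le_or_gt (1 - C * δ) 0 with hneg | hpos
  · refine le_trans ?_ (Nat.cast_nonneg _)
    exact mul_nonpos_of_nonneg_of_nonpos (by positivity) hneg
  have hδ1 : δ ≤ 1 / 2 := by nlinarith
  -- With `⌈√b R⌉` cells the side is at most `b^(-1/2)`, and the hypothesis on `c₀` absorbs the
  -- rounding into the factor `1 + c₀`.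
  have hcell : ∀ R : ℝ, 0 < R → 1 ≤ c₀ * √b * R → ∃ (p : ℕ) (r : ℝ), 0 < r ∧ p * r = R ∧
      (p : ℝ) ≤ (1 + c₀) * √b * R ∧ (b * r / 4) ^ 2 ≤ b / 16 := by
    intro R hR h
    have hp : 0 < ⌈√b * R⌉₊ := Nat.ceil_pos.2 (by positivity)
    have hp' : (0 : ℝ) < ⌈√b * R⌉₊ := by exact_mod_cast hp
    refine ⟨⌈√b * R⌉₊, R / ⌈√b * R⌉₊, by positivity, by field_simp, ?_, ?_⟩
    · have := (Nat.ceil_lt_add_one (by positivity : 0 ≤ √b * R)).le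
      linarith
    · have h1 : √b * (R / ⌈√b * R⌉₊) ≤ 1 := by
        rw [← mul_div_assoc, div_le_one hp']
        exact Nat.le_ceil _
      have h2 : (√b * (R / ⌈√b * R⌉₊)) ^ 2 ≤ 1 := pow_le_one₀ (by positivity) h1
      rw [mul_pow, hsb2] at h2
      nlinarith
  obtain ⟨p₁, r₁, hr₁, hp₁, hpb₁, hV₁⟩ := hcell R₁ hR₁ h₁
  obtain ⟨p₂, r₂, hr₂, hp₂, hpb₂, hV₂⟩ := hcell R₂ hR₂ h₂
  -- The largest Dirichlet energy allowed in a cell: by `b = δ² t` it solves `(1 + δ) μ + (1 + 1/δ)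
  -- b / 8 = t`, where `b / 8` bounds the two centred potentials together.
  set μ := t / (1 + δ) - t * δ / 8 with hμ
  have hμ1 : (1 + δ) * μ + (1 + 1 / δ) * (b / 8) = t := by
    rw [hμ, hb2]; field_simp; ring
  have hμlow : t * (1 - 2 * δ) ≤ μ := by
    have : t * (1 - δ) ≤ t / (1 + δ) := by
      rw [le_div_iff₀ (by positivity)]
      nlinarith [mul_pos ht (pow_pos hδ 2)]
    rw [hμ]
    nlinarith [mul_pos ht hδ]
  have hμup : μ ≤ t := by
    have : t / (1 + δ) ≤ t := div_le_self ht.le (by linarith)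
    rw [hμ]
    nlinarith [mul_pos ht hδ]
  have hμ0 : 0 < μ := by
    refine lt_of_lt_of_le (mul_pos ht ?_) hμlow
    nlinarith
  obtain ⟨L, hL, hLcard⟩ := exists_lattice_points (E := μ / Real.pi ^ 2) hr₁ hr₂ (by positivity)
  let J : Finset ((ℕ × ℕ) × (ℕ × ℕ)) := ((Finset.range p₁ ×ˢ Finset.range p₂) ×ˢ L).map
    (Equiv.prodProdProdComm ℕ ℕ ℕ ℕ).toEmbedding
  have hJ : ∀ j ∈ J, (j.1.1 < p₁ ∧ j.2.1 < p₂) ∧ (j.1.2, j.2.2) ∈ L := by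
    intro j hj
    obtain ⟨s, hs, rfl⟩ := Finset.mem_map.1 hj
    simpa using hs
  have hcard := card_le_finrank_lowSpace_of_sines (t := t) hb hR₁ hR₂ hr₁ hr₂ hp₁ hp₂ hδ J
    (fun j hj => (hJ j hj).1.1) (fun j hj => (hJ j hj).1.2) (fun j hj => by
      have h := hL _ (hJ j hj).2
      rw [lt_div_iff₀ (by positivity)] at h
      have e : (((j.1.2 : ℝ) + 1) * Real.pi / r₁) ^ 2 + (((j.2.2 : ℝ) + 1) * Real.pi / r₂) ^ 2 =
          (((j.1.2 : ℝ) + 1) ^ 2 / r₁ ^ 2 + ((j.2.2 : ℝ) + 1) ^ 2 / r₂ ^ 2) * Real.pi ^ 2 := by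
        ring
      have h3 : (1 + 1 / δ) * ((b * r₁ / 4) ^ 2 + (b * r₂ / 4) ^ 2) ≤ (1 + 1 / δ) * (b / 8) :=
        mul_le_mul_of_nonneg_left (by linarith) (by positivity)
      rw [e]
      have h4 := mul_lt_mul_of_pos_left h (by positivity : 0 < 1 + δ)
      linarith)
  have hJcard : (J.card : ℝ) = p₁ * p₂ * L.card := by
    simp [J, Finset.card_map, Finset.card_product]
  have hsqrt : √(μ / Real.pi ^ 2) ≤ √t / Real.pi := by
    refine Real.sqrt_le_iff.2 ⟨by positivity, ?_⟩
    rw [div_pow, hst2]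
    gcongr
  have hsum : (p₁ : ℝ) * p₂ * (r₁ + r₂) ≤ 2 * (1 + c₀) * √b * (R₁ * R₂) := by
    have e : (p₁ : ℝ) * p₂ * (r₁ + r₂) = p₂ * R₁ + p₁ * R₂ := by rw [← hp₁, ← hp₂]; ring
    have k1 := mul_le_mul_of_nonneg_right hpb₂ hR₁.le
    have k2 := mul_le_mul_of_nonneg_right hpb₁ hR₂.le
    rw [e]
    linarith
  -- In `C`, the `2` is the loss from `t` to `μ`, and `8 (1 + c₀)` is the total lattice remainder
  -- over all cells, relative to the leading term.
  calc R₁ * R₂ / (4 * Real.pi) * t * (1 - C * δ)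
      = R₁ * R₂ / (4 * Real.pi) * (t * (1 - 2 * δ)) -
          2 * (1 + c₀) * (δ * √t) * (R₁ * R₂) * (√t / Real.pi) := by
        rw [hC]
        have : √t * √t = t := Real.mul_self_sqrt ht.le
        linear_combination (2 * (1 + c₀) * δ * (R₁ * R₂) / Real.pi) * this
    _ ≤ R₁ * R₂ / (4 * Real.pi) * μ -
          (p₁ : ℝ) * p₂ * (r₁ + r₂) * √(μ / Real.pi ^ 2) := by
        rw [hbδ] at hsum
        have k1 := mul_le_mul hsum hsqrt (Real.sqrt_nonneg _) (by positivity)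
        have k2 := mul_le_mul_of_nonneg_left hμlow
          (by positivity : 0 ≤ R₁ * R₂ / (4 * Real.pi))
        linarith
    _ = p₁ * p₂ * (Real.pi / 4 * (r₁ * r₂ * (μ / Real.pi ^ 2)) -
          (r₁ + r₂) * √(μ / Real.pi ^ 2)) := by
        rw [← hp₁, ← hp₂]
        field_simp
    _ ≤ p₁ * p₂ * L.card := by gcongr
    _ ≤ _ := by rw [← hJcard]; exact_mod_cast hcard

/-- The upper bound in Weyl's law, with a remainder uniform in the field. -/
theorem weyl_upper_bound {b R₁ R₂ t : ℝ} (hb : 0 < b) (hbt : b ≤ t) (hR₁ : 0 < R₁)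
    (hR₂ : 0 < R₂) :
    (Module.finrank ℂ (lowSpace (formGraph b (rectangle R₁ R₂)) t) : ℝ) ≤
      R₁ * R₂ / (4 * Real.pi) * t * (1 + √b / √t) := by
  have ht : 0 < t := hb.trans_le hbt
  have hπ := Real.pi_pos
  have hst : 0 < √t := Real.sqrt_pos.2 ht
  refine (finrank_lowSpace_le hb ht.le hR₁ hR₂).trans ?_
  have h1 : (landauCount b t : ℝ) ≤ (t / b + 1) / 2 := by
    rw [landauCount_eq_ceil hb]
    have h0 : 0 ≤ (t / b - 1) / 2 := by
      have : 1 ≤ t / b := (one_le_div hb).2 hbt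
      linarith
    linarith [Nat.ceil_lt_add_one h0]
  -- The right side is the geometric mean of `b` and `t`; this turns the additive excess `b` into
  -- the relative error `√(b/t)`.
  have h2 : b ≤ t * (√b / √t) := by
    have e : t * (√b / √t) = √t * √b := by
      nth_rewrite 1 [← Real.mul_self_sqrt ht.le]; field_simp
    rw [e]
    calc b = √b * √b := (Real.mul_self_sqrt hb.le).symm
      _ ≤ √t * √b := by gcongr
  calc b * (R₁ * R₂) / (2 * Real.pi) * landauCount b t
      ≤ b * (R₁ * R₂) / (2 * Real.pi) * ((t / b + 1) / 2) := by gcongr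
    _ = R₁ * R₂ / (4 * Real.pi) * (t + b) := by field_simp; ring
    _ ≤ R₁ * R₂ / (4 * Real.pi) * (t + t * (√b / √t)) := by gcongr
    _ = _ := by ring

end MagneticRectangle

end

/-! ### Assembly of the three statements -/

theorem theoremA2 :
    (∀ b R₁ R₂ t : ℝ, 0 < b → 0 < R₁ → 0 < R₂ → 1 < t →
      eigenvalueCount (dirichletOperator b (rectangle R₁ R₂)) t ≤
        ENNReal.ofReal
          (b * volume.real (rectangle R₁ R₂) / (2 * Real.pi) * (landauCount b t : ℝ))) ∧
    (∃ C₀ : ℝ, 0 < C₀ ∧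
      ∀ b R₁ R₂ t : ℝ, 0 < b → b < t → 0 < R₁ → 0 < R₂ → 1 ≤ √b * min R₁ R₂ →
      ∀ ε : ℝ, 0 < ε → ε ≤ 1 →
        ENNReal.ofReal
          ((1 - ε) ^ 2 * (b * volume.real (rectangle R₁ R₂) / (2 * Real.pi)) *
            (landauCount b (t - C₀ / (ε * min R₁ R₂) ^ 2) : ℝ)) ≤
          eigenvalueCount (dirichletOperator b (rectangle R₁ R₂)) t) ∧
    (∀ c₀ : ℝ, 0 < c₀ → ∃ C₀ : ℝ, 0 < C₀ ∧
      ∀ b R₁ R₂ t : ℝ, 0 ≤ b → b ≤ t → 0 < R₁ → 0 < R₂ →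
        1 ≤ c₀ * √b * R₁ → 1 ≤ c₀ * √b * R₂ →
        ENNReal.ofReal
          (volume.real (rectangle R₁ R₂) / (4 * Real.pi) * t * (1 - C₀ * (√b / √t))) ≤
          eigenvalueCount (dirichletOperator b (rectangle R₁ R₂)) t ∧
        eigenvalueCount (dirichletOperator b (rectangle R₁ R₂)) t ≤
          ENNReal.ofReal
            (volume.real (rectangle R₁ R₂) / (4 * Real.pi) * t * (1 + C₀ * (√b / √t)))) := by
  refine ⟨fun b R₁ R₂ t hb hR₁ hR₂ ht => ?_, ?_, fun c₀ hc₀ => ?_⟩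
  · rw [eigenvalueCount_rectangle hb hR₁ hR₂, volume_real_rectangle hR₁ hR₂]
    exact ENNReal.ofReal_le_ofReal (finrank_lowSpace_le hb (by linarith) hR₁ hR₂)
  · obtain ⟨C₀, hC₀, h⟩ := exists_landau_lower_bound
    refine ⟨C₀, hC₀, fun b R₁ R₂ t hb hbt hR₁ hR₂ _ ε hε hε1 => ?_⟩
    rw [eigenvalueCount_rectangle hb hR₁ hR₂, volume_real_rectangle hR₁ hR₂]
    exact ENNReal.ofReal_le_ofReal (h b R₁ R₂ t hb (hb.trans hbt) hR₁ hR₂ ε hε hε1)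
  -- The constant is dictated by the lower bound, since the upper bound holds with `1`. The case `b
  -- = 0` is excluded by the lower bound on `√b R₁`.
  · refine ⟨2 + 8 * (1 + c₀), by positivity, fun b R₁ R₂ t hb0 hbt hR₁ hR₂ h₁ h₂ => ?_⟩
    have hb : 0 < b := by
      refine hb0.lt_of_ne fun h => ?_
      rw [← h, Real.sqrt_zero] at h₁
      norm_num at h₁
    have ht : 0 < t := hb.trans_le hbt
    rw [eigenvalueCount_rectangle hb hR₁ hR₂, volume_real_rectangle hR₁ hR₂]
    refine ⟨ENNReal.ofReal_le_ofReal (weyl_lower_bound hc₀ hb hbt hR₁ hR₂ h₁ h₂),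
      ENNReal.ofReal_le_ofReal ((weyl_upper_bound hb hbt hR₁ hR₂).trans ?_)⟩
    have : 0 ≤ √b / √t := by positivity
    gcongr
    nlinarith
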